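/- Let $0<b\le\infty$ and let $R_1,R_2$ be non-decreasing left-continuous functions on $[0,b)$ with $R_1(0)=R_2(0)=0$, with Lebesgue--Stieltjes measures $dR_1,dR_2$ on $[0,b)$ determined by $dR_i[x,y)=R_i(y)-R_i(x)$. Assume that $R_1$ and $R_2$ have no common points of discontinuity and that for some $[0,b_0)\subseteq[0,b)$ the functions $1$ and $R_1$ are linearly independent modulo equality $dR_2$-a.e. on $[0,b_0)$. Write $\int_0^x=\int_{[0,x)}$. Let $\mathcal T$ be the set of triples $(u_1,u_2,f)$ with $u_1,f\in\mathcal L^2(dR_2)$ and $$u_1(x)=u_1(0)+\int_0^x u_2\,dR_1,\qquad u_2(x)=u_2(0)-\int_0^x f\,dR_2\qquad(x\in[0,b)),$$ let $\pi:\mathcal L^2(dR_2)\to L^2(dR_2)$ be the quotient map and $T_{\max}=\{(\pi u_1,\pi f):(u_1,u_2,f)\in\mathcal T\}$, a linear relation in $L^2(dR_2)$. For $\lambda\in\mathbb C$ let $c(\cdot,\lambda)=(c_1,c_2)$ and $s(\cdot,\lambda)=(s_1,s_2)$ be the unique solutions of the system with $f=\lambda u_1$ and $c(0,\lambda)=(1,0)$,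 $s(0,\lambda)=(0,1)$. Put $u_2(b)=\lim_{x\to b}u_2(x)$ and $R_i(b)=\lim_{x\to b}R_i(x)$. A Stieltjes function is a holomorphic function $m$ on $\mathbb C\setminus[0,\infty)$ with $\operatorname{Im}m(\lambda)\ge0$ for $\operatorname{Im}\lambda>0$, $m(\bar\lambda)=\overline{m(\lambda)}$, and $m(\lambda)\ge0$ for $\lambda<0$. For a symmetric relation $T$ (that is, $T\subseteq T^*$) in a Hilbert space $H$, a boundary triple $(\mathbb C,\Gamma_0,\Gamma_1)$ for $T^*$ consists of linear maps $\Gamma_0,\Gamma_1:T^*\to\mathbb C$ with $(\Gamma_0,\Gamma_1):T^*\to\mathbb C^2$ surjective and $\langle f,v\rangle-\langle u,g\rangle=\Gamma_1\mathbf u\,\overline{\Gamma_0\mathbf v}-\Gamma_0\mathbf u\,\overline{\Gamma_1\mathbf v}$ for all $\mathbf u=(u,f),\mathbf v=(v,g)\in T^*$. A point $\lambda$ is a regular point of a relation $A$, written $\lambda\in\rho(A)$, if $\ker(A-\lambda)=\{0\}$ and $\operatorname{ran}(A-\lambda)=H$. The Weyl function $m$ of the triple is determined by $m(\lambda)\Gamma_0\mathbf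 u=\Gamma_1\mathbf u$ for all $\mathbf u=(u,\lambda u)\in T^*$, where $\lambda\in\rho(A_0)$ and $A_0=\ker\Gamma_0$. Suppose that $b$ is singular, i.e. $R_1(b)+R_2(b)=\infty$, and that the system is limit circle at $b$, i.e. $\dim\ker(T_{\max}-\lambda)=2$ for one (equivalently, every) non-real $\lambda$. Then the limits $c_2(b,\lambda)$, $s_2(b,\lambda)$ exist for all $\lambda\in\mathbb C$, and for $$T_N=\{(\pi u_1,\pi f):(u_1,u_2,f)\in\mathcal T,\ u_1(0)=u_2(0)=u_2(b)=0\}$$ the following hold. (i) $T_N$ is a symmetric nonnegative linear relation in $L^2(dR_2)$ with deficiency indices $(1,1)$, and $T_N^*=\{(\pi u_1,\pi f):(u_1,u_2,f)\in\mathcal T,\ u_2(b)=0\}$. (ii) The maps $\Gamma_0\mathbf u=u_2(0)$ and $\Gamma_1\mathbf u=-u_1(0)$ are well defined on $T_N^*$, and $(\mathbb C,\Gamma_0,\Gamma_1)$ is a boundary triple for $T_N^*$. (iii) With $A_0=\ker\Gamma_0$ one has $\mathbb C\setminus[0,\infty)\subseteq\rho(A_0)$, $c_2(b,\lambda)\ne0$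 for $\lambda\in\rho(A_0)$, and the Weyl function $m_N$ of this boundary triple is the Neumann $m$-function, $m_N(\lambda)=s_2(b,\lambda)/c_2(b,\lambda)$ for $\lambda\in\rho(A_0)$. (iv) $m_N$ coincides with the principal Titchmarsh--Weyl coefficient: for $\lambda\in\rho(A_0)$ the limit $q(\lambda)=\lim_{x\to b}s_1(x,\lambda)/c_1(x,\lambda)$ exists (with $c_1(x,\lambda)\neq0$ for $x$ near $b$) and equals $m_N(\lambda)$. Moreover $m_N$ is a Stieltjes function, and $\lim_{\lambda\to-\infty}m_N(\lambda)=R_{1+}(a)$, where $a=\inf\operatorname{supp}dR_2$ and $R_{1+}(a)=\lim_{t\downarrow a}R_1(t)$. (v) $0<R_2(b)<\infty$, and $m_N(\lambda)=-\dfrac1{R_2(b)\lambda}+\widetilde m(\lambda)$ for $\lambda\in\mathbb C\setminus[0,\infty)$, where $\widetilde m$ is a Stieltjes function with $\lim_{y\to0}y\,\widetilde m(iy)=0$. -/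

import Mathlib

open MeasureTheory Filter Topology Set

noncomputable section

/-! ### Linear relations, boundary triples, Weyl functions, Stieltjes functions -/

namespace LinRel

variable {H : Type*} [NormedAddCommGroup H] [InnerProductSpace ℂ H]

/-- `ker (T - z)` for a linear relation `T` in `H`, that is, a subspace of `H × H`. -/
def kerSub (T : Submodule ℂ (H × H)) (z : ℂ) : Submodule ℂ H where
  carrier := {u | (u, z • u) ∈ T}
  add_mem' := by
    intro u v hu hv
    have := T.add_mem hu hv
    simpa [smul_add] using this
  zero_mem' := by
    have h : ((0 : H), z • (0 : H)) = 0 := by rw [smul_zero]; rfl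
    exact (congrArg (· ∈ T) h).mpr T.zero_mem
  smul_mem' := by
    intro a u hu
    have := T.smul_mem a hu
    simpa [smul_comm z a u] using this

/-- `z` is a regular point of `T`: `ker (T - z) = 0` and `ran (T - z) = H`. -/
def IsRegularPoint (T : Submodule ℂ (H × H)) (z : ℂ) : Prop :=
  (∀ u : H, (u, z • u) ∈ T → u = 0) ∧ ∀ h : H, ∃ p ∈ T, p.2 - z • p.1 = h

/-- `T` is symmetric: `T ⊆ T^*`. The adjoint relation is Mathlib's `Submodule.adjoint`:
`(u, f) ∈ T^*` iff `⟨f, v⟩ = ⟨u, g⟩` for all `(v, g) ∈ T`. -/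
def IsSymm (T : Submodule ℂ (H × H)) : Prop := T ≤ T.adjoint

/-- `T` is nonnegative: `⟨f, u⟩ ≥ 0` for all `(u, f) ∈ T`. -/
def IsNonneg (T : Submodule ℂ (H × H)) : Prop :=
  ∀ p ∈ T, (inner ℂ p.1 p.2).im = 0 ∧ 0 ≤ (inner ℂ p.1 p.2).re

/-- The deficiency indices `dim ker (T^* ∓ i)` of `T` are `(m, n)`. -/
def HasDeficiencyIndices (T : Submodule ℂ (H × H)) (m n : ℕ) : Prop :=
  Module.rank ℂ (kerSub T.adjoint Complex.I) = m ∧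
    Module.rank ℂ (kerSub T.adjoint (-Complex.I)) = n

/-- `(ℂ, Γ₀, Γ₁)` is a boundary triple for `T^*`. Mathlib's inner product is conjugate-linear in
its first argument, so `⟨f, v⟩` is `inner ℂ v f`. -/
def IsBoundaryTriple (T : Submodule ℂ (H × H)) (Γ₀ Γ₁ : T.adjoint →ₗ[ℂ] ℂ) : Prop :=
  (∀ p q : T.adjoint,
    inner ℂ (q : H × H).1 (p : H × H).2 - inner ℂ (q : H × H).2 (p : H × H).1
      = Γ₁ p * (starRingEnd ℂ) (Γ₀ q) - Γ₀ p * (starRingEnd ℂ) (Γ₁ q)) ∧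
  Function.Surjective (fun p : T.adjoint => (Γ₀ p, Γ₁ p))

/-- The extension `A₀ = ker Γ₀`, as a linear relation in `H`. -/
def kerExt (T : Submodule ℂ (H × H)) (Γ₀ : T.adjoint →ₗ[ℂ] ℂ) : Submodule ℂ (H × H) :=
  (LinearMap.ker Γ₀).map T.adjoint.subtype

/-- `m` is the Weyl function of `(ℂ, Γ₀, Γ₁)`: for every regular point `z` of `A₀ = ker Γ₀`,
the number `m z` satisfies `m z * Γ₀ p = Γ₁ p` for all `p = (u, z u) ∈ T^*`, and it is the only
number that does so. -/
def IsWeylFunction (T : Submodule ℂ (H × H)) (Γ₀ Γ₁ : T.adjoint →ₗ[ℂ] ℂ) (m : ℂ → ℂ) : Prop :=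
  ∀ z : ℂ, IsRegularPoint (kerExt T Γ₀) z → ∀ w : ℂ,
    w = m z ↔
      ∀ p : T.adjoint, (p : H × H).2 = z • (p : H × H).1 → w * Γ₀ p = Γ₁ p

end LinRel

/-- The plane cut along the half-line `[0, ∞)`. -/
def cutPlane : Set ℂ := {z | ¬ (z.im = 0 ∧ 0 ≤ z.re)}

/-- Stieltjes functions, as functions on `ℂ ∖ [0, ∞)` (values on `[0, ∞)` are irrelevant):
Herglotz-Nevanlinna functions with a holomorphic continuation to the negative half-line which
takes nonnegative values there. -/
def IsStieltjes (m : ℂ → ℂ) : Prop :=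
  DifferentiableOn ℂ m cutPlane ∧
  (∀ z : ℂ, 0 < z.im → 0 ≤ (m z).im) ∧
  (∀ z : ℂ, z.im ≠ 0 → m ((starRingEnd ℂ) z) = (starRingEnd ℂ) (m z)) ∧
  ∀ x : ℝ, x < 0 → (m x).im = 0 ∧ 0 ≤ (m x).re

/-! ### Lebesgue-Stieltjes measures on `[0, b)` -/

/-- The interval `[0, b)`, where `b ≤ ∞`. -/
def halfOpen (b : EReal) : Set ℝ := {x | 0 ≤ x ∧ (x : EReal) < b}

/-- The filter `x → b`, `x < b`. -/
def toEnd (b : EReal) : Filter ℝ := comap (fun x : ℝ => (x : EReal)) (𝓝[<] b)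

/-- The Lebesgue-Stieltjes measure `dR` of a left-continuous non-decreasing function `R` on
`[0, b)` with `R 0 = 0`, as a measure on `ℝ` concentrated on `[0, b)`: the image of Lebesgue
measure under the generalized inverse of `R`. It is the measure with `dR [x, y) = R y - R x`, see
`lsMeasure_Ico` and `lsMeasure_compl`; in particular `dR {0} = R (0+)`. -/
def lsMeasure (b : EReal) (R : ℝ → ℝ) : Measure ℝ :=
  (volume.restrict {t : ℝ | 0 ≤ t ∧ ∃ y ∈ halfOpen b, t < R y}).map
    (fun t => sSup {x | x ∈ halfOpen b ∧ R x ≤ t})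

section lsMeasure

variable {b : EReal} {R : ℝ → ℝ}

theorem lsMeasure_aux (hR : MonotoneOn R (halfOpen b)) (h0 : R 0 = 0) (hb : 0 < b) {t : ℝ}
    (ht : t ∈ {t : ℝ | 0 ≤ t ∧ ∃ y ∈ halfOpen b, t < R y}) :
    BddAbove {x | x ∈ halfOpen b ∧ R x ≤ t} ∧ (0 : ℝ) ∈ {x | x ∈ halfOpen b ∧ R x ≤ t} ∧
      sSup {x | x ∈ halfOpen b ∧ R x ≤ t} ∈ halfOpen b := by
  obtain ⟨ht0, y, hy, hty⟩ := ht
  have hub : y ∈ upperBounds {x | x ∈ halfOpen b ∧ R x ≤ t} := by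
    rintro x ⟨hx, hxt⟩
    by_contra hlt
    exact absurd (hR hy hx (le_of_lt (not_le.mp hlt))) (by linarith)
  have hbdd : BddAbove {x | x ∈ halfOpen b ∧ R x ≤ t} := ⟨y, hub⟩
  have hz : (0 : ℝ) ∈ {x | x ∈ halfOpen b ∧ R x ≤ t} := ⟨⟨le_rfl, by simpa using hb⟩, by rwa [h0]⟩
  refine ⟨hbdd, hz, le_csSup hbdd hz, lt_of_le_of_lt ?_ hy.2⟩
  exact_mod_cast csSup_le ⟨0, hz⟩ hub

theorem lsMeasure_lt_iff (hR : MonotoneOn R (halfOpen b)) (h0 : R 0 = 0) (hb : 0 < b)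
    (hl : ∀ x ∈ halfOpen b, ContinuousWithinAt R (halfOpen b ∩ Iic x) x) {t : ℝ}
    (ht : t ∈ {t : ℝ | 0 ≤ t ∧ ∃ y ∈ halfOpen b, t < R y}) {y : ℝ} (hy : y ∈ halfOpen b) :
    sSup {x | x ∈ halfOpen b ∧ R x ≤ t} < y ↔ t < R y := by
  obtain ⟨hbdd, hz, -⟩ := lsMeasure_aux hR h0 hb ht
  constructor
  · intro h
    by_contra hle
    exact absurd (le_csSup hbdd ⟨hy, not_lt.mp hle⟩) (not_le.mpr h)
  · intro h
    have hy0 : 0 < y := by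
      rcases hy.1.lt_or_eq with h1 | h1
      · exact h1
      · rw [← h1, h0] at h
        exact absurd ht.1 (not_le.mpr h)
    have hev : ∀ᶠ x in 𝓝[halfOpen b ∩ Iic y] y, t < R x := (hl y hy) (Ioi_mem_nhds h)
    have hev2 : ∀ᶠ x in 𝓝[<] y, t < R x ∧ x ∈ halfOpen b := by
      have h3 : ∀ᶠ x in 𝓝[<] y, x ∈ halfOpen b ∩ Iic y := by
        filter_upwards [Ioo_mem_nhdsLT hy0] with x hx
        exact ⟨⟨hx.1.le, lt_trans (by exact_mod_cast hx.2) hy.2⟩, hx.2.le⟩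
      have h4 : 𝓝[<] y ≤ 𝓝[halfOpen b ∩ Iic y] y :=
        le_inf nhdsWithin_le_nhds (le_principal_iff.mpr h3)
      filter_upwards [h4 hev, h3] with x hx hx2 using ⟨hx, hx2.1⟩
    obtain ⟨x, ⟨hx1, hx2⟩, hxy⟩ := (hev2.and self_mem_nhdsWithin).exists
    refine lt_of_le_of_lt (csSup_le ⟨0, hz⟩ ?_) hxy
    rintro w ⟨hw, hwt⟩
    by_contra hlt
    exact absurd (hR hx2 hw (le_of_lt (not_le.mp hlt))) (by linarith)

theorem lsMeasure_measurableSet (b : EReal) (R : ℝ → ℝ) :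
    MeasurableSet {t : ℝ | 0 ≤ t ∧ ∃ y ∈ halfOpen b, t < R y} := by
  have : {t : ℝ | 0 ≤ t ∧ ∃ y ∈ halfOpen b, t < R y} = Ici 0 ∩ ⋃ y ∈ halfOpen b, Iio (R y) := by
    ext t; simp
  rw [this]
  exact measurableSet_Ici.inter (isOpen_biUnion fun _ _ => isOpen_Iio).measurableSet

theorem lsMeasure_aemeasurable (hR : MonotoneOn R (halfOpen b)) (h0 : R 0 = 0) (hb : 0 < b) :
    AEMeasurable (fun t => sSup {x | x ∈ halfOpen b ∧ R x ≤ t})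
      (volume.restrict {t : ℝ | 0 ≤ t ∧ ∃ y ∈ halfOpen b, t < R y}) := by
  refine aemeasurable_restrict_of_monotoneOn (lsMeasure_measurableSet b R) ?_
  intro s hs t ht hst
  obtain ⟨-, hz, -⟩ := lsMeasure_aux hR h0 hb hs
  exact csSup_le_csSup (lsMeasure_aux hR h0 hb ht).1 ⟨0, hz⟩ fun x hx => ⟨hx.1, hx.2.trans hst⟩

theorem lsMeasure_Ico (hR : MonotoneOn R (halfOpen b)) (h0 : R 0 = 0) (hb : 0 < b)
    (hl : ∀ x ∈ halfOpen b, ContinuousWithinAt R (halfOpen b ∩ Iic x) x) {x y : ℝ}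
    (hx : x ∈ halfOpen b) (hy : y ∈ halfOpen b) :
    lsMeasure b R (Ico x y) = ENNReal.ofReal (R y - R x) := by
  rw [lsMeasure, Measure.map_apply_of_aemeasurable (lsMeasure_aemeasurable hR h0 hb)
    measurableSet_Ico, Measure.restrict_apply' (lsMeasure_measurableSet b R)]
  rw [← Real.volume_Ico]
  congr 1
  ext t
  constructor
  · rintro ⟨⟨h1, h2⟩, ht⟩
    exact ⟨not_lt.mp fun h => absurd ((lsMeasure_lt_iff hR h0 hb hl ht hx).mpr h)
      (not_lt.mpr h1), (lsMeasure_lt_iff hR h0 hb hl ht hy).mp h2⟩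
  · rintro ⟨h1, h2⟩
    have hRx : 0 ≤ R x := by
      rw [← h0]
      exact hR ⟨le_rfl, by simpa using hb⟩ hx hx.1
    have ht : t ∈ {t : ℝ | 0 ≤ t ∧ ∃ y ∈ halfOpen b, t < R y} := ⟨hRx.trans h1, y, hy, h2⟩
    exact ⟨⟨not_lt.mp fun h => absurd ((lsMeasure_lt_iff hR h0 hb hl ht hx).mp h)
      (not_lt.mpr h1), (lsMeasure_lt_iff hR h0 hb hl ht hy).mpr h2⟩, ht⟩

theorem measurableSet_halfOpen (b : EReal) : MeasurableSet (halfOpen b) :=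
  measurableSet_Ici.inter (measurable_coe_real_ereal measurableSet_Iio)

theorem lsMeasure_compl (hR : MonotoneOn R (halfOpen b)) (h0 : R 0 = 0) (hb : 0 < b) :
    lsMeasure b R (halfOpen b)ᶜ = 0 := by
  rw [lsMeasure, Measure.map_apply_of_aemeasurable (lsMeasure_aemeasurable hR h0 hb)
    (measurableSet_halfOpen b).compl, Measure.restrict_apply' (lsMeasure_measurableSet b R)]
  convert measure_empty (μ := (volume : Measure ℝ))
  ext t
  simp only [mem_inter_iff, mem_empty_iff_false, iff_false, not_and]
  exact fun h ht => h (lsMeasure_aux hR h0 hb ht).2.2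

end lsMeasure

/-! ### Integral systems -/

/-- The data of an integral system `S[R₁, R₂]` on `[0, b)`, `0 < b ≤ ∞`: two non-decreasing
left-continuous functions on `[0, b)` which vanish at `0`. (Values of `R₁`, `R₂` outside `[0, b)`
are irrelevant.) -/
structure IntegralSystem where
  b : EReal
  b_pos : 0 < b
  R₁ : ℝ → ℝ
  R₂ : ℝ → ℝ
  mono₁ : MonotoneOn R₁ (halfOpen b)
  mono₂ : MonotoneOn R₂ (halfOpen b)
  leftCont₁ : ∀ x ∈ halfOpen b, ContinuousWithinAt R₁ (halfOpen b ∩ Iic x) x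
  leftCont₂ : ∀ x ∈ halfOpen b, ContinuousWithinAt R₂ (halfOpen b ∩ Iic x) x
  zero₁ : R₁ 0 = 0
  zero₂ : R₂ 0 = 0

namespace IntegralSystem

variable (S : IntegralSystem)

/-- The interval `[0, b)`. -/
def I : Set ℝ := halfOpen S.b

/-- The filter `x → b`, `x < b`. -/
def atEnd : Filter ℝ := toEnd S.b

/-- The measure `dR₁`. -/
def dR₁ : Measure ℝ := lsMeasure S.b S.R₁

/-- The measure `dR₂`. -/
def dR₂ : Measure ℝ := lsMeasure S.b S.R₂

/-- The Hilbert space `L²(R₂)`. -/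
abbrev L2 : Type := Lp ℂ 2 S.dR₂

/-- `R₁` and `R₂` have no common points of discontinuity in `[0, b)`. -/
def NoCommonJumps : Prop :=
  ∀ x ∈ S.I, ContinuousWithinAt S.R₁ S.I x ∨ ContinuousWithinAt S.R₂ S.I x

/-- For some `[0, b₀) ⊆ [0, b)` the functions `1` and `R₁` are linearly independent modulo
equality `dR₂`-almost everywhere on `[0, b₀)`. -/
def Definite : Prop :=
  ∃ b₀ : EReal, b₀ ≤ S.b ∧ ∀ α β : ℂ,
    (∀ᵐ x ∂(S.dR₂.restrict (halfOpen b₀)), α + β * (S.R₁ x : ℂ) = 0) → α = 0 ∧ β = 0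

/-- `b` is singular: `R₁(b) + R₂(b) = ∞`. -/
def IsSingular : Prop := Tendsto (fun x => S.R₁ x + S.R₂ x) S.atEnd atTop

/-- `(u₁, u₂)` solves the integral system with right-hand side `f`:
`u₁(x) = u₁(0) + ∫_{[0,x)} u₂ dR₁` and `u₂(x) = u₂(0) - ∫_{[0,x)} f dR₂` for all `x ∈ [0, b)`,
where the integrals exist. -/
def Solves (u₁ u₂ f : ℝ → ℂ) : Prop :=
  ∀ x ∈ S.I,
    IntegrableOn u₂ (Ico 0 x) S.dR₁ ∧ IntegrableOn f (Ico 0 x) S.dR₂ ∧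
    u₁ x = u₁ 0 + ∫ t in Ico 0 x, u₂ t ∂S.dR₁ ∧
    u₂ x = u₂ 0 - ∫ t in Ico 0 x, f t ∂S.dR₂

/-- The set `𝒯` of triples `(u₁, u₂, f)` with `u₁, f ∈ ℒ²(R₂)` that satisfy the inhomogeneous
system. -/
def IsTriple (u₁ u₂ f : ℝ → ℂ) : Prop :=
  MemLp u₁ 2 S.dR₂ ∧ MemLp f 2 S.dR₂ ∧ S.Solves u₁ u₂ f

/-- `p = (π u₁, π f)` for the triple `(u₁, u₂, f) ∈ 𝒯`. -/
def Represents (p : S.L2 × S.L2) (u₁ u₂ f : ℝ → ℂ) : Prop :=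
  S.IsTriple u₁ u₂ f ∧ p.1 =ᵐ[S.dR₂] u₁ ∧ p.2 =ᵐ[S.dR₂] f

variable {S}

theorem Solves.add {u₁ u₂ f v₁ v₂ g : ℝ → ℂ} (h : S.Solves u₁ u₂ f) (k : S.Solves v₁ v₂ g) :
    S.Solves (u₁ + v₁) (u₂ + v₂) (f + g) := by
  intro x hx
  obtain ⟨a1, a2, a3, a4⟩ := h x hx
  obtain ⟨c1, c2, c3, c4⟩ := k x hx
  refine ⟨a1.add c1, a2.add c2, ?_, ?_⟩
  · simp only [Pi.add_apply]
    rw [integral_add a1 c1, a3, c3]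
    ring
  · simp only [Pi.add_apply]
    rw [integral_add a2 c2, a4, c4]
    ring

theorem Solves.smul {u₁ u₂ f : ℝ → ℂ} (a : ℂ) (h : S.Solves u₁ u₂ f) :
    S.Solves (a • u₁) (a • u₂) (a • f) := by
  intro x hx
  obtain ⟨a1, a2, a3, a4⟩ := h x hx
  refine ⟨a1.smul a, a2.smul a, ?_, ?_⟩
  · simp only [Pi.smul_apply]
    rw [integral_smul, a3, smul_add]
  · simp only [Pi.smul_apply]
    rw [integral_smul, a4, smul_sub]

theorem Solves.zero : S.Solves 0 0 0 := by
  intro x _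
  exact ⟨integrableOn_zero, integrableOn_zero, by simp, by simp⟩

theorem Represents.add {p q : S.L2 × S.L2} {u₁ u₂ f v₁ v₂ g : ℝ → ℂ}
    (h : S.Represents p u₁ u₂ f) (k : S.Represents q v₁ v₂ g) :
    S.Represents (p + q) (u₁ + v₁) (u₂ + v₂) (f + g) :=
  ⟨⟨h.1.1.add k.1.1, h.1.2.1.add k.1.2.1, h.1.2.2.add k.1.2.2⟩,
    (Lp.coeFn_add _ _).trans (h.2.1.add k.2.1), (Lp.coeFn_add _ _).trans (h.2.2.add k.2.2)⟩

theorem Represents.smul {p : S.L2 × S.L2} {u₁ u₂ f : ℝ → ℂ} (a : ℂ)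
    (h : S.Represents p u₁ u₂ f) : S.Represents (a • p) (a • u₁) (a • u₂) (a • f) :=
  ⟨⟨h.1.1.const_smul a, h.1.2.1.const_smul a, h.1.2.2.smul a⟩,
    (Lp.coeFn_smul _ _).trans (h.2.1.const_smul a), (Lp.coeFn_smul _ _).trans (h.2.2.const_smul a)⟩

theorem Represents.zero : S.Represents 0 0 0 0 :=
  ⟨⟨MemLp.zero, MemLp.zero, Solves.zero⟩, Lp.coeFn_zero _ _ _, Lp.coeFn_zero _ _ _⟩

variable (S)

/-- The maximal relation `T_max`. -/
def Tmax : Submodule ℂ (S.L2 × S.L2) where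
  carrier := {p | ∃ u₁ u₂ f, S.Represents p u₁ u₂ f}
  add_mem' := by
    rintro p q ⟨u₁, u₂, f, h⟩ ⟨v₁, v₂, g, k⟩
    exact ⟨_, _, _, h.add k⟩
  zero_mem' := ⟨0, 0, 0, Represents.zero⟩
  smul_mem' := by
    rintro a p ⟨u₁, u₂, f, h⟩
    exact ⟨_, _, _, h.smul a⟩

/-- The relation `T_N`, given by `u₁(0) = u₂(0) = u₂(b) = 0`. -/
def TN : Submodule ℂ (S.L2 × S.L2) where
  carrier := {p | ∃ u₁ u₂ f, S.Represents p u₁ u₂ f ∧ u₁ 0 = 0 ∧ u₂ 0 = 0 ∧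
    Tendsto u₂ S.atEnd (𝓝 0)}
  add_mem' := by
    rintro p q ⟨u₁, u₂, f, h, h1, h2, h3⟩ ⟨v₁, v₂, g, k, k1, k2, k3⟩
    refine ⟨_, _, _, h.add k, by simp [h1, k1], by simp [h2, k2], ?_⟩
    rw [← add_zero (0 : ℂ)]
    exact h3.add k3
  zero_mem' := ⟨0, 0, 0, Represents.zero, rfl, rfl, tendsto_const_nhds⟩
  smul_mem' := by
    rintro a p ⟨u₁, u₂, f, h, h1, h2, h3⟩
    refine ⟨_, _, _, h.smul a, by simp [h1], by simp [h2], ?_⟩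
    rw [← smul_zero a]
    exact h3.const_smul a

/-- `S[R₁, R₂]` is limit circle at `b`: the space `ker (T_max - z)` has dimension `2` for
non-real `z`. (By Weyl's alternative the dimension is the same for all non-real `z`.) -/
def IsLimitCircle : Prop :=
  ∃ z : ℂ, z.im ≠ 0 ∧ Module.rank ℂ (LinRel.kerSub S.Tmax z) = 2

/-- `(u₁, u₂)` solves the homogeneous system with spectral parameter `z` and initial values
`(α, β)`. -/
def IsSol (z α β : ℂ) (u : (ℝ → ℂ) × (ℝ → ℂ)) : Prop :=
  S.Solves u.1 u.2 (fun t => z * u.1 t) ∧ u.1 0 = α ∧ u.2 0 = β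

/-- The solution with spectral parameter `z` and initial values `(α, β)`; its existence, and its
uniqueness on `[0, b)`, is the assertion `WellPosed`. -/
def sol (z α β : ℂ) : (ℝ → ℂ) × (ℝ → ℂ) := Classical.epsilon (S.IsSol z α β)

/-- For every spectral parameter and all initial values `sol` is a solution, and it is the only
one on `[0, b)`. -/
def WellPosed : Prop :=
  ∀ z α β : ℂ, S.IsSol z α β (S.sol z α β) ∧
    ∀ v, S.IsSol z α β v → EqOn v.1 (S.sol z α β).1 S.I ∧ EqOn v.2 (S.sol z α β).2 S.I

/-- The first component of `c(·, z)`; here `c(·, z)` and `s(·, z)` are the solutions with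
`c(0, z) = (1, 0)` and `s(0, z) = (0, 1)`. -/
def c₁ (z : ℂ) : ℝ → ℂ := (S.sol z 1 0).1
/-- The second component of `c(·, z)`. -/
def c₂ (z : ℂ) : ℝ → ℂ := (S.sol z 1 0).2
/-- The first component of `s(·, z)`. -/
def s₁ (z : ℂ) : ℝ → ℂ := (S.sol z 0 1).1
/-- The second component of `s(·, z)`. -/
def s₂ (z : ℂ) : ℝ → ℂ := (S.sol z 0 1).2

/-- The limit `c₂(b, z)`. -/
def c₂b (z : ℂ) : ℂ := limUnder S.atEnd (S.c₂ z)

/-- The limit `s₂(b, z)`. -/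
def s₂b (z : ℂ) : ℂ := limUnder S.atEnd (S.s₂ z)

/-- The Neumann `m`-function `s₂(b, z) / c₂(b, z)`. -/
def neumannM (z : ℂ) : ℂ := S.s₂b z / S.c₂b z

/-- The principal Titchmarsh-Weyl coefficient `q(z) = lim_{x → b} s₁(x, z) / c₁(x, z)` exists
at `z` and equals `w`. -/
def PrincipalCoeffEq (z w : ℂ) : Prop :=
  (∀ᶠ x in S.atEnd, S.c₁ z x ≠ 0) ∧
    Tendsto (fun x => S.s₁ z x / S.c₁ z x) S.atEnd (𝓝 w)

end IntegralSystem

end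

/-! The problem reduces to one bounded positive operator and one vector. Applying Gronwall to two
independent square-integrable solutions gives `1 + R₁ ∈ L²(dR₂)` (`IsLimitCircle.memLp_one_add_R₁`).
Hence `dR₂` is finite, `R₁ ∈ L²(dR₂)`, and, `b` being singular, `R₁ → ∞` at `b`.

Let `K f (x) = ∫_{[0,x)} ∫_{[s,b)} f dR₂ dR₁(s)` (`greenOp`). It is bounded because `|K f| ≤ R₁
‖f‖₁`, and Fubini together with the absence of common jumps gives `⟨K f, f⟩ = ∫ |∫_{[s,b)} f dR₂|²
dR₁(s) ≥ 0`. Every solution with `f ∈ L²` satisfies `u₁ = u₁(0) + K f + u₂(b) R₁` and `u₂(b) = u₂(0)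
- ∫ f dR₂`. So `u₂(b) = 0` turns into `u₁ = u₁(0) e + K f` and `u₂(0) = ⟨f, e⟩`, with `e` the
constant function `1`, and `T_N = {(K f, f) : ⟨f, e⟩ = 0}` (`TN_eq`). Definiteness gives `e ≠ 0` and
makes the boundary values independent of the representing triple.

For any positive `K` and any `e ≠ 0` the adjoint of this restriction is `{(α e + K f, f)}`
(`mem_adjoint_invRestrict`), a boundary triple is given by `⟨f, e⟩` and `-α`, and off `[0, ∞)` the
Weyl function is `-1 / (z D)`, where `D = ⟨u, e⟩` and `u = (1 - z K)⁻¹ e`. Substituting `e = u - z K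
u` yields `-1 / (z D) = ⟨K u, u⟩ / |D|² - (‖u‖² / |D|²) / z`, a Stieltjes function; Cauchy-Schwarz
shows that it stays one after the pole `-1 / (‖e‖² z)` is removed, and `‖e‖² = R₂(b)`. Its limit at
`-∞` is the infimum of `⟨K f, f⟩` over `⟨f, e⟩ = 1`, which the quadratic form identifies as
`R₁₊(a)`.

The link with `c` and `s` is that an element of `ker (T_N^* - z)` comes from `u₁(0) c + u₂(0) s`,
and `u₂(b) = 0` becomes a linear relation between `u₁(0)` and `u₂(0)`. Finally `u₁ / R₁ → u₂(b)` for
such solutions (`Solves.tendsto_div_R₁`), so `s₁ / c₁` and `s₂(b) / c₂(b)` agree in the limit. -/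

noncomputable section

/-! ### Iterated integrals and Gronwall's lemma for measures on the line -/

/-- The iterated integrals `a₀ = 1`, `aₙ₊₁(x) = ∫_{(-∞, x)} aₙ dω`. -/
def iterInt (ω : Measure ℝ) : ℕ → ℝ → ENNReal
  | 0 => fun _ => 1
  | n + 1 => fun x => ∫⁻ t in Iio x, iterInt ω n t ∂ω

theorem iterInt_succ (ω : Measure ℝ) (n : ℕ) (x : ℝ) :
    iterInt ω (n + 1) x = ∫⁻ t in Iio x, iterInt ω n t ∂ω := rfl

theorem iterInt_monotone (ω : Measure ℝ) (n : ℕ) : Monotone (iterInt ω n) := by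
  cases n with
  | zero => exact monotone_const
  | succ n => exact fun x y hxy => lintegral_mono_set (Iio_subset_Iio hxy)

theorem iterInt_measurable (ω : Measure ℝ) (n : ℕ) : Measurable (iterInt ω n) :=
  (iterInt_monotone ω n).measurable

/-- For `t < x` the sets `(-∞, t)` and `(t, x)` are disjoint in `(-∞, x)`. Integrating `aₙ(t)`
against their masses gives at least `(n + 1) aₙ₊₂(x)` by induction, plus exactly `aₙ₊₂(x)` by
Tonelli. An atom at `t` is simply dropped, so atoms only help: this is why open half-lines are used.
-/
theorem succ_mul_iterInt_le (ω : Measure ℝ) [SFinite ω] (n : ℕ) (x : ℝ) :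
    ((n : ENNReal) + 1) * iterInt ω (n + 1) x ≤ ω (Iio x) * iterInt ω n x := by
  induction n generalizing x with
  | zero => simp [iterInt]
  | succ n ih =>
    have key : ∀ t ∈ Iio x, iterInt ω n t * (ω (Iio t) + ω (Ioo t x)) ≤
        ω (Iio x) * iterInt ω n t := by
      intro t ht
      rw [mul_comm]
      gcongr
      rw [← measure_union (by
        rw [Set.disjoint_left]; intro s hs hs'; exact lt_asymm hs hs'.1) measurableSet_Ioo]
      refine measure_mono (union_subset (Iio_subset_Iio (le_of_lt ht)) fun s hs => hs.2)
    have hmeas : Measurable fun t => ω (Iio t) :=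
      (show Monotone fun t => ω (Iio t) from
        fun s t hst => measure_mono (Iio_subset_Iio hst)).measurable
    have swap : ∫⁻ t in Iio x, iterInt ω n t * ω (Ioo t x) ∂ω = iterInt ω (n + 2) x := by
      have h1 : ∀ t, iterInt ω n t * ω (Ioo t x) =
          ∫⁻ s in Iio x, (Ioi t).indicator (fun _ => iterInt ω n t) s ∂ω := by
        intro t
        rw [lintegral_indicator measurableSet_Ioi, Measure.restrict_restrict measurableSet_Ioi,
          setLIntegral_const, Ioi_inter_Iio]
      simp_rw [h1]
      rw [lintegral_lintegral_swap]
      · refine setLIntegral_congr_fun measurableSet_Iio fun s hs => ?_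
        have h2 : ∀ t, (Ioi t).indicator (fun _ => iterInt ω n t) s =
            (Iio s).indicator (iterInt ω n) t := by
          intro t
          by_cases h : t < s <;> simp [h]
        simp_rw [h2]
        rw [lintegral_indicator measurableSet_Iio, Measure.restrict_restrict measurableSet_Iio,
          inter_eq_left.mpr (Iio_subset_Iio (le_of_lt hs))]
        rfl
      · have : Function.uncurry (fun t s => (Ioi t).indicator (fun _ => iterInt ω n t) s) =
            {p : ℝ × ℝ | p.1 < p.2}.indicator fun p => iterInt ω n p.1 := by
          ext ⟨t, s⟩
          by_cases h : t < s <;> simp [h]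
        rw [this]
        exact (((iterInt_measurable ω _).comp measurable_fst).indicator
          (measurableSet_lt measurable_fst measurable_snd)).aemeasurable
    have hadd : ∀ t, iterInt ω n t * (ω (Iio t) + ω (Ioo t x)) =
        ω (Iio t) * iterInt ω n t + iterInt ω n t * ω (Ioo t x) := fun t => by ring
    have hlow : ((n : ENNReal) + 1) * iterInt ω (n + 2) x ≤
        ∫⁻ t in Iio x, ω (Iio t) * iterInt ω n t ∂ω := by
      have : ((n : ENNReal) + 1) * iterInt ω (n + 2) x =
          ∫⁻ t in Iio x, ((n : ENNReal) + 1) * iterInt ω (n + 1) t ∂ω :=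
        (lintegral_const_mul _ (iterInt_measurable ω _)).symm
      rw [this]
      exact lintegral_mono fun t => ih t
    calc (((n + 1 : ℕ) : ENNReal) + 1) * iterInt ω (n + 1 + 1) x
        = ((n : ENNReal) + 1) * iterInt ω (n + 2) x + iterInt ω (n + 2) x := by push_cast; ring
      _ ≤ (∫⁻ t in Iio x, ω (Iio t) * iterInt ω n t ∂ω) +
          ∫⁻ t in Iio x, iterInt ω n t * ω (Ioo t x) ∂ω := by rw [swap]; gcongr
      _ = ∫⁻ t in Iio x, iterInt ω n t * (ω (Iio t) + ω (Ioo t x)) ∂ω := by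
        simp_rw [hadd]
        exact (lintegral_add_left (hmeas.mul (iterInt_measurable ω n)) _).symm
      _ ≤ ∫⁻ t in Iio x, ω (Iio x) * iterInt ω n t ∂ω := setLIntegral_mono'
          measurableSet_Iio key
      _ = ω (Iio x) * iterInt ω (n + 1) x := lintegral_const_mul _ (iterInt_measurable ω n)

theorem factorial_mul_iterInt_le (ω : Measure ℝ) [SFinite ω] (n : ℕ) (x : ℝ) :
    (n.factorial : ENNReal) * iterInt ω n x ≤ ω (Iio x) ^ n := by
  induction n with
  | zero => simp [iterInt]
  | succ n ih =>
    calc ((n + 1).factorial : ENNReal) * iterInt ω (n + 1) x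
        = n.factorial * (((n : ENNReal) + 1) * iterInt ω (n + 1) x) := by
          rw [Nat.factorial_succ]; push_cast; ring
      _ ≤ n.factorial * (ω (Iio x) * iterInt ω n x) := by
          exact mul_le_mul' le_rfl (succ_mul_iterInt_le ω n x)
      _ = ω (Iio x) * (n.factorial * iterInt ω n x) := by ring
      _ ≤ ω (Iio x) * ω (Iio x) ^ n := by gcongr
      _ = _ := by ring

theorem iterInt_le_ofReal (ω : Measure ℝ) [SFinite ω] (n : ℕ) (x : ℝ) (hx : ω (Iio x) ≠ ⊤) :
    iterInt ω n x ≤ ENNReal.ofReal ((ω (Iio x)).toReal ^ n / n.factorial) := by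
  have hf : (0 : ℝ) < n.factorial := by exact_mod_cast n.factorial_pos
  rw [ENNReal.ofReal_div_of_pos hf, ENNReal.ofReal_pow ENNReal.toReal_nonneg,
    ENNReal.ofReal_toReal hx, ENNReal.ofReal_natCast,
    ENNReal.le_div_iff_mul_le (Or.inl (by exact_mod_cast n.factorial_ne_zero))
      (Or.inl (ENNReal.natCast_ne_top _)), mul_comm]
  exact factorial_mul_iterInt_le ω n x

/-- Gronwall's lemma for integrals over half-lines `(-∞, t)` with respect to a measure `ω`. -/
theorem gronwall_measure (ω : Measure ℝ) [SFinite ω] {φ : ℝ → ENNReal} {A M : ENNReal} {x : ℝ}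
    (hφ : ∀ᵐ t ∂ω, t < x → φ t ≤ A + ∫⁻ s in Iio t, φ s ∂ω)
    (hM : ∀ᵐ t ∂ω, t < x → φ t ≤ M) (hM' : M ≠ ⊤) (hx : ω (Iio x) ≠ ⊤) :
    ∀ᵐ t ∂ω, t < x → φ t ≤ A * ENNReal.ofReal (Real.exp (ω (Iio x)).toReal) := by
  -- Substituting the inequality into itself `n` times leaves a partial sum of the `aₖ` and a
  -- remainder `M aₙ`. The factorial bound sums the former to an exponential and, `M` being finite,
  -- kills the latter.
  have step : ∀ n : ℕ, ∀ᵐ t ∂ω, t < x →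
      φ t ≤ A * ∑ k ∈ Finset.range n, iterInt ω k t + M * iterInt ω n t := by
    intro n
    induction n with
    | zero => filter_upwards [hM] with t ht htx; simpa [iterInt] using ht htx
    | succ n ih =>
      filter_upwards [hφ] with t ht htx
      refine (ht htx).trans ?_
      have h1 : ∫⁻ s in Iio t, φ s ∂ω ≤ ∫⁻ s in Iio t,
          (A * ∑ k ∈ Finset.range n, iterInt ω k s + M * iterInt ω n s) ∂ω := by
        refine lintegral_mono_ae ?_
        refine (ae_restrict_iff' measurableSet_Iio).mpr ?_
        filter_upwards [ih] with s hs hst using hs (lt_trans hst htx)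
      have hm : Measurable fun s => ∑ k ∈ Finset.range n, iterInt ω k s :=
        Finset.measurable_fun_sum _ fun k _ => iterInt_measurable ω k
      rw [lintegral_add_left (hm.const_mul A), lintegral_const_mul _ hm,
        lintegral_const_mul _ (iterInt_measurable ω n),
        lintegral_finsetSum _ fun k _ => iterInt_measurable ω k] at h1
      calc A + ∫⁻ s in Iio t, φ s ∂ω ≤ A + _ := add_le_add le_rfl h1
        _ = _ := by
          rw [Finset.sum_range_succ', ← add_assoc, mul_add]
          simp only [iterInt, mul_one]
          ring
  rw [← ae_all_iff] at step
  filter_upwards [step] with t ht htx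
  set Ω := (ω (Iio x)).toReal
  have hle : ∀ k, iterInt ω k t ≤ ENNReal.ofReal (Ω ^ k / k.factorial) := fun k =>
    (iterInt_monotone ω k htx.le).trans (iterInt_le_ofReal ω k x hx)
  have hb : ∀ n, φ t ≤ A * ENNReal.ofReal (Real.exp Ω) +
      M * ENNReal.ofReal (Ω ^ n / n.factorial) := by
    intro n
    refine (ht n htx).trans ?_
    gcongr
    · calc _ ≤ ∑ k ∈ Finset.range n, ENNReal.ofReal (Ω ^ k / k.factorial) :=
            Finset.sum_le_sum fun k _ => hle k
        _ = ENNReal.ofReal (∑ k ∈ Finset.range n, Ω ^ k / k.factorial) :=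
            (ENNReal.ofReal_sum_of_nonneg fun k _ => by positivity).symm
        _ ≤ _ := ENNReal.ofReal_le_ofReal (Real.sum_le_exp_of_nonneg ENNReal.toReal_nonneg n)
    · exact hle n
  have hlim : Tendsto (fun n : ℕ => A * ENNReal.ofReal (Real.exp Ω) +
      M * ENNReal.ofReal (Ω ^ n / n.factorial)) atTop
      (𝓝 (A * ENNReal.ofReal (Real.exp Ω) + M * ENNReal.ofReal 0)) :=
    tendsto_const_nhds.add (ENNReal.Tendsto.const_mul
      (ENNReal.tendsto_ofReal (FloorSemiring.tendsto_pow_div_factorial_atTop Ω)) (Or.inr hM'))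
  simpa using ge_of_tendsto' hlim hb

/-! ### Integration by parts -/

/-- An s-finite measure has only countably many atoms, and each of those of `μ` is `ν`-null. -/
theorem ae_measure_singleton_eq_zero {μ ν : Measure ℝ} [SFinite μ]
    (h : ∀ x, ν {x} = 0 ∨ μ {x} = 0) : ∀ᵐ x ∂ν, μ {x} = 0 := by
  have hc : {x : ℝ | 0 < μ {x}}.Countable :=
    Measure.countable_meas_pos_of_disjoint_iUnion (fun x => measurableSet_singleton x)
      fun x y hxy => by simpa [Function.onFun] using hxy
  have h0 : ν {x : ℝ | 0 < μ {x}} = 0 := by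
    rw [← biUnion_of_singleton {x : ℝ | 0 < μ {x}}, measure_biUnion_null_iff hc]
    exact fun x hx => (h x).resolve_right (ne_of_gt hx)
  filter_upwards [measure_eq_zero_iff_ae_notMem.mp h0] with x hx
  simpa using hx

theorem measure_prod_diagonal_eq_zero {μ ν : Measure ℝ} [SFinite μ] [SFinite ν]
    (h : ∀ x, ν {x} = 0 ∨ μ {x} = 0) : ν.prod μ {p | p.1 = p.2} = 0 := by
  rw [Measure.measure_prod_null (measurableSet_eq_fun measurable_fst measurable_snd)]
  filter_upwards [ae_measure_singleton_eq_zero h] with x hx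
  have : Prod.mk x ⁻¹' {p : ℝ × ℝ | p.1 = p.2} = {x} := by ext y; simp [eq_comm]
  rw [this, hx]; rfl

/-- The primitive `∫_{(-∞, s)} γ dμ` is a bounded multiplier of functions integrable on `(-∞, x)`. -/
theorem integrableOn_mul_integral {μ ν : Measure ℝ} [SFinite μ] [SFinite ν] {φ γ : ℝ → ℂ} {x : ℝ}
    (hφ : IntegrableOn φ (Iio x) ν) (hγ : IntegrableOn γ (Iio x) μ) :
    IntegrableOn (fun s => φ s * ∫ t in Iio s, γ t ∂μ) (Iio x) ν := by
  have hint : Integrable (fun p : ℝ × ℝ => φ p.1 * γ p.2)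
      ((ν.restrict (Iio x)).prod (μ.restrict (Iio x))) := hφ.mul_prod hγ
  have hm1 : MeasurableSet {p : ℝ × ℝ | p.2 < p.1} := measurableSet_lt measurable_snd measurable_fst
  refine ((hint.indicator hm1).integral_prod_left).congr
    ((ae_restrict_iff' measurableSet_Iio).mpr (Eventually.of_forall fun s hs => ?_))
  have : ∀ t, {p : ℝ × ℝ | p.2 < p.1}.indicator (fun p => φ p.1 * γ p.2) (s, t) =
      (Iio s).indicator (fun t => φ s * γ t) t := fun t => by
    by_cases h : t < s <;> simp [h]
  simp_rw [this]
  rw [integral_indicator measurableSet_Iio, Measure.restrict_restrict measurableSet_Iio,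
    inter_eq_left.mpr (Iio_subset_Iio (le_of_lt hs)), integral_const_mul]

/-- Integration by parts for two measures on the line without common atoms. -/
theorem integral_mul_integral_eq {μ ν : Measure ℝ} [SFinite μ] [SFinite ν]
    (h : ∀ x, ν {x} = 0 ∨ μ {x} = 0) {φ γ : ℝ → ℂ} {x : ℝ}
    (hφ : IntegrableOn φ (Iio x) ν) (hγ : IntegrableOn γ (Iio x) μ) :
    (∫ s in Iio x, φ s ∂ν) * (∫ t in Iio x, γ t ∂μ) =
      (∫ s in Iio x, φ s * (∫ t in Iio s, γ t ∂μ) ∂ν) +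
        ∫ t in Iio x, γ t * (∫ s in Iio t, φ s ∂ν) ∂μ := by
  set ν' := ν.restrict (Iio x)
  set μ' := μ.restrict (Iio x)
  have hint : Integrable (fun p : ℝ × ℝ => φ p.1 * γ p.2) (ν'.prod μ') := hφ.mul_prod hγ
  have h' : ∀ x, ν' {x} = 0 ∨ μ' {x} = 0 := fun y => (h y).imp
    (fun h => Measure.restrict_le_self.absolutelyContinuous h)
    (fun h => Measure.restrict_le_self.absolutelyContinuous h)
  have hm1 : MeasurableSet {p : ℝ × ℝ | p.2 < p.1} := measurableSet_lt measurable_snd measurable_fst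
  have hm2 : MeasurableSet {p : ℝ × ℝ | p.1 < p.2} := measurableSet_lt measurable_fst measurable_snd
  rw [← integral_prod_mul]
  -- The product measure does not charge the diagonal, so only the two open triangles count; Fubini
  -- on each gives one of the two terms.
  have hsplit : (fun p : ℝ × ℝ => φ p.1 * γ p.2) =ᵐ[ν'.prod μ']
      {p : ℝ × ℝ | p.2 < p.1}.indicator (fun p => φ p.1 * γ p.2) +
      {p : ℝ × ℝ | p.1 < p.2}.indicator (fun p => φ p.1 * γ p.2) := by
    filter_upwards [measure_eq_zero_iff_ae_notMem.mp (measure_prod_diagonal_eq_zero h')] with p hp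
    have hp : p.1 ≠ p.2 := hp
    rcases lt_or_gt_of_ne hp with h1 | h1
    · simp [h1, h1.not_gt]
    · simp [h1, h1.not_gt]
  rw [integral_congr_ae hsplit]
  have e : ∀ p : ℝ × ℝ, ({p : ℝ × ℝ | p.2 < p.1}.indicator (fun p => φ p.1 * γ p.2) +
      {p : ℝ × ℝ | p.1 < p.2}.indicator (fun p => φ p.1 * γ p.2)) p =
      {p : ℝ × ℝ | p.2 < p.1}.indicator (fun p => φ p.1 * γ p.2) p +
      {p : ℝ × ℝ | p.1 < p.2}.indicator (fun p => φ p.1 * γ p.2) p := fun _ => rfl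
  simp_rw [e]
  rw [integral_add (hint.indicator hm1) (hint.indicator hm2), integral_prod _ (hint.indicator hm1),
    integral_prod_symm _ (hint.indicator hm2)]
  congr 1
  · refine setIntegral_congr_fun measurableSet_Iio fun s hs => ?_
    have : ∀ t, {p : ℝ × ℝ | p.2 < p.1}.indicator (fun p => φ p.1 * γ p.2) (s, t) =
        (Iio s).indicator (fun t => φ s * γ t) t := fun t => by
      by_cases h : t < s <;> simp [h]
    simp_rw [this]
    rw [integral_indicator measurableSet_Iio, Measure.restrict_restrict measurableSet_Iio,
      inter_eq_left.mpr (Iio_subset_Iio (le_of_lt hs)), integral_const_mul]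
  · refine setIntegral_congr_fun measurableSet_Iio fun s hs => ?_
    have : ∀ t, {p : ℝ × ℝ | p.1 < p.2}.indicator (fun p => φ p.1 * γ p.2) (t, s) =
        (Iio s).indicator (fun t => γ s * φ t) t := fun t => by
      by_cases h : t < s <;> simp [h, mul_comm]
    simp_rw [this]
    rw [integral_indicator measurableSet_Iio, Measure.restrict_restrict measurableSet_Iio,
      inter_eq_left.mpr (Iio_subset_Iio (le_of_lt hs)), integral_const_mul]

end

noncomputable section

/-! ### Basic facts on Lebesgue-Stieltjes measures on `[0, b)` -/

section lsMeasure

variable {b : EReal} {R : ℝ → ℝ}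

instance (b : EReal) (R : ℝ → ℝ) : SFinite (lsMeasure b R) := by
  unfold lsMeasure; infer_instance

theorem halfOpen_of_le {x y : ℝ} (hy : y ∈ halfOpen b) (hx : 0 ≤ x) (hxy : x ≤ y) :
    x ∈ halfOpen b := ⟨hx, lt_of_le_of_lt (by exact_mod_cast hxy) hy.2⟩

theorem exists_gt_mem_halfOpen {x : ℝ} (hx : x ∈ halfOpen b) : ∃ y ∈ halfOpen b, x < y := by
  obtain ⟨y, hy1, hy2⟩ := EReal.lt_iff_exists_real_btwn.mp hx.2
  have hxy : x < y := by exact_mod_cast hy1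
  exact ⟨y, ⟨hx.1.trans hxy.le, hy2⟩, hxy⟩

theorem lsMeasure_ae_mem (hR : MonotoneOn R (halfOpen b)) (h0 : R 0 = 0) (hb : 0 < b) :
    ∀ᵐ x ∂lsMeasure b R, x ∈ halfOpen b := by
  simpa [mem_ae_iff] using lsMeasure_compl hR h0 hb

theorem lsMeasure_restrict_Ico (hR : MonotoneOn R (halfOpen b)) (h0 : R 0 = 0) (hb : 0 < b)
    (x : ℝ) : (lsMeasure b R).restrict (Ico 0 x) = (lsMeasure b R).restrict (Iio x) := by
  refine Measure.restrict_congr_set ?_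
  filter_upwards [lsMeasure_ae_mem hR h0 hb] with y hy
  exact propext ⟨fun h => h.2, fun h => ⟨hy.1, h⟩⟩

theorem lsMeasure_Iio (hR : MonotoneOn R (halfOpen b)) (h0 : R 0 = 0) (hb : 0 < b)
    (hl : ∀ x ∈ halfOpen b, ContinuousWithinAt R (halfOpen b ∩ Iic x) x) {x : ℝ}
    (hx : x ∈ halfOpen b) : lsMeasure b R (Iio x) = ENNReal.ofReal (R x) := by
  have h := lsMeasure_Ico hR h0 hb hl (x := 0) ⟨le_rfl, by simpa using hb⟩ hx
  rw [h0, sub_zero] at h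
  rw [← h, ← Measure.restrict_apply_univ, ← Measure.restrict_apply_univ (Ico 0 x),
    lsMeasure_restrict_Ico hR h0 hb]

theorem lsMeasure_singleton (hR : MonotoneOn R (halfOpen b)) (h0 : R 0 = 0) (hb : 0 < b)
    (hl : ∀ x ∈ halfOpen b, ContinuousWithinAt R (halfOpen b ∩ Iic x) x) {x : ℝ}
    (hx : x ∈ halfOpen b) (hc : ContinuousWithinAt R (halfOpen b) x) :
    lsMeasure b R {x} = 0 := by
  obtain ⟨y, hy, hxy⟩ := exists_gt_mem_halfOpen hx
  have hle : 𝓝[>] x ≤ 𝓝[halfOpen b] x := by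
    refine le_inf nhdsWithin_le_nhds (le_principal_iff.mpr ?_)
    filter_upwards [Ioo_mem_nhdsGT hxy] with t ht
    exact halfOpen_of_le hy (hx.1.trans ht.1.le) ht.2.le
  have ht : Tendsto (fun t => ENNReal.ofReal (R t - R x)) (𝓝[>] x) (𝓝 0) := by
    have : Tendsto (fun t => R t - R x) (𝓝[>] x) (𝓝 (R x - R x)) :=
      (Tendsto.mono_left hc hle).sub_const _
    rw [sub_self] at this
    simpa using ENNReal.tendsto_ofReal this
  refine le_antisymm (ge_of_tendsto ht ?_) zero_le
  filter_upwards [Ioo_mem_nhdsGT hxy] with t ht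
  rw [← lsMeasure_Ico hR h0 hb hl hx (halfOpen_of_le hy (hx.1.trans ht.1.le) ht.2.le)]
  exact measure_mono (by rintro _ rfl; exact ⟨le_rfl, ht.1⟩)

theorem toEnd_neBot (hb : 0 < b) : (toEnd b).NeBot := by
  unfold toEnd
  rw [comap_neBot_iff]
  intro t ht
  obtain ⟨l, hl, hlt⟩ := (mem_nhdsLT_iff_exists_Ioo_subset' hb).mp ht
  obtain ⟨y, hy1, hy2⟩ := EReal.lt_iff_exists_real_btwn.mp hl
  exact ⟨y, hlt ⟨hy1, hy2⟩⟩

theorem eventually_toEnd_lt {y : ℝ} (hy : y ∈ halfOpen b) :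
    ∀ᶠ x in toEnd b, x ∈ halfOpen b ∧ y < x := by
  have : Ioo (y : EReal) b ∈ 𝓝[<] b := Ioo_mem_nhdsLT hy.2
  filter_upwards [preimage_mem_comap this] with x hx
  have hyx : y < x := EReal.coe_lt_coe_iff.mp hx.1
  exact ⟨⟨hy.1.trans hyx.le, hx.2⟩, hyx⟩

instance (b : EReal) : (toEnd b).IsCountablyGenerated := by
  unfold toEnd; infer_instance

end lsMeasure

namespace IntegralSystem

variable (S : IntegralSystem)

instance : SFinite S.dR₁ := by unfold dR₁; infer_instance

instance : SFinite S.dR₂ := by unfold dR₂; infer_instance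

instance : S.atEnd.IsCountablyGenerated := by unfold atEnd; infer_instance

instance : S.atEnd.NeBot := toEnd_neBot S.b_pos

theorem zero_mem_I : (0 : ℝ) ∈ S.I := ⟨le_rfl, by simpa using S.b_pos⟩

theorem dR₁_ae_mem : ∀ᵐ x ∂S.dR₁, x ∈ S.I := lsMeasure_ae_mem S.mono₁ S.zero₁ S.b_pos

theorem dR₂_ae_mem : ∀ᵐ x ∂S.dR₂, x ∈ S.I := lsMeasure_ae_mem S.mono₂ S.zero₂ S.b_pos

theorem dR₁_restrict_Ico (x : ℝ) : S.dR₁.restrict (Ico 0 x) = S.dR₁.restrict (Iio x) :=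
  lsMeasure_restrict_Ico S.mono₁ S.zero₁ S.b_pos x

theorem dR₂_restrict_Ico (x : ℝ) : S.dR₂.restrict (Ico 0 x) = S.dR₂.restrict (Iio x) :=
  lsMeasure_restrict_Ico S.mono₂ S.zero₂ S.b_pos x

variable {S}

theorem dR₁_Iio {x : ℝ} (hx : x ∈ S.I) : S.dR₁ (Iio x) = ENNReal.ofReal (S.R₁ x) :=
  lsMeasure_Iio S.mono₁ S.zero₁ S.b_pos S.leftCont₁ hx

theorem dR₂_Iio {x : ℝ} (hx : x ∈ S.I) : S.dR₂ (Iio x) = ENNReal.ofReal (S.R₂ x) :=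
  lsMeasure_Iio S.mono₂ S.zero₂ S.b_pos S.leftCont₂ hx

theorem R₁_nonneg {x : ℝ} (hx : x ∈ S.I) : 0 ≤ S.R₁ x := by
  rw [← S.zero₁]; exact S.mono₁ S.zero_mem_I hx hx.1

theorem R₂_nonneg {x : ℝ} (hx : x ∈ S.I) : 0 ≤ S.R₂ x := by
  rw [← S.zero₂]; exact S.mono₂ S.zero_mem_I hx hx.1

theorem real_dR₁_Iio {x : ℝ} (hx : x ∈ S.I) : S.dR₁.real (Iio x) = S.R₁ x := by
  rw [Measure.real, dR₁_Iio hx, ENNReal.toReal_ofReal (R₁_nonneg hx)]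

theorem real_dR₂_Iio {x : ℝ} (hx : x ∈ S.I) : S.dR₂.real (Iio x) = S.R₂ x := by
  rw [Measure.real, dR₂_Iio hx, ENNReal.toReal_ofReal (R₂_nonneg hx)]

theorem NoCommonJumps.singleton (h : S.NoCommonJumps) (x : ℝ) :
    S.dR₁ {x} = 0 ∨ S.dR₂ {x} = 0 := by
  by_cases hx : x ∈ S.I
  · exact (h x hx).imp (lsMeasure_singleton S.mono₁ S.zero₁ S.b_pos S.leftCont₁ hx)
      (lsMeasure_singleton S.mono₂ S.zero₂ S.b_pos S.leftCont₂ hx)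
  · exact Or.inl (measure_mono_null (singleton_subset_iff.mpr hx)
      (lsMeasure_compl S.mono₁ S.zero₁ S.b_pos))

theorem eventually_atEnd_gt {y : ℝ} (hy : y ∈ S.I) : ∀ᶠ x in S.atEnd, x ∈ S.I ∧ y < x :=
  eventually_toEnd_lt hy

variable (S) in
theorem eventually_mem_I : ∀ᶠ x in S.atEnd, x ∈ S.I :=
  (eventually_atEnd_gt S.zero_mem_I).mono fun _ h => h.1

theorem solves_iff {u₁ u₂ f : ℝ → ℂ} : S.Solves u₁ u₂ f ↔ ∀ x ∈ S.I,
    IntegrableOn u₂ (Iio x) S.dR₁ ∧ IntegrableOn f (Iio x) S.dR₂ ∧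
    u₁ x = u₁ 0 + ∫ t in Iio x, u₂ t ∂S.dR₁ ∧ u₂ x = u₂ 0 - ∫ t in Iio x, f t ∂S.dR₂ := by
  simp only [Solves, IntegrableOn, dR₁_restrict_Ico, dR₂_restrict_Ico]

theorem Solves.iff_Iio {u₁ u₂ f : ℝ → ℂ} (h : S.Solves u₁ u₂ f) {x : ℝ} (hx : x ∈ S.I) :
    IntegrableOn u₂ (Iio x) S.dR₁ ∧ IntegrableOn f (Iio x) S.dR₂ ∧
    u₁ x = u₁ 0 + ∫ t in Iio x, u₂ t ∂S.dR₁ ∧ u₂ x = u₂ 0 - ∫ t in Iio x, f t ∂S.dR₂ :=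
  solves_iff.mp h x hx

theorem Solves.congr_rhs {u₁ u₂ f g : ℝ → ℂ} (h : S.Solves u₁ u₂ f) (hfg : f =ᵐ[S.dR₂] g) :
    S.Solves u₁ u₂ g := by
  intro x hx
  obtain ⟨a1, a2, a3, a4⟩ := h x hx
  exact ⟨a1, a2.congr (ae_restrict_of_ae hfg), a3, by
    rw [a4, integral_congr_ae (ae_restrict_of_ae hfg)]⟩

theorem tendsto_integral_Iio {μ : Measure ℝ} (hμ : ∀ᵐ x ∂μ, x ∈ S.I) {f : ℝ → ℂ}
    (hf : Integrable f μ) :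
    Tendsto (fun x => ∫ t in Iio x, f t ∂μ) S.atEnd (𝓝 (∫ t, f t ∂μ)) := by
  simp_rw [← integral_indicator (measurableSet_Iio (a := _))]
  refine tendsto_integral_filter_of_dominated_convergence (fun t => ‖f t‖)
    (Eventually.of_forall fun x => hf.aestronglyMeasurable.indicator measurableSet_Iio)
    (Eventually.of_forall fun x => Eventually.of_forall fun t =>
      norm_indicator_le_norm_self _ _) hf.norm ?_
  filter_upwards [hμ] with t ht
  refine tendsto_const_nhds.congr' ?_
  filter_upwards [eventually_atEnd_gt ht] with x hx
  simp [hx.2]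

/-- The filter at `b` is countably generated, so countably many half-lines exhaust `[0, b)`. -/
theorem ae_of_forall_Iio {μ : Measure ℝ} (hμ : ∀ᵐ x ∂μ, x ∈ S.I) {p : ℝ → Prop}
    (h : ∀ x ∈ S.I, ∀ᵐ t ∂μ, t < x → p t) : ∀ᵐ t ∂μ, p t := by
  obtain ⟨x, hx⟩ := S.atEnd.exists_seq_tendsto
  obtain ⟨N, hN⟩ := eventually_atTop.mp (hx.eventually S.eventually_mem_I)
  have h' : ∀ n, ∀ᵐ t ∂μ, N ≤ n → t < x n → p t := fun n => by
    by_cases hn : N ≤ n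
    · simpa [hn] using h _ (hN n hn)
    · simp [hn]
  filter_upwards [hμ, ae_all_iff.mpr h'] with t ht h1
  obtain ⟨n, hn, hn'⟩ := ((hx.eventually (eventually_atEnd_gt ht)).and
    (eventually_ge_atTop N)).exists
  exact h1 n hn' hn.2

theorem aestronglyMeasurable_R₁ :
    AEStronglyMeasurable (fun x => (S.R₁ x : ℂ)) S.dR₂ := by
  have h : AEMeasurable S.R₁ (S.dR₂.restrict S.I) :=
    aemeasurable_restrict_of_monotoneOn (measurableSet_halfOpen S.b) S.mono₁
  rw [Measure.restrict_eq_self_of_ae_mem S.dR₂_ae_mem] at h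
  exact (Complex.measurable_ofReal.comp_aemeasurable h).aestronglyMeasurable

theorem aemeasurable_ofReal_R₁ : AEMeasurable (fun x => ENNReal.ofReal (S.R₁ x)) S.dR₂ :=
  (Complex.measurable_re.comp_aemeasurable
    (aestronglyMeasurable_R₁ (S := S)).aemeasurable).ennreal_ofReal

/-! ### Uniqueness for the homogeneous system and the Wronskian -/

/-- With `φ(x) = ∫_{[0,x)} |z y₁| dR₂` one has `|y₂| ≤ φ` and `|y₁| ≤ R₁ φ`, hence `φ(x) ≤ ∫_{[0,x)}
φ dω` for `dω = |z| R₁ dR₂`. Gronwall with constant term `0` gives `φ = 0`. -/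
theorem Solves.eq_zero {z : ℂ} {y₁ y₂ : ℝ → ℂ} (h : S.Solves y₁ y₂ fun t => z * y₁ t)
    (h1 : y₁ 0 = 0) (h2 : y₂ 0 = 0) {x : ℝ} (hx : x ∈ S.I) : y₁ x = 0 ∧ y₂ x = 0 := by
  set φ : ℝ → ENNReal := fun x => ∫⁻ t in Iio x, ‖z * y₁ t‖ₑ ∂S.dR₂ with hφ
  have hφm : Monotone φ := fun s t hst => lintegral_mono_set (Iio_subset_Iio hst)
  have hφfin : ∀ s ∈ S.I, φ s ≠ ⊤ := fun s hs => (h.iff_Iio hs).2.1.2.ne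
  have hy2 : ∀ s ∈ S.I, ‖y₂ s‖ₑ ≤ φ s := fun s hs => by
    rw [(h.iff_Iio hs).2.2.2, h2, zero_sub, enorm_neg]
    exact enorm_integral_le_lintegral_enorm _
  have hy1 : ∀ s ∈ S.I, ‖y₁ s‖ₑ ≤ ENNReal.ofReal (S.R₁ s) * φ s := fun s hs => by
    rw [(h.iff_Iio hs).2.2.1, h1, zero_add]
    calc _ ≤ ∫⁻ t in Iio s, ‖y₂ t‖ₑ ∂S.dR₁ := enorm_integral_le_lintegral_enorm _
      _ ≤ ∫⁻ t in Iio s, φ s ∂S.dR₁ := by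
        refine lintegral_mono_ae ((ae_restrict_iff' measurableSet_Iio).mpr ?_)
        filter_upwards [S.dR₁_ae_mem] with t ht hts
        exact (hy2 t ht).trans (hφm (le_of_lt hts))
      _ = _ := by rw [setLIntegral_const, dR₁_Iio hs, mul_comm]
  set r : ℝ → ENNReal := fun t => ‖z‖ₑ * ENNReal.ofReal (S.R₁ t) with hr
  have hrm : AEMeasurable r S.dR₂ := aemeasurable_ofReal_R₁.const_mul _
  set ω := S.dR₂.withDensity r
  have hle : ∀ s ∈ S.I, φ s ≤ ∫⁻ t in Iio s, φ t ∂ω := fun s hs => by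
    rw [setLIntegral_withDensity_eq_lintegral_mul₀ hrm
      hφm.measurable.aemeasurable measurableSet_Iio]
    refine lintegral_mono_ae ((ae_restrict_iff' measurableSet_Iio).mpr ?_)
    filter_upwards [S.dR₂_ae_mem] with t ht hts
    rw [enorm_mul, Pi.mul_apply, hr, mul_assoc]
    exact mul_le_mul' le_rfl (hy1 t ht)
  have hωI : ∀ᵐ t ∂ω, t ∈ S.I := (withDensity_absolutelyContinuous _ _).ae_le S.dR₂_ae_mem
  have hωfin : ω (Iio x) ≠ ⊤ := by
    rw [withDensity_apply _ measurableSet_Iio]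
    refine ne_top_of_le_ne_top (b := ∫⁻ t in Iio x, ‖z‖ₑ * ENNReal.ofReal (S.R₁ x) ∂S.dR₂) ?_ ?_
    · rw [setLIntegral_const, dR₂_Iio hx]
      exact ENNReal.mul_ne_top (ENNReal.mul_ne_top enorm_ne_top ENNReal.ofReal_ne_top)
        ENNReal.ofReal_ne_top
    · refine lintegral_mono_ae ((ae_restrict_iff' measurableSet_Iio).mpr ?_)
      filter_upwards [S.dR₂_ae_mem] with t ht hts
      rw [hr]
      exact mul_le_mul' le_rfl (ENNReal.ofReal_le_ofReal (S.mono₁ ht hx (le_of_lt hts)))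
  have hg := gronwall_measure ω (φ := φ) (A := 0) (M := φ x) (x := x)
    (by filter_upwards [hωI] with t ht _; simpa using hle t ht)
    (Eventually.of_forall fun t ht => hφm ht.le) (hφfin x hx) hωfin
  have h0 : φ x = 0 := by
    refine le_antisymm ((hle x hx).trans ?_) zero_le
    rw [← lintegral_zero (μ := ω.restrict (Iio x))]
    refine lintegral_mono_ae ((ae_restrict_iff' measurableSet_Iio).mpr ?_)
    filter_upwards [hg] with t ht htx
    simpa using ht htx
  have a1 := hy1 x hx
  have a2 := hy2 x hx
  rw [h0] at a1 a2
  simpa using And.intro a1 a2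

theorem Solves.sub {u₁ u₂ f v₁ v₂ g : ℝ → ℂ} (h : S.Solves u₁ u₂ f) (k : S.Solves v₁ v₂ g) :
    S.Solves (fun x => u₁ x - v₁ x) (fun x => u₂ x - v₂ x) (fun x => f x - g x) := by
  have := h.add (k.smul (-1))
  convert this using 1 <;> ext x <;> simp <;> ring

theorem Solves.eqOn {z : ℂ} {u₁ u₂ v₁ v₂ : ℝ → ℂ} (h : S.Solves u₁ u₂ fun t => z * u₁ t)
    (k : S.Solves v₁ v₂ fun t => z * v₁ t) (h1 : u₁ 0 = v₁ 0) (h2 : u₂ 0 = v₂ 0) :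
    EqOn u₁ v₁ S.I ∧ EqOn u₂ v₂ S.I := by
  have hd : S.Solves (fun x => u₁ x - v₁ x) (fun x => u₂ x - v₂ x)
      (fun x => z * (u₁ x - v₁ x)) := by
    simpa only [mul_sub] using h.sub k
  have h0 := fun x (hx : x ∈ S.I) => hd.eq_zero (by simp [h1]) (by simp [h2]) hx
  exact ⟨fun x hx => sub_eq_zero.mp (h0 x hx).1, fun x hx => sub_eq_zero.mp (h0 x hx).2⟩

/-- Together with the companion for `g u₁`, this rewrites the two iterated integrals from
integration by parts in terms of the solutions themselves. -/
theorem Solves.integrableOn_mul₂ {u₁ u₂ f w₁ w₂ g : ℝ → ℂ} (h : S.Solves u₁ u₂ f)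
    (k : S.Solves w₁ w₂ g) {x : ℝ} (hx : x ∈ S.I) :
    IntegrableOn (fun t => u₂ t * w₂ t) (Iio x) S.dR₁ ∧
      ∫ s in Iio x, u₂ s * (∫ t in Iio s, g t ∂S.dR₂) ∂S.dR₁ =
        w₂ 0 * (∫ s in Iio x, u₂ s ∂S.dR₁) - ∫ t in Iio x, u₂ t * w₂ t ∂S.dR₁ := by
  obtain ⟨a1, -, a3, -⟩ := h.iff_Iio hx
  obtain ⟨-, c2, -, c4⟩ := k.iff_Iio hx
  have hi := integrableOn_mul_integral a1 c2
  have hae : (fun t => u₂ t * w₂ t) =ᵐ[S.dR₁.restrict (Iio x)]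
      fun s => w₂ 0 * u₂ s - u₂ s * ∫ t in Iio s, g t ∂S.dR₂ := by
    filter_upwards [ae_restrict_of_ae S.dR₁_ae_mem] with s hs
    rw [(k.iff_Iio hs).2.2.2]; ring
  refine ⟨((a1.const_mul _).sub hi).congr hae.symm, ?_⟩
  rw [integral_congr_ae hae, integral_sub (a1.const_mul _) hi, integral_const_mul]
  ring

theorem Solves.integrableOn_mul₁ {u₁ u₂ f w₁ w₂ g : ℝ → ℂ} (h : S.Solves u₁ u₂ f)
    (k : S.Solves w₁ w₂ g) {x : ℝ} (hx : x ∈ S.I) :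
    IntegrableOn (fun t => g t * u₁ t) (Iio x) S.dR₂ ∧
      ∫ s in Iio x, g s * (∫ t in Iio s, u₂ t ∂S.dR₁) ∂S.dR₂ =
        (∫ s in Iio x, g s * u₁ s ∂S.dR₂) - u₁ 0 * ∫ s in Iio x, g s ∂S.dR₂ := by
  obtain ⟨a1, -, a3, -⟩ := h.iff_Iio hx
  obtain ⟨-, c2, -, c4⟩ := k.iff_Iio hx
  have hi := integrableOn_mul_integral c2 a1
  have hae : (fun t => g t * u₁ t) =ᵐ[S.dR₂.restrict (Iio x)]
      fun s => u₁ 0 * g s + g s * ∫ t in Iio s, u₂ t ∂S.dR₁ := by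
    filter_upwards [ae_restrict_of_ae S.dR₂_ae_mem] with s hs
    rw [(h.iff_Iio hs).2.2.1]; ring
  refine ⟨((c2.const_mul _).add hi).congr hae.symm, ?_⟩
  rw [integral_congr_ae hae, integral_add (c2.const_mul _) hi, integral_const_mul]
  ring

/-- The product rule for `u₁ w₂`. -/
theorem Solves.mul_eq (hj : S.NoCommonJumps) {u₁ u₂ f w₁ w₂ g : ℝ → ℂ} (h : S.Solves u₁ u₂ f)
    (k : S.Solves w₁ w₂ g) {x : ℝ} (hx : x ∈ S.I) :
    u₁ x * w₂ x = u₁ 0 * w₂ 0 + (∫ t in Iio x, u₂ t * w₂ t ∂S.dR₁) -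
      ∫ t in Iio x, g t * u₁ t ∂S.dR₂ := by
  obtain ⟨a1, -, a3, -⟩ := h.iff_Iio hx
  obtain ⟨-, c2, -, c4⟩ := k.iff_Iio hx
  have hP := integral_mul_integral_eq hj.singleton a1 c2
  rw [(h.integrableOn_mul₂ k hx).2, (h.integrableOn_mul₁ k hx).2] at hP
  rw [a3, c4]
  linear_combination -hP

/-- In the two product rules the integrals coincide, because both solutions have the same spectral
parameter. -/
theorem Solves.wronskian (hj : S.NoCommonJumps) {z : ℂ} {u₁ u₂ w₁ w₂ : ℝ → ℂ}
    (h : S.Solves u₁ u₂ fun t => z * u₁ t) (k : S.Solves w₁ w₂ fun t => z * w₁ t) {x : ℝ}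
    (hx : x ∈ S.I) : u₁ x * w₂ x - w₁ x * u₂ x = u₁ 0 * w₂ 0 - w₁ 0 * u₂ 0 := by
  rw [h.mul_eq hj k hx, k.mul_eq hj h hx]
  have e1 : ∀ t, w₂ t * u₂ t = u₂ t * w₂ t := fun t => mul_comm _ _
  have e2 : ∀ t, z * w₁ t * u₁ t = z * u₁ t * w₁ t := fun t => by ring
  simp_rw [e1, e2]
  ring

/-- The pair `(R₁, 1)` solves the system with zero right-hand side; inserting it in the product rule
isolates `R₁ u₂`. -/
theorem solves_R₁ : S.Solves (fun x => S.R₁ x) (fun _ => 1) (fun _ => 0) := by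
  refine solves_iff.mpr fun x hx => ⟨?_, integrableOn_zero, ?_, by simp⟩
  · rw [integrableOn_const_iff]
    right; rw [dR₁_Iio hx]; exact ENNReal.ofReal_lt_top
  · simp [S.zero₁, real_dR₁_Iio hx]

/-- `u₁ - R₁ u₂` is an integral with respect to `dR₂`. -/
theorem Solves.eq_R₁_mul (hj : S.NoCommonJumps) {u₁ u₂ f : ℝ → ℂ} (h : S.Solves u₁ u₂ f) {x : ℝ}
    (hx : x ∈ S.I) : IntegrableOn (fun t => f t * S.R₁ t) (Iio x) S.dR₂ ∧
    u₁ x = u₁ 0 + S.R₁ x * u₂ x + ∫ t in Iio x, f t * S.R₁ t ∂S.dR₂ := by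
  refine ⟨(solves_R₁.integrableOn_mul₁ h hx).1, ?_⟩
  have := solves_R₁.mul_eq hj h hx
  simp only [S.zero₁, Complex.ofReal_zero, zero_mul, one_mul, zero_add] at this
  rw [(h.iff_Iio hx).2.2.1]
  linear_combination -this

end IntegralSystem

end

noncomputable section

namespace IntegralSystem

variable {S : IntegralSystem}

/-! ### Consequences of the limit circle condition -/

theorem Represents.solves_of_mem_kerSub {z : ℂ} {p : S.L2} (hp : p ∈ LinRel.kerSub S.Tmax z) :
    ∃ u₁ u₂ : ℝ → ℂ, p =ᵐ[S.dR₂] u₁ ∧ MemLp u₁ 2 S.dR₂ ∧ S.Solves u₁ u₂ fun t => z * u₁ t := by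
  obtain ⟨u₁, u₂, f, ⟨h1, -, h3⟩, h4, h5⟩ := hp
  refine ⟨u₁, u₂, h4, h1, h3.congr_rhs ?_⟩
  filter_upwards [h4, h5, Lp.coeFn_smul z p] with t a1 a2 a3
  rw [← a2, a3, ← a1]; rfl

/-- By uniqueness a solution is determined by its initial values, so two solutions independent in
`L²` have independent initial vectors, that is, nonzero Wronskian at `0`. -/
theorem IsLimitCircle.exists_wronskian_ne_zero (h : S.IsLimitCircle) :
    ∃ (z : ℂ) (u₁ u₂ w₁ w₂ : ℝ → ℂ), MemLp u₁ 2 S.dR₂ ∧ MemLp w₁ 2 S.dR₂ ∧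
      (S.Solves u₁ u₂ fun t => z * u₁ t) ∧ (S.Solves w₁ w₂ fun t => z * w₁ t) ∧
      u₁ 0 * w₂ 0 - w₁ 0 * u₂ 0 ≠ 0 := by
  obtain ⟨z, -, hz⟩ := h
  have hfin : Module.finrank ℂ (LinRel.kerSub S.Tmax z) = 2 :=
    Module.finrank_eq_of_rank_eq (by simpa using hz)
  have : FiniteDimensional ℂ (LinRel.kerSub S.Tmax z) :=
    FiniteDimensional.of_finrank_pos (by omega)
  let B := Module.finBasisOfFinrankEq ℂ (LinRel.kerSub S.Tmax z) hfin
  obtain ⟨u₁, u₂, hu, hu1, hus⟩ := Represents.solves_of_mem_kerSub (B 0).2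
  obtain ⟨w₁, w₂, hw, hw1, hws⟩ := Represents.solves_of_mem_kerSub (B 1).2
  refine ⟨z, u₁, u₂, w₁, w₂, hu1, hw1, hus, hws, fun hW => ?_⟩
  have hlin := LinearIndependent.pair_iff.mp
    (show LinearIndependent ℂ ![B 0, B 1] by
      have := B.linearIndependent
      convert this using 1
      ext i; fin_cases i <;> rfl)
  have key : ∀ α β : ℂ, α * u₁ 0 + β * w₁ 0 = 0 → α * u₂ 0 + β * w₂ 0 = 0 → α = 0 ∧ β = 0 := by
    intro α β h1 h2
    apply hlin
    have hs : S.Solves (fun x => α * u₁ x + β * w₁ x) (fun x => α * u₂ x + β * w₂ x)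
        fun x => z * (α * u₁ x + β * w₁ x) := by
      have h3 := (hus.smul α).add (hws.smul β)
      have e : (α • fun t => z * u₁ t) + (β • fun t => z * w₁ t) =
          fun x => z * (α * u₁ x + β * w₁ x) := by
        ext x
        simp only [Pi.add_apply, Pi.smul_apply, smul_eq_mul]
        ring
      rw [e] at h3
      exact h3
    apply Subtype.ext
    apply Lp.ext
    have e : ((α • B 0 + β • B 1 : LinRel.kerSub S.Tmax z) : S.L2) =
        α • ((B 0 : LinRel.kerSub S.Tmax z) : S.L2) +
        β • ((B 1 : LinRel.kerSub S.Tmax z) : S.L2) := rfl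
    rw [e]
    filter_upwards [Lp.coeFn_add (α • ((B 0 : LinRel.kerSub S.Tmax z) : S.L2))
      (β • ((B 1 : LinRel.kerSub S.Tmax z) : S.L2)), Lp.coeFn_smul α
      ((B 0 : LinRel.kerSub S.Tmax z) : S.L2), Lp.coeFn_smul β
      ((B 1 : LinRel.kerSub S.Tmax z) : S.L2), hu, hw, S.dR₂_ae_mem,
      Lp.coeFn_zero ℂ 2 S.dR₂] with x a1 a2 a3 a4 a5 hx a6
    rw [a1, Pi.add_apply, a2, a3, Pi.smul_apply, Pi.smul_apply, a4, a5]
    refine Eq.trans ?_ a6.symm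
    simpa using (hs.eq_zero (by simpa using h1) (by simpa using h2) hx).1
  -- If the Wronskian vanishes, these two combinations have zero initial values. Then `u₁(0) = u₂(0)
  -- = 0`, so the pair `(1, 0)` is annihilated too, a contradiction.
  have k1 := key (w₁ 0) (-u₁ 0) (by ring) (by linear_combination -hW)
  have k2 := key (w₂ 0) (-u₂ 0) (by linear_combination hW) (by ring)
  have k3 := key 1 0 (by simpa using k1.2) (by simpa using k2.2)
  exact one_ne_zero k3.1

/-- Let `g = 1 + R₁` and, for a solution `v`, `X(v) = v₂ + R₁ v₂ - v₁`. Then `X(v) = X(v)(0) - z ∫ g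
v₁ dR₂`, while the constant Wronskian gives `W g = u₁ X(w) - w₁ X(u)`. With `η = |u₁| + |w₁|` and `φ
= C + |z| ∫ g η dR₂` this reads `g ≤ 2 |W|⁻¹ η φ`, so `φ ≤ C + ∫ φ κ η² dR₂`. As `η ∈ L²`, the
measure `κ η² dR₂` is finite, Gronwall bounds `φ`, and `g` is at most a multiple of `η`. -/
theorem IsLimitCircle.memLp_one_add_R₁ (hj : S.NoCommonJumps) (h : S.IsLimitCircle) :
    MemLp (fun x => 1 + (S.R₁ x : ℂ)) 2 S.dR₂ := by
  obtain ⟨z, u₁, u₂, w₁, w₂, hu, hw, hus, hws, hW⟩ := h.exists_wronskian_ne_zero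
  set W := u₁ 0 * w₂ 0 - w₁ 0 * u₂ 0 with hWdef
  set η : ℝ → ℝ := fun t => ‖u₁ t‖ + ‖w₁ t‖ with hη
  have hηL : MemLp η 2 S.dR₂ := hu.norm.add hw.norm
  have hη0 : ∀ t, 0 ≤ η t := fun t => by positivity
  have huη : ∀ t, ‖u₁ t‖ₑ ≤ ‖η t‖ₑ := fun t => by
    rw [enorm_le_iff_norm_le, Real.norm_of_nonneg (hη0 t)]; simp [hη]
  have hwη : ∀ t, ‖w₁ t‖ₑ ≤ ‖η t‖ₑ := fun t => by
    rw [enorm_le_iff_norm_le, Real.norm_of_nonneg (hη0 t)]; simp [hη]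
  set g : ℝ → ℂ := fun t => 1 + (S.R₁ t : ℂ) with hg
  have hgm : AEStronglyMeasurable g S.dR₂ := aestronglyMeasurable_const.add aestronglyMeasurable_R₁
  set ψ : ℝ → ENNReal := fun x => ∫⁻ t in Iio x, ‖g t‖ₑ * ‖η t‖ₑ ∂S.dR₂ with hψ
  -- each solution satisfies the same integral bound
  have hX : ∀ v₁ v₂ : ℝ → ℂ, (S.Solves v₁ v₂ fun t => z * v₁ t) → (∀ t, ‖v₁ t‖ₑ ≤ ‖η t‖ₑ) →
      ∀ x ∈ S.I, ‖v₂ x + (S.R₁ x * v₂ x - v₁ x)‖ₑ ≤ ‖v₂ 0 - v₁ 0‖ₑ + ‖z‖ₑ * ψ x := by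
    intro v₁ v₂ hv hvη x hx
    obtain ⟨i1, e1⟩ := hv.eq_R₁_mul hj hx
    obtain ⟨-, i2, -, e2⟩ := hv.iff_Iio hx
    have e : v₂ x + (S.R₁ x * v₂ x - v₁ x) =
        (v₂ 0 - v₁ 0) - ∫ t in Iio x, (z * v₁ t + z * v₁ t * S.R₁ t) ∂S.dR₂ := by
      rw [integral_add i2 i1]
      linear_combination e2 - e1
    rw [e]
    refine (enorm_sub_le).trans (add_le_add le_rfl ((enorm_integral_le_lintegral_enorm _).trans ?_))
    rw [hψ, ← lintegral_const_mul' _ _ enorm_ne_top]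
    refine lintegral_mono fun t => ?_
    have : z * v₁ t + z * v₁ t * S.R₁ t = z * (g t * v₁ t) := by rw [hg]; ring
    rw [this, enorm_mul, enorm_mul]
    exact mul_le_mul' le_rfl (mul_le_mul' le_rfl (hvη t))
  set C : ENNReal := ‖w₂ 0 - w₁ 0‖ₑ + ‖u₂ 0 - u₁ 0‖ₑ with hC
  have hCfin : C ≠ ⊤ := by simp [hC]
  set φ : ℝ → ENNReal := fun x => C + ‖z‖ₑ * ψ x with hφ
  have hφm : Monotone φ := fun s t hst =>
    add_le_add le_rfl (mul_le_mul' le_rfl (lintegral_mono_set (Iio_subset_Iio hst)))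
  have hgle : ∀ x ∈ S.I, ‖g x‖ₑ ≤ ‖W‖ₑ⁻¹ * (2 * (‖η x‖ₑ * φ x)) := by
    intro x hx
    have hw' := hus.wronskian hj hws hx
    have e : W * g x = u₁ x * (w₂ x + (S.R₁ x * w₂ x - w₁ x)) -
        w₁ x * (u₂ x + (S.R₁ x * u₂ x - u₁ x)) := by
      rw [hg, hWdef, ← hw']; ring
    have hW0 : ‖W‖ₑ ≠ 0 := by simpa using hW
    rw [← ENNReal.mul_le_iff_le_inv hW0 enorm_ne_top, ← enorm_mul, e, two_mul]
    refine enorm_sub_le.trans (add_le_add ?_ ?_) <;> rw [enorm_mul]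
    · refine mul_le_mul' (huη x) ((hX _ _ hws hwη x hx).trans ?_)
      exact add_le_add (by rw [hC]; exact le_self_add) le_rfl
    · refine mul_le_mul' (hwη x) ((hX _ _ hus huη x hx).trans ?_)
      exact add_le_add (by rw [hC]; exact le_add_self) le_rfl
  set κ : ENNReal := ‖z‖ₑ * (‖W‖ₑ⁻¹ * 2) with hκ
  have hκfin : κ ≠ ⊤ := ENNReal.mul_ne_top enorm_ne_top
    (ENNReal.mul_ne_top (ENNReal.inv_ne_top.mpr (by simpa using hW)) (by simp))
  have hηm : AEMeasurable (fun t => κ * ‖η t‖ₑ ^ 2) S.dR₂ :=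
    (hηL.1.enorm.pow_const 2).const_mul κ
  set ω := S.dR₂.withDensity fun t => κ * ‖η t‖ₑ ^ 2 with hω
  have hωfin : ω univ ≠ ⊤ := by
    rw [hω, withDensity_apply _ MeasurableSet.univ, setLIntegral_univ,
      lintegral_const_mul' _ _ hκfin]
    refine ENNReal.mul_ne_top hκfin ?_
    have := (eLpNorm_lt_top_iff_lintegral_rpow_enorm_lt_top (by simp) (by simp)).mp hηL.2
    simpa using this.ne
  have hωI : ∀ᵐ t ∂ω, t ∈ S.I := (withDensity_absolutelyContinuous _ _).ae_le S.dR₂_ae_mem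
  have hφle : ∀ x, φ x ≤ C + ∫⁻ t in Iio x, φ t ∂ω := by
    intro x
    rw [setLIntegral_withDensity_eq_lintegral_mul₀ hηm hφm.measurable.aemeasurable
      measurableSet_Iio]
    refine add_le_add le_rfl ?_
    rw [hψ, ← lintegral_const_mul' _ _ enorm_ne_top]
    refine lintegral_mono_ae (ae_restrict_of_ae ?_)
    filter_upwards [S.dR₂_ae_mem] with t ht
    calc ‖z‖ₑ * (‖g t‖ₑ * ‖η t‖ₑ) ≤ ‖z‖ₑ * (‖W‖ₑ⁻¹ * (2 * (‖η t‖ₑ * φ t)) * ‖η t‖ₑ) :=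
          mul_le_mul' le_rfl (mul_le_mul' (hgle t ht) le_rfl)
      _ = _ := by rw [Pi.mul_apply, hκ]; ring
  -- This a priori bound depends on `x` through `R₁(x)`; Gronwall needs it only to be finite, and
  -- its conclusion `C'` no longer depends on `x`.
  have hφfin : ∀ x ∈ S.I, φ x ≠ ⊤ := by
    intro x hx
    refine ENNReal.add_ne_top.mpr ⟨hCfin, ENNReal.mul_ne_top enorm_ne_top ?_⟩
    have : IsFiniteMeasure (S.dR₂.restrict (Iio x)) :=
      ⟨by rw [Measure.restrict_apply_univ, dR₂_Iio hx]; exact ENNReal.ofReal_lt_top⟩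
    have hi : Integrable η (S.dR₂.restrict (Iio x)) := (hηL.restrict _).integrable (by norm_num)
    refine ne_top_of_le_ne_top (b := ∫⁻ t in Iio x, ENNReal.ofReal (1 + S.R₁ x) * ‖η t‖ₑ ∂S.dR₂)
      ?_ ?_
    · rw [lintegral_const_mul' _ _ ENNReal.ofReal_ne_top]
      exact ENNReal.mul_ne_top ENNReal.ofReal_ne_top hi.2.ne
    · refine lintegral_mono_ae ((ae_restrict_iff' measurableSet_Iio).mpr ?_)
      filter_upwards [S.dR₂_ae_mem] with t ht htx
      refine mul_le_mul' ?_ le_rfl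
      have e : g t = ((1 + S.R₁ t : ℝ) : ℂ) := by simp [hg]
      rw [e, ← ofReal_norm, Complex.norm_real,
        Real.norm_of_nonneg (by linarith [R₁_nonneg ht])]
      exact ENNReal.ofReal_le_ofReal (by linarith [S.mono₁ ht hx (le_of_lt htx)])
  set C' : ENNReal := C * ENNReal.ofReal (Real.exp (ω univ).toReal) with hC'
  have hC'fin : C' ≠ ⊤ := ENNReal.mul_ne_top hCfin ENNReal.ofReal_ne_top
  have hae : ∀ᵐ t ∂ω, φ t ≤ C' := by
    refine ae_of_forall_Iio hωI fun x hx => ?_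
    have hωx : ω (Iio x) ≠ ⊤ := ne_top_of_le_ne_top hωfin (measure_mono (subset_univ _))
    filter_upwards [gronwall_measure ω (A := C) (M := φ x)
      (Eventually.of_forall fun t _ => hφle t)
      (Eventually.of_forall fun t ht => hφm (le_of_lt ht)) (hφfin x hx) hωx] with t ht htx
    refine (ht htx).trans (mul_le_mul' le_rfl (ENNReal.ofReal_le_ofReal ?_))
    exact Real.exp_le_exp.mpr (ENNReal.toReal_mono hωfin (measure_mono (subset_univ _)))
  -- The bound `C'` holds only `ω`-almost everywhere, which says nothing where `η = 0`. Inserting it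
  -- once more into the integral inequality gives a bound at every point.
  set D : ENNReal := C + C' * ω univ with hD
  have hDfin : D ≠ ⊤ := ENNReal.add_ne_top.mpr ⟨hCfin, ENNReal.mul_ne_top hC'fin hωfin⟩
  have hφD : ∀ x, φ x ≤ D := fun x => by
    refine (hφle x).trans (add_le_add le_rfl ?_)
    calc _ ≤ ∫⁻ t in Iio x, C' ∂ω := lintegral_mono_ae (ae_restrict_of_ae hae)
      _ ≤ _ := by rw [setLIntegral_const]; exact mul_le_mul' le_rfl (measure_mono (subset_univ _))
  refine hηL.of_le_mul (c := (‖W‖ₑ⁻¹ * (2 * D)).toReal) hgm ?_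
  filter_upwards [S.dR₂_ae_mem] with x hx
  have hfin : ‖W‖ₑ⁻¹ * (2 * D) ≠ ⊤ := ENNReal.mul_ne_top
    (ENNReal.inv_ne_top.mpr (by simpa using hW)) (ENNReal.mul_ne_top (by simp) hDfin)
  have h1 : ‖g x‖ₑ ≤ ‖W‖ₑ⁻¹ * (2 * D) * ‖η x‖ₑ := by
    refine (hgle x hx).trans ?_
    calc _ ≤ ‖W‖ₑ⁻¹ * (2 * (‖η x‖ₑ * D)) := by gcongr; exact hφD x
      _ = _ := by ring
  have := ENNReal.toReal_mono (ENNReal.mul_ne_top hfin enorm_ne_top) h1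
  simpa [ENNReal.toReal_mul] using this

theorem IsLimitCircle.memLp_one (hj : S.NoCommonJumps) (h : S.IsLimitCircle) :
    MemLp (fun _ => (1 : ℂ)) 2 S.dR₂ := by
  refine (h.memLp_one_add_R₁ hj).of_le aestronglyMeasurable_const ?_
  filter_upwards [S.dR₂_ae_mem] with x hx
  have e : 1 + (S.R₁ x : ℂ) = ((1 + S.R₁ x : ℝ) : ℂ) := by simp
  rw [e, Complex.norm_real, Real.norm_of_nonneg (by linarith [R₁_nonneg hx])]
  simpa using R₁_nonneg hx

theorem IsLimitCircle.isFiniteMeasure (hj : S.NoCommonJumps) (h : S.IsLimitCircle) :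
    IsFiniteMeasure S.dR₂ := by
  have := (memLp_const_iff (by simp) (by simp)).mp (h.memLp_one hj)
  exact ⟨by simpa using this⟩

theorem IsLimitCircle.memLp_R₁ (hj : S.NoCommonJumps) (h : S.IsLimitCircle) :
    MemLp (fun x => (S.R₁ x : ℂ)) 2 S.dR₂ := by
  refine ((h.memLp_one_add_R₁ hj).sub (h.memLp_one hj)).ae_eq (Eventually.of_forall fun x => ?_)
  simp

theorem tendsto_R₂ [IsFiniteMeasure S.dR₂] : Tendsto S.R₂ S.atEnd (𝓝 (S.dR₂.real univ)) := by
  have := tendsto_integral_Iio S.dR₂_ae_mem (integrable_const (1 : ℂ))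
  have h2 := (Complex.continuous_re.tendsto _).comp this
  refine (Tendsto.congr' ?_ (by simpa using h2))
  filter_upwards [S.eventually_mem_I] with x hx
  simp [real_dR₂_Iio hx]

/-- Since `dR₂` is finite, `R₂` has a finite limit and the divergence must come from `R₁`. -/
theorem IsSingular.tendsto_R₁ (h : S.IsSingular) [IsFiniteMeasure S.dR₂] :
    Tendsto S.R₁ S.atEnd atTop := by
  have := h.atTop_add tendsto_R₂.neg
  refine this.congr fun x => ?_
  ring

end IntegralSystem

end

noncomputable section

namespace IntegralSystem

variable (S : IntegralSystem)

/-! ### The integral operator of the Neumann problem -/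

/-- The function `∫_{[s, b)} f dR₂`. -/
def tail (f : ℝ → ℂ) (s : ℝ) : ℂ := ∫ t in Ici s, f t ∂S.dR₂

/-- The function `∫_{[0, x)} ∫_{[s, b)} f dR₂ dR₁(s)`. -/
def green (f : ℝ → ℂ) (x : ℝ) : ℂ := ∫ s in Iio x, S.tail f s ∂S.dR₁

variable {S}

theorem tail_congr {f g : ℝ → ℂ} (h : f =ᵐ[S.dR₂] g) : S.tail f = S.tail g := by
  ext s; exact integral_congr_ae (ae_restrict_of_ae h)

theorem green_congr {f g : ℝ → ℂ} (h : f =ᵐ[S.dR₂] g) : S.green f = S.green g := by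
  ext s; simp only [green, tail_congr h]

theorem tail_eq_sub {f : ℝ → ℂ} (hf : Integrable f S.dR₂) (s : ℝ) :
    S.tail f s = (∫ t, f t ∂S.dR₂) - ∫ t in Iio s, f t ∂S.dR₂ := by
  have := integral_add_compl (measurableSet_Iio (a := s)) hf
  rw [compl_Iio] at this
  rw [tail, ← this]; ring

theorem norm_tail_le {f : ℝ → ℂ} (hf : Integrable f S.dR₂) (s : ℝ) :
    ‖S.tail f s‖ ≤ ∫ t, ‖f t‖ ∂S.dR₂ :=
  (norm_integral_le_integral_norm _).trans
    (setIntegral_le_integral hf.norm (Eventually.of_forall fun _ => norm_nonneg _))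

theorem stronglyMeasurable_tail {f : ℝ → ℂ} (hf : AEStronglyMeasurable f S.dR₂) :
    StronglyMeasurable (S.tail f) := by
  rw [tail_congr hf.ae_eq_mk]
  have h : S.tail (hf.mk f) = fun s => ∫ t,
      {p : ℝ × ℝ | p.1 ≤ p.2}.indicator (fun p => hf.mk f p.2) (s, t) ∂S.dR₂ := by
    ext s
    rw [tail, ← integral_indicator measurableSet_Ici]
    rfl
  rw [h]
  exact ((hf.stronglyMeasurable_mk.comp_measurable measurable_snd).indicator
    (measurableSet_le measurable_fst measurable_snd)).integral_prod_right'

theorem stronglyMeasurable_green {f : ℝ → ℂ} (hf : AEStronglyMeasurable f S.dR₂) :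
    StronglyMeasurable (S.green f) := by
  have h : S.green f = fun x => ∫ s,
      {p : ℝ × ℝ | p.2 < p.1}.indicator (fun p => S.tail f p.2) (x, s) ∂S.dR₁ := by
    ext s
    rw [green, ← integral_indicator measurableSet_Iio]
    rfl
  rw [h]
  exact (((stronglyMeasurable_tail hf).comp_measurable measurable_snd).indicator
    (measurableSet_lt measurable_snd measurable_fst)).integral_prod_right'

theorem integrableOn_const_dR₁ {x : ℝ} (hx : x ∈ S.I) (c : ℂ) :
    IntegrableOn (fun _ => c) (Iio x) S.dR₁ := by
  rw [integrableOn_const_iff]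
  right; rw [dR₁_Iio hx]; exact ENNReal.ofReal_lt_top

theorem integrableOn_tail {f : ℝ → ℂ} (hf : Integrable f S.dR₂) {x : ℝ} (hx : x ∈ S.I) :
    IntegrableOn (S.tail f) (Iio x) S.dR₁ :=
  Integrable.mono' (g := fun _ => ∫ t, ‖f t‖ ∂S.dR₂)
    (by rw [← IntegrableOn, integrableOn_const_iff]
        right; rw [dR₁_Iio hx]; exact ENNReal.ofReal_lt_top)
    (stronglyMeasurable_tail hf.1).aestronglyMeasurable
    (Eventually.of_forall fun s => norm_tail_le hf s)

theorem norm_green_le {f : ℝ → ℂ} (hf : Integrable f S.dR₂) {x : ℝ} (hx : x ∈ S.I) :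
    ‖S.green f x‖ ≤ S.R₁ x * ∫ t, ‖f t‖ ∂S.dR₂ := by
  rw [mul_comm, ← real_dR₁_Iio hx]
  exact norm_setIntegral_le_of_norm_le_const (by rw [dR₁_Iio hx]; exact ENNReal.ofReal_lt_top)
    fun s _ => norm_tail_le hf s

theorem setIntegral_Iio_zero (f : ℝ → ℂ) : ∫ s in Iio 0, f s ∂S.dR₁ = 0 := by
  refine setIntegral_measure_zero _ ?_
  rw [dR₁_Iio S.zero_mem_I, S.zero₁, ENNReal.ofReal_zero]

theorem green_zero (f : ℝ → ℂ) : S.green f 0 = 0 := setIntegral_Iio_zero _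

theorem tail_zero {f : ℝ → ℂ} (hf : Integrable f S.dR₂) : S.tail f 0 = ∫ t, f t ∂S.dR₂ := by
  rw [tail_eq_sub hf, sub_eq_self]
  refine setIntegral_measure_zero _ ?_
  rw [dR₂_Iio S.zero_mem_I, S.zero₂, ENNReal.ofReal_zero]

/-- Integrating the tail from the right end makes `γ` the value of the second component at `b`,
which is what the Neumann condition prescribes. -/
theorem solves_green {f : ℝ → ℂ} (hf : Integrable f S.dR₂) (α γ : ℂ) :
    S.Solves (fun x => α + S.green f x + γ * S.R₁ x) (fun x => γ + S.tail f x) f := by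
  refine solves_iff.mpr fun x hx => ⟨(integrableOn_const_dR₁ hx γ).add (integrableOn_tail hf hx),
    hf.integrableOn, ?_, ?_⟩
  · rw [integral_add (integrableOn_const_dR₁ hx γ) (integrableOn_tail hf hx), green_zero, S.zero₁,
      setIntegral_const, real_dR₁_Iio hx, ← green, Complex.real_smul]
    push_cast; ring
  · rw [tail_zero hf, tail_eq_sub hf]; ring

theorem Solves.eq_green {u₁ u₂ f : ℝ → ℂ} (h : S.Solves u₁ u₂ f) (hf : Integrable f S.dR₂) {x : ℝ}
    (hx : x ∈ S.I) : u₁ x = u₁ 0 + S.green f x + (u₂ 0 - ∫ t, f t ∂S.dR₂) * S.R₁ x ∧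
      u₂ x = (u₂ 0 - ∫ t, f t ∂S.dR₂) + S.tail f x := by
  have e2 : ∀ s ∈ S.I, u₂ s = (u₂ 0 - ∫ t, f t ∂S.dR₂) + S.tail f s := fun s hs => by
    rw [tail_eq_sub hf, (h.iff_Iio hs).2.2.2]; ring
  refine ⟨?_, e2 x hx⟩
  have hae : u₂ =ᵐ[S.dR₁.restrict (Iio x)]
      fun s => (u₂ 0 - ∫ t, f t ∂S.dR₂) + S.tail f s := by
    filter_upwards [ae_restrict_of_ae S.dR₁_ae_mem] with s hs using e2 s hs
  rw [(h.iff_Iio hx).2.2.1, integral_congr_ae hae,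
    integral_add (integrableOn_const_dR₁ hx _) (integrableOn_tail hf hx), setIntegral_const,
    real_dR₁_Iio hx, ← green, Complex.real_smul]
  ring

theorem Solves.tendsto₂ {u₁ u₂ f : ℝ → ℂ} (h : S.Solves u₁ u₂ f) (hf : Integrable f S.dR₂) :
    Tendsto u₂ S.atEnd (𝓝 (u₂ 0 - ∫ t, f t ∂S.dR₂)) := by
  refine ((tendsto_integral_Iio S.dR₂_ae_mem hf).const_sub (u₂ 0)).congr' ?_
  filter_upwards [S.eventually_mem_I] with x hx
  rw [(h.iff_Iio hx).2.2.2]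

theorem memLp_green (hR : MemLp (fun x => (S.R₁ x : ℂ)) 2 S.dR₂) {f : ℝ → ℂ}
    (hf : Integrable f S.dR₂) : MemLp (S.green f) 2 S.dR₂ := by
  refine hR.of_le_mul (c := ∫ t, ‖f t‖ ∂S.dR₂) (stronglyMeasurable_green hf.1).aestronglyMeasurable
    ?_
  filter_upwards [S.dR₂_ae_mem] with x hx
  rw [Complex.norm_real, Real.norm_of_nonneg (R₁_nonneg hx), mul_comm]
  exact norm_green_le hf hx

theorem tail_add {f g : ℝ → ℂ} (hf : Integrable f S.dR₂) (hg : Integrable g S.dR₂) (s : ℝ) :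
    S.tail (f + g) s = S.tail f s + S.tail g s :=
  integral_add hf.integrableOn hg.integrableOn

theorem green_add {f g : ℝ → ℂ} (hf : Integrable f S.dR₂) (hg : Integrable g S.dR₂) {x : ℝ}
    (hx : x ∈ S.I) : S.green (f + g) x = S.green f x + S.green g x := by
  simp only [green, tail_add hf hg]
  exact integral_add (integrableOn_tail hf hx) (integrableOn_tail hg hx)

theorem green_smul (a : ℂ) (f : ℝ → ℂ) (x : ℝ) : S.green (a • f) x = a * S.green f x := by
  simp only [green, tail, Pi.smul_apply, smul_eq_mul, integral_const_mul]

theorem tail_conj (f : ℝ → ℂ) (s : ℝ) :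
    S.tail (fun t => (starRingEnd ℂ) (f t)) s = (starRingEnd ℂ) (S.tail f s) := integral_conj

variable [IsFiniteMeasure S.dR₂]

theorem _root_.MeasureTheory.MemLp.integrable_two {α : Type*} [MeasurableSpace α] {μ : Measure α}
    [IsFiniteMeasure μ] {f : α → ℂ} (hf : MemLp f 2 μ) : Integrable f μ :=
  hf.integrable (by norm_num)

theorem integrable_coeFn (f : S.L2) : Integrable f S.dR₂ := (Lp.memLp f).integrable_two

variable (S) in
theorem integral_norm_le_mul_norm : ∃ C : ℝ, 0 ≤ C ∧ ∀ f : S.L2,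
    ∫ t, ‖f t‖ ∂S.dR₂ ≤ C * ‖f‖ := by
  refine ⟨((S.dR₂ univ) ^ (1 / (1 : ENNReal).toReal - 1 / (2 : ENNReal).toReal)).toReal,
    ENNReal.toReal_nonneg, fun f => ?_⟩
  have h := eLpNorm_le_eLpNorm_mul_rpow_measure_univ (p := 1) (q := 2) (by norm_num)
    (Lp.aestronglyMeasurable f)
  rw [integral_norm_eq_lintegral_enorm (Lp.aestronglyMeasurable f), Lp.norm_def, mul_comm,
    ← ENNReal.toReal_mul, ← eLpNorm_one_eq_lintegral_enorm]
  refine ENNReal.toReal_mono (ENNReal.mul_ne_top (Lp.eLpNorm_ne_top f) ?_) h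
  exact ENNReal.rpow_ne_top_of_nonneg (by norm_num) (measure_ne_top _ _)

/-- The operator `f ↦ ∫_{[0, x)} ∫_{[s, b)} f dR₂ dR₁(s)` in `L²(R₂)`. -/
def greenOp (hR : MemLp (fun x => (S.R₁ x : ℂ)) 2 S.dR₂) : S.L2 →L[ℂ] S.L2 :=
  LinearMap.mkContinuousOfExistsBound
    { toFun := fun f => (memLp_green hR (integrable_coeFn f)).toLp
      map_add' := fun f g => by
        rw [← MemLp.toLp_add]
        refine (MemLp.toLp_eq_toLp_iff _ _).mpr ?_
        filter_upwards [S.dR₂_ae_mem] with x hx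
        rw [green_congr (Lp.coeFn_add f g), green_add (integrable_coeFn f) (integrable_coeFn g) hx]
        rfl
      map_smul' := fun a f => by
        rw [RingHom.id_apply, ← MemLp.toLp_const_smul]
        refine (MemLp.toLp_eq_toLp_iff _ _).mpr (Eventually.of_forall fun x => ?_)
        rw [green_congr (Lp.coeFn_smul a f), green_smul]
        rfl }
    (by
      obtain ⟨C, hC0, hC⟩ := S.integral_norm_le_mul_norm
      refine ⟨C * ‖hR.toLp‖, fun f => ?_⟩
      have := Lp.norm_le_mul_norm_of_ae_le_mul (c := ∫ t, ‖f t‖ ∂S.dR₂) (g := hR.toLp)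
        (f := (memLp_green hR (integrable_coeFn f)).toLp) (by
          filter_upwards [MemLp.coeFn_toLp hR, MemLp.coeFn_toLp (memLp_green hR
            (integrable_coeFn f)), S.dR₂_ae_mem] with x h1 h2 hx
          rw [h1, h2, Complex.norm_real, Real.norm_of_nonneg (R₁_nonneg hx), mul_comm]
          exact norm_green_le (integrable_coeFn f) hx)
      refine this.trans ?_
      calc _ ≤ C * ‖f‖ * ‖hR.toLp‖ := by gcongr; exact hC f
        _ = _ := by ring)

theorem coeFn_greenOp (hR : MemLp (fun x => (S.R₁ x : ℂ)) 2 S.dR₂) (f : S.L2) :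
    greenOp hR f =ᵐ[S.dR₂] S.green f :=
  MemLp.coeFn_toLp (memLp_green hR (integrable_coeFn f))

variable (S) in
/-- The constant function `1` as an element of `L²(R₂)`. -/
def one : S.L2 := (memLp_const (1 : ℂ)).toLp

theorem coeFn_one : S.one =ᵐ[S.dR₂] fun _ => 1 := MemLp.coeFn_toLp _

theorem inner_one (f : S.L2) : inner ℂ S.one f = ∫ t, f t ∂S.dR₂ := by
  rw [L2.inner_def]
  refine integral_congr_ae ?_
  filter_upwards [S.coeFn_one] with t ht
  rw [ht]; simp

/-- The quadratic form of `greenOp`. -/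
theorem inner_greenOp (hj : S.NoCommonJumps) (hR : MemLp (fun x => (S.R₁ x : ℂ)) 2 S.dR₂)
    (f g : S.L2) : Integrable (fun s => S.tail g s * (starRingEnd ℂ) (S.tail f s)) S.dR₁ ∧
      inner ℂ f (greenOp hR g) = ∫ s, S.tail g s * (starRingEnd ℂ) (S.tail f s) ∂S.dR₁ := by
  have hf := integrable_coeFn f
  have hg := integrable_coeFn g
  set F : ℝ × ℝ → ℂ := {p : ℝ × ℝ | p.2 < p.1}.indicator
    fun p => (starRingEnd ℂ) (f p.1) * S.tail g p.2 with hF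
  have hFx : ∀ x s, F (x, s) =
      (Iio x).indicator (fun s => (starRingEnd ℂ) (f x) * S.tail g s) s := fun x s => by
    by_cases h : s < x <;> simp [hF, h]
  have hFs : ∀ s x, F (x, s) =
      (Ioi s).indicator (fun x => S.tail g s * (starRingEnd ℂ) (f x)) x := fun s x => by
    by_cases h : s < x <;> simp [hF, h, mul_comm]
  have hFm : AEStronglyMeasurable F (S.dR₂.prod S.dR₁) := by
    refine AEStronglyMeasurable.indicator ?_ (measurableSet_lt measurable_snd measurable_fst)
    exact (Complex.continuous_conj.comp_aestronglyMeasurable hf.1).comp_fst.mul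
      ((stronglyMeasurable_tail hg.1).comp_measurable measurable_snd).aestronglyMeasurable
  have hFi : Integrable F (S.dR₂.prod S.dR₁) := by
    rw [integrable_prod_iff hFm]
    constructor
    · filter_upwards [S.dR₂_ae_mem] with x hx
      simp_rw [hFx]
      exact (integrable_indicator_iff measurableSet_Iio).mpr
        ((integrableOn_tail hg hx).const_mul _)
    -- The inner integral of `|tail g|` over `[0, x)` is at most `R₁(x) ‖g‖₁`, and `f R₁` is
    -- integrable as a product of two `L²` functions.
    · have hb : Integrable (fun x => ‖f x‖ * (‖(S.R₁ x : ℂ)‖ * ∫ t, ‖g t‖ ∂S.dR₂)) S.dR₂ := by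
        have := ((Lp.memLp f).norm.integrable_mul hR.norm).mul_const (∫ t, ‖g t‖ ∂S.dR₂)
        refine this.congr (Eventually.of_forall fun x => ?_)
        simp [mul_assoc]
      refine hb.mono' hFm.norm.integral_prod_right' ?_
      filter_upwards [S.dR₂_ae_mem] with x hx
      rw [Real.norm_of_nonneg (integral_nonneg fun _ => norm_nonneg _)]
      simp_rw [hFx, norm_indicator_eq_indicator_norm]
      rw [integral_indicator measurableSet_Iio]
      simp_rw [norm_mul, RCLike.norm_conj]
      rw [integral_const_mul]
      gcongr
      calc ∫ s in Iio x, ‖S.tail g s‖ ∂S.dR₁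
          ≤ ‖∫ s in Iio x, ‖S.tail g s‖ ∂S.dR₁‖ := le_abs_self _
        _ ≤ (∫ t, ‖g t‖ ∂S.dR₂) * S.dR₁.real (Iio x) :=
          norm_setIntegral_le_of_norm_le_const (by rw [dR₁_Iio hx]; exact ENNReal.ofReal_lt_top)
            fun s _ => by rw [norm_norm]; exact norm_tail_le hg s
        _ = _ := by
          rw [real_dR₁_Iio hx, Complex.norm_real, Real.norm_of_nonneg (R₁_nonneg hx), mul_comm]
  -- Exchanging the integrals produces `∫_{(s,b)}` where the tail has `∫_{[s,b)}`. They differ by an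
  -- atom of `dR₂` at `s`, absent for `dR₁`-almost every `s`.
  have hin : (fun s => ∫ x, F (x, s) ∂S.dR₂) =ᵐ[S.dR₁]
      fun s => S.tail g s * (starRingEnd ℂ) (S.tail f s) := by
    filter_upwards [ae_measure_singleton_eq_zero hj.singleton] with s hs
    simp_rw [hFs]
    rw [integral_indicator measurableSet_Ioi, integral_const_mul, ← tail_conj, tail]
    congr 2
    refine Measure.restrict_congr_set ?_
    exact Ioi_ae_eq_Ici' hs
  refine ⟨hFi.integral_prod_right.congr hin, ?_⟩
  rw [← integral_congr_ae hin, ← integral_prod_symm _ hFi, integral_prod _ hFi, L2.inner_def]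
  refine integral_congr_ae ?_
  filter_upwards [coeFn_greenOp hR g] with x hx
  simp_rw [hFx]
  rw [hx, integral_indicator measurableSet_Iio, integral_const_mul, RCLike.inner_apply', green]

end IntegralSystem

end

noncomputable section

/-- `1 - a` is invertible as soon as some power of `a` has norm less than one. -/
theorem isUnit_one_sub_of_norm_pow_lt_one {A : Type*} [NormedRing A] [CompleteSpace A] {a : A}
    {n : ℕ} (h : ‖a ^ n‖ < 1) : IsUnit (1 - a) := by
  have h1 := isUnit_one_sub_of_norm_lt_one h
  -- `1 - aⁿ` is the product of `1 - a` and a geometric sum; the factors commute, so each is a unit.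
  rw [← mul_neg_geom_sum a n] at h1
  have hc : Commute (1 - a) (∑ i ∈ Finset.range n, a ^ i) :=
    (mul_neg_geom_sum a n).trans (geom_sum_mul_neg a n).symm
  exact (hc.isUnit_mul_iff.mp h1).1

namespace IntegralSystem

variable {S : IntegralSystem} [IsFiniteMeasure S.dR₂]

/-! ### Solutions of the homogeneous system -/

/-- The Volterra operator `f ↦ ∫_{[0, x)} ∫_{[0, s)} f dR₂ dR₁(s)` in `L²(R₂)`. -/
def volterra (hR : MemLp (fun x => (S.R₁ x : ℂ)) 2 S.dR₂) : S.L2 →L[ℂ] S.L2 :=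
  (innerSL ℂ S.one).smulRight hR.toLp - greenOp hR

theorem volterra_apply (hR : MemLp (fun x => (S.R₁ x : ℂ)) 2 S.dR₂) (f : S.L2) :
    volterra hR f = (∫ t, f t ∂S.dR₂) • hR.toLp - greenOp hR f := by
  simp [volterra, inner_one]

theorem coeFn_volterra (hR : MemLp (fun x => (S.R₁ x : ℂ)) 2 S.dR₂) (f : S.L2) :
    ∀ᵐ x ∂S.dR₂, volterra hR f x = (∫ t, f t ∂S.dR₂) * S.R₁ x - S.green f x := by
  rw [volterra_apply]
  filter_upwards [Lp.coeFn_sub ((∫ t, f t ∂S.dR₂) • hR.toLp) (greenOp hR f),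
    Lp.coeFn_smul (∫ t, f t ∂S.dR₂) hR.toLp, coeFn_greenOp hR f, hR.coeFn_toLp] with x a1 a2 a3 a4
  rw [a1, Pi.sub_apply, a2, Pi.smul_apply, a3, a4, smul_eq_mul]

/-- Subtracting the tail from the full integral leaves `∫_{[0,s)} f dR₂`, so only values of `f` to
the left of `x` enter. -/
theorem enorm_volterra_le (hR : MemLp (fun x => (S.R₁ x : ℂ)) 2 S.dR₂) (f : S.L2) :
    ∀ᵐ x ∂S.dR₂, ‖volterra hR f x‖ₑ ≤ ENNReal.ofReal (S.R₁ x) * ∫⁻ t in Iio x, ‖f t‖ₑ ∂S.dR₂ := by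
  filter_upwards [coeFn_volterra hR f, S.dR₂_ae_mem] with x hx hxI
  have hf := integrable_coeFn f
  have e : volterra hR f x = ∫ s in Iio x, ((∫ t, f t ∂S.dR₂) - S.tail f s) ∂S.dR₁ := by
    rw [hx, integral_sub (integrableOn_const_dR₁ hxI _) (integrableOn_tail hf hxI),
      setIntegral_const, real_dR₁_Iio hxI, green, Complex.real_smul, mul_comm]
  rw [e]
  calc _ ≤ ∫⁻ s in Iio x, ‖(∫ t, f t ∂S.dR₂) - S.tail f s‖ₑ ∂S.dR₁ :=
        enorm_integral_le_lintegral_enorm _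
    _ ≤ ∫⁻ s in Iio x, (∫⁻ t in Iio x, ‖f t‖ₑ ∂S.dR₂) ∂S.dR₁ := by
        refine setLIntegral_mono' measurableSet_Iio fun s hs => ?_
        rw [tail_eq_sub hf, sub_sub_cancel]
        exact (enorm_integral_le_lintegral_enorm _).trans
          (lintegral_mono_set (Iio_subset_Iio (le_of_lt hs)))
    _ = _ := by rw [setLIntegral_const, dR₁_Iio hxI, mul_comm]

/-- Each application integrates over an initial interval and multiplies by `R₁`, so the powers are
governed by the iterated integrals of `R₁ dR₂`. This measure is finite because `R₁ ∈ L²` and `dR₂`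
is finite, whence the factorial decay of the norms below. -/
theorem enorm_volterra_pow_le (hR : MemLp (fun x => (S.R₁ x : ℂ)) 2 S.dR₂) (f : S.L2) (n : ℕ) :
    ∀ᵐ x ∂S.dR₂, ‖(volterra hR ^ (n + 1)) f x‖ₑ ≤ ENNReal.ofReal (S.R₁ x) *
      ((∫⁻ t, ‖f t‖ₑ ∂S.dR₂) *
        iterInt (S.dR₂.withDensity fun x => ENNReal.ofReal (S.R₁ x)) n x) := by
  have hB : (∫⁻ t, ‖f t‖ₑ ∂S.dR₂) ≠ ⊤ := (integrable_coeFn f).2.ne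
  induction n with
  | zero =>
    filter_upwards [enorm_volterra_le hR f] with x hx
    rw [zero_add, pow_one, iterInt, mul_one]
    exact hx.trans (mul_le_mul' le_rfl (setLIntegral_le_lintegral _ _))
  | succ n ih =>
    filter_upwards [enorm_volterra_le hR ((volterra hR ^ (n + 1)) f)] with x hx
    rw [pow_succ', mul_apply_eq_comp]
    refine hx.trans (mul_le_mul' le_rfl ?_)
    rw [iterInt_succ, setLIntegral_withDensity_eq_lintegral_mul₀ aemeasurable_ofReal_R₁
      (iterInt_measurable _ _).aemeasurable measurableSet_Iio, ← lintegral_const_mul' _ _ hB]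
    refine lintegral_mono_ae (ae_restrict_of_ae ?_)
    filter_upwards [ih] with t ht
    refine ht.trans (le_of_eq ?_)
    rw [Pi.mul_apply]; ring

theorem exists_norm_volterra_pow_le (hR : MemLp (fun x => (S.R₁ x : ℂ)) 2 S.dR₂) :
    ∃ C Ω : ℝ, ∀ n : ℕ, ‖volterra hR ^ (n + 1)‖ ≤ C * (Ω ^ n / n.factorial) := by
  obtain ⟨C, hC0, hC⟩ := S.integral_norm_le_mul_norm
  set ω := S.dR₂.withDensity fun x => ENNReal.ofReal (S.R₁ x)
  have hω : ω univ ≠ ⊤ := by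
    rw [withDensity_apply _ MeasurableSet.univ, setLIntegral_univ]
    refine ne_top_of_le_ne_top hR.integrable_two.2.ne (lintegral_mono_ae ?_)
    filter_upwards [S.dR₂_ae_mem] with x hx
    rw [← ofReal_norm, Complex.norm_real]
    exact ENNReal.ofReal_le_ofReal (le_abs_self _)
  refine ⟨C * ‖hR.toLp‖, (ω univ).toReal, fun n => ?_⟩
  have hq : 0 ≤ (ω univ).toReal ^ n / n.factorial := by positivity
  refine ContinuousLinearMap.opNorm_le_bound _ (by positivity) fun f => ?_
  have := Lp.norm_le_mul_norm_of_ae_le_mul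
    (c := (∫ t, ‖f t‖ ∂S.dR₂) * ((ω univ).toReal ^ n / n.factorial)) (g := hR.toLp)
    (f := (volterra hR ^ (n + 1)) f) (by
      filter_upwards [enorm_volterra_pow_le hR f n, hR.coeFn_toLp, S.dR₂_ae_mem] with x h1 h2 hx
      have hωx : ω (Iio x) ≠ ⊤ := ne_top_of_le_ne_top hω (measure_mono (subset_univ _))
      have h3 : iterInt ω n x ≤ ENNReal.ofReal ((ω univ).toReal ^ n / n.factorial) := by
        refine (iterInt_le_ofReal ω n x hωx).trans (ENNReal.ofReal_le_ofReal ?_)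
        have := ENNReal.toReal_mono hω (measure_mono (subset_univ (Iio x)))
        gcongr
      have h4 := h1.trans (mul_le_mul' le_rfl (mul_le_mul' le_rfl h3))
      have h5 : (∫⁻ t, ‖f t‖ₑ ∂S.dR₂) = ENNReal.ofReal (∫ t, ‖f t‖ ∂S.dR₂) :=
        (ofReal_integral_norm_eq_lintegral_enorm (integrable_coeFn f)).symm
      rw [h5, ← ENNReal.ofReal_mul (integral_nonneg fun _ => norm_nonneg _),
        ← ENNReal.ofReal_mul (R₁_nonneg hx), ← ofReal_norm] at h4
      rw [h2, Complex.norm_real, Real.norm_of_nonneg (R₁_nonneg hx), mul_comm]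
      refine (ENNReal.ofReal_le_ofReal_iff (mul_nonneg (R₁_nonneg hx) ?_)).mp h4
      exact mul_nonneg (integral_nonneg fun _ => norm_nonneg _) hq)
  refine this.trans ?_
  calc _ ≤ C * ‖f‖ * ((ω univ).toReal ^ n / n.factorial) * ‖hR.toLp‖ := by gcongr; exact hC f
    _ = _ := by ring

theorem isUnit_one_sub_smul_volterra (hR : MemLp (fun x => (S.R₁ x : ℂ)) 2 S.dR₂) (z : ℂ) :
    IsUnit (1 - z • volterra hR) := by
  obtain ⟨C, Ω, h⟩ := exists_norm_volterra_pow_le hR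
  have hlim : Tendsto (fun n : ℕ => ‖z‖ * C * ((‖z‖ * Ω) ^ n / n.factorial)) atTop (𝓝 0) := by
    simpa using (FloorSemiring.tendsto_pow_div_factorial_atTop (‖z‖ * Ω)).const_mul (‖z‖ * C)
  obtain ⟨n, hn⟩ := (hlim.eventually (gt_mem_nhds one_pos)).exists
  refine isUnit_one_sub_of_norm_pow_lt_one (n := n + 1) (lt_of_le_of_lt ?_ hn)
  rw [smul_pow, norm_smul, norm_pow]
  calc _ ≤ ‖z‖ ^ (n + 1) * (C * (Ω ^ n / n.factorial)) := by gcongr; exact h n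
    _ = _ := by rw [mul_pow]; ring

/-- The initial value problem is the integral equation `u = α + β R₁ - z V u`, with `V` the Volterra
operator, solvable since `1 + z V` is invertible for every `z`. -/
theorem exists_isSol (hR : MemLp (fun x => (S.R₁ x : ℂ)) 2 S.dR₂) (z α β : ℂ) :
    ∃ u, S.IsSol z α β u ∧ MemLp u.1 2 S.dR₂ := by
  obtain ⟨A, hA⟩ := isUnit_one_sub_smul_volterra hR (-z)
  set u : S.L2 := (↑A⁻¹ : S.L2 →L[ℂ] S.L2) (α • S.one + β • hR.toLp)
  have hu : (1 - (-z) • volterra hR) u = α • S.one + β • hR.toLp := by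
    rw [← hA, ← mul_apply_eq_comp, A.mul_inv, one_apply_eq_self]
  set f : S.L2 := z • u
  have hf := integrable_coeFn f
  set γ := β - ∫ t, f t ∂S.dR₂
  have hae : ∀ᵐ x ∂S.dR₂, u x = α + S.green f x + γ * S.R₁ x := by
    have hu' : u = α • S.one + (β • hR.toLp + (-1 : ℂ) • volterra hR f) := by
      rw [← add_assoc, ← hu]
      simp [f]
    have hsum := Lp.coeFn_add (α • S.one) (β • hR.toLp + (-1 : ℂ) • volterra hR f)
    rw [← hu'] at hsum
    filter_upwards [hsum, Lp.coeFn_add (β • hR.toLp) ((-1 : ℂ) • volterra hR f),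
      Lp.coeFn_smul α S.one, Lp.coeFn_smul β hR.toLp, Lp.coeFn_smul (-1 : ℂ) (volterra hR f),
      coeFn_volterra hR f, S.coeFn_one, hR.coeFn_toLp] with x a1 a2 a3 a4 a5 a6 a7 a8
    rw [a1, Pi.add_apply, a2, Pi.add_apply, a3, a4, a5, Pi.smul_apply, Pi.smul_apply,
      Pi.smul_apply, a6, a7, a8]
    simp only [smul_eq_mul, γ]
    ring
  -- The `L²` class is replaced by this explicit function, defined at every point, so that the
  -- system holds pointwise and not only almost everywhere.
  have hsol := solves_green hf α γ
  refine ⟨(fun x => α + S.green f x + γ * S.R₁ x, fun x => γ + S.tail f x),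
    ⟨hsol.congr_rhs ?_, ?_, ?_⟩, (Lp.memLp u).ae_eq hae⟩
  · filter_upwards [hae, Lp.coeFn_smul z u] with x h1 h2
    rw [h2, Pi.smul_apply, h1, smul_eq_mul]
  · simp [green_zero, S.zero₁]
  · simp [tail_zero hf, γ]

theorem wellPosed (hR : MemLp (fun x => (S.R₁ x : ℂ)) 2 S.dR₂) : S.WellPosed := by
  intro z α β
  obtain ⟨u, hu, -⟩ := exists_isSol hR z α β
  have h : S.IsSol z α β (S.sol z α β) := Classical.epsilon_spec ⟨u, hu⟩
  exact ⟨h, fun v hv => hv.1.eqOn h.1 (hv.2.1.trans h.2.1.symm) (hv.2.2.trans h.2.2.symm)⟩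

theorem memLp_sol (hR : MemLp (fun x => (S.R₁ x : ℂ)) 2 S.dR₂) (z α β : ℂ) :
    MemLp (S.sol z α β).1 2 S.dR₂ := by
  obtain ⟨u, hu, hu2⟩ := exists_isSol hR z α β
  refine hu2.ae_eq ?_
  filter_upwards [S.dR₂_ae_mem] with x hx using ((wellPosed hR z α β).2 u hu).1 hx

theorem tendsto_sol₂ (hR : MemLp (fun x => (S.R₁ x : ℂ)) 2 S.dR₂) (z α β : ℂ) :
    Tendsto (S.sol z α β).2 S.atEnd (𝓝 (limUnder S.atEnd (S.sol z α β).2)) :=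
  tendsto_nhds_limUnder ⟨_, (wellPosed hR z α β).1.1.tendsto₂
    ((memLp_sol hR z α β).integrable_two.const_mul z)⟩

end IntegralSystem

end

noncomputable section

/-! ### A rank one restriction of a nonnegative operator -/

namespace LinRel

variable {H : Type*} [NormedAddCommGroup H] [InnerProductSpace ℂ H]

/-- The restriction `{(K f, f) : ⟨f, e⟩ = 0}` of the inverse of `K`. -/
def invRestrict (K : H →L[ℂ] H) (e : H) : Submodule ℂ (H × H) where
  carrier := {p | p.1 = K p.2 ∧ inner ℂ e p.2 = 0}
  add_mem' := by
    rintro p q ⟨h1, h2⟩ ⟨k1, k2⟩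
    exact ⟨by simp [h1, k1], by simp [h2, k2]⟩
  zero_mem' := by simp
  smul_mem' := by
    rintro a p ⟨h1, h2⟩
    exact ⟨by simp [h1], by simp [h2]⟩

variable {K : H →L[ℂ] H} {e : H}

/-- By symmetry of `K`, membership says that `w = p.1 - K p.2` is orthogonal to everything
orthogonal to `e`, so `w` is a multiple of `e`. In the proof `f` is the component of `w` orthogonal
to `e`; testing against `(K f, f)` gives `f = 0`. -/
theorem mem_adjoint_invRestrict (hK : K.IsSymmetric) (he : e ≠ 0) {p : H × H} :
    p ∈ (invRestrict K e).adjoint ↔ ∃ α : ℂ, p.1 = α • e + K p.2 := by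
  rw [Submodule.mem_adjoint_iff]
  have hee : inner ℂ e e ≠ 0 := inner_self_ne_zero.mpr he
  constructor
  · intro h
    set w := p.1 - K p.2 with hw
    set α := inner ℂ e w / inner ℂ e e with hα
    set f := w - α • e with hf
    have hef : inner ℂ e f = 0 := by
      rw [hf, inner_sub_right, inner_smul_right, hα, div_mul_cancel₀ _ hee, sub_self]
    have h1 := h (K f) f ⟨rfl, hef⟩
    have hfw : inner ℂ f w = 0 := by
      rw [hw, inner_sub_right, ← h1]
      congr 1
      exact (hK f p.2).symm
    have hff : inner ℂ f f = 0 := by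
      have : inner ℂ f e = 0 := by rw [← inner_conj_symm, hef, map_zero]
      conv_lhs => rw [hf]
      rw [← hf, inner_sub_right, hfw, inner_smul_right, this, mul_zero, sub_zero]
    refine ⟨α, ?_⟩
    have h2 : f = 0 := inner_self_eq_zero.mp hff
    rw [hf, sub_eq_zero] at h2
    rw [← h2, hw, sub_add_cancel]
  · rintro ⟨α, h⟩ a b ⟨h1, h2⟩
    simp only at h1 h2
    have : inner ℂ b e = 0 := by rw [← inner_conj_symm, h2, map_zero]
    rw [h, inner_add_right, inner_smul_right, this, mul_zero, zero_add, h1, sub_eq_zero]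
    exact (hK b p.2).symm

theorem isSymm_invRestrict (hK : K.IsSymmetric) (he : e ≠ 0) : IsSymm (invRestrict K e) :=
  fun p hp => (mem_adjoint_invRestrict hK he).mpr ⟨0, by rw [zero_smul, zero_add, hp.1]⟩

theorem inner_apply_eq (hK : K.IsPositive) (u : H) :
    inner ℂ u (K u) = ((inner ℂ u (K u)).re : ℂ) ∧ 0 ≤ (inner ℂ u (K u)).re := by
  have h := hK.inner_nonneg_right u
  exact ⟨Complex.eq_re_of_ofReal_le (r := 0) (by simpa using h), (Complex.le_def.mp h).1⟩

theorem inner_apply_eq' (hK : K.IsPositive) (u : H) :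
    inner ℂ (K u) u = ((inner ℂ u (K u)).re : ℂ) := by
  rw [← (inner_apply_eq hK u).1]; exact hK.isSymmetric u u

theorem isNonneg_invRestrict (hK : K.IsPositive) : IsNonneg (invRestrict K e) := by
  rintro p ⟨h1, -⟩
  rw [h1, inner_apply_eq' hK]
  exact ⟨Complex.ofReal_im _, (inner_apply_eq hK p.2).2⟩

/-- The boundary map `(α e + K f, f) ↦ ⟨f, e⟩`. -/
def bdry₀ (K : H →L[ℂ] H) (e : H) : (invRestrict K e).adjoint →ₗ[ℂ] ℂ :=
  (innerₛₗ ℂ e ∘ₗ LinearMap.snd ℂ H H) ∘ₗ (invRestrict K e).adjoint.subtype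

/-- The boundary map `(α e + K f, f) ↦ -α`. -/
def bdry₁ (K : H →L[ℂ] H) (e : H) : (invRestrict K e).adjoint →ₗ[ℂ] ℂ :=
  (-(inner ℂ e e)⁻¹) • ((innerₛₗ ℂ e ∘ₗ (LinearMap.fst ℂ H H - K.toLinearMap ∘ₗ
    LinearMap.snd ℂ H H)) ∘ₗ (invRestrict K e).adjoint.subtype)

theorem bdry₀_apply (p : (invRestrict K e).adjoint) :
    bdry₀ K e p = inner ℂ e (p : H × H).2 := rfl

theorem bdry₁_apply (he : e ≠ 0) (p : (invRestrict K e).adjoint) {α : ℂ}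
    (h : (p : H × H).1 = α • e + K (p : H × H).2) : bdry₁ K e p = -α := by
  have hee : inner ℂ e e ≠ 0 := inner_self_ne_zero.mpr he
  have : bdry₁ K e p = -(inner ℂ e e)⁻¹ * inner ℂ e ((p : H × H).1 - K (p : H × H).2) := rfl
  rw [this, h, add_sub_cancel_right, inner_smul_right]
  field_simp

theorem isBoundaryTriple_invRestrict (hK : K.IsSymmetric) (he : e ≠ 0) :
    IsBoundaryTriple (invRestrict K e) (bdry₀ K e) (bdry₁ K e) := by
  have hee : inner ℂ e e ≠ 0 := inner_self_ne_zero.mpr he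
  constructor
  · intro p q
    obtain ⟨α, hα⟩ := (mem_adjoint_invRestrict hK he).mp p.2
    obtain ⟨β, hβ⟩ := (mem_adjoint_invRestrict hK he).mp q.2
    rw [bdry₁_apply he p hα, bdry₁_apply he q hβ, bdry₀_apply, bdry₀_apply, hα, hβ,
      inner_add_left, inner_add_right, inner_smul_left, inner_smul_right, inner_conj_symm, map_neg]
    have := hK (q : H × H).2 (p : H × H).2
    simp only [ContinuousLinearMap.coe_coe] at this
    rw [this]
    ring
  · rintro ⟨a, c⟩
    set f := (a / inner ℂ e e) • e
    have hp : ((-c) • e + K f, f) ∈ (invRestrict K e).adjoint :=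
      (mem_adjoint_invRestrict hK he).mpr ⟨-c, rfl⟩
    refine ⟨⟨_, hp⟩, Prod.ext ?_ ?_⟩
    · change bdry₀ K e ⟨_, hp⟩ = a
      rw [bdry₀_apply]
      simp only [f, inner_smul_right]
      field_simp
    · change bdry₁ K e ⟨_, hp⟩ = c
      rw [bdry₁_apply he ⟨_, hp⟩ (α := -c) rfl, neg_neg]

theorem mem_kerExt (hK : K.IsSymmetric) (he : e ≠ 0) {p : H × H} :
    p ∈ kerExt (invRestrict K e) (bdry₀ K e) ↔
      inner ℂ e p.2 = 0 ∧ ∃ α : ℂ, p.1 = α • e + K p.2 := by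
  rw [kerExt, Submodule.mem_map]
  constructor
  · rintro ⟨q, hq, rfl⟩
    exact ⟨hq, (mem_adjoint_invRestrict hK he).mp q.2⟩
  · rintro ⟨h1, h2⟩
    exact ⟨⟨p, (mem_adjoint_invRestrict hK he).mpr h2⟩, h1, rfl⟩

/-- The vector `(1 - z K)⁻¹ e`. -/
def resVec (K : H →L[ℂ] H) (e : H) (z : ℂ) : H := Ring.inverse (1 - z • K) e

theorem inverse_apply_sub {z : ℂ} (h : IsUnit (1 - z • K)) (v : H) :
    Ring.inverse (1 - z • K) v - z • K (Ring.inverse (1 - z • K) v) = v := by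
  have := congrArg (fun A : H →L[ℂ] H => A v) (Ring.mul_inverse_cancel _ h)
  simpa using this

theorem eq_inverse_apply {z : ℂ} (h : IsUnit (1 - z • K)) {u v : H} (huv : u - z • K u = v) :
    u = Ring.inverse (1 - z • K) v := by
  have := congrArg (fun A : H →L[ℂ] H => A u) (Ring.inverse_mul_cancel _ h)
  rw [← huv]
  simpa using this.symm

theorem resVec_sub {z : ℂ} (h : IsUnit (1 - z • K)) : resVec K e z - z • K (resVec K e z) = e :=
  inverse_apply_sub h e

/-! ### The resolvent vector and its form off the half-line `[0, ∞)`. -/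

variable [CompleteSpace H]

open scoped ComplexOrder in
theorem isUnit_one_sub_smul (hK : K.IsPositive) {z : ℂ} (hz : z ∈ cutPlane) :
    IsUnit (1 - z • K) := by
  have hz0 : z ≠ 0 := by rintro rfl; exact hz ⟨rfl, le_rfl⟩
  have hK0 : 0 ≤ K := (ContinuousLinearMap.nonneg_iff_isPositive K).mpr hK
  -- The spectrum of a positive operator lies in `[0, ∞)`, and `1 - z K = z (z⁻¹ - K)`.
  have hns : z⁻¹ ∉ spectrum ℂ K := by
    intro h
    have h1 := spectrum_nonneg_of_nonneg hK0 h
    have h2 : 0 ≤ z := by simpa using inv_nonneg.mpr h1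
    exact hz ⟨(Complex.le_def.mp h2).2.symm, (Complex.le_def.mp h2).1⟩
  rw [spectrum.notMem_iff] at hns
  have : 1 - z • K = z • (algebraMap ℂ (H →L[ℂ] H) z⁻¹ - K) := by
    rw [smul_sub, Algebra.algebraMap_eq_smul_one, smul_smul, mul_inv_cancel₀ hz0, one_smul]
  rw [this]
  exact hns.smul (Units.mk0 z hz0)

/-- `⟨(1 - z K)⁻¹ e, e⟩`. -/
def resForm (K : H →L[ℂ] H) (e : H) (z : ℂ) : ℂ := inner ℂ e (resVec K e z)

theorem resForm_eq (hK : K.IsPositive) {z : ℂ} (hz : z ∈ cutPlane) :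
    resForm K e z = (‖resVec K e z‖ ^ 2 : ℝ) -
      (starRingEnd ℂ) z * ((inner ℂ (resVec K e z) (K (resVec K e z))).re : ℂ) := by
  have h := resVec_sub (e := e) (isUnit_one_sub_smul hK hz)
  rw [resForm]
  set u := resVec K e z
  rw [← h, inner_sub_left, inner_smul_left, inner_apply_eq' hK, inner_self_eq_norm_sq_to_K]
  simp

/-- With `u = (1 - z K)⁻¹ e` and `k = ⟨K u, u⟩ ≥ 0`, the form has real part `‖u‖² - k Re z` and
imaginary part `k Im z`. Off `[0, ∞)` both vanish only if `u = 0`, and then `e = 0`. -/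
theorem resForm_ne_zero (hK : K.IsPositive) (he : e ≠ 0) {z : ℂ} (hz : z ∈ cutPlane) :
    resForm K e z ≠ 0 := by
  intro h0
  have h := resVec_sub (e := e) (isUnit_one_sub_smul hK hz)
  rw [resForm_eq hK hz] at h0
  set u := resVec K e z
  obtain ⟨hk, hk0⟩ := inner_apply_eq hK u
  set k := (inner ℂ u (K u)).re
  have hre := congrArg Complex.re h0
  have him := congrArg Complex.im h0
  simp only [Complex.sub_re, Complex.sub_im, Complex.mul_re, Complex.mul_im, Complex.conj_re,
    Complex.conj_im, Complex.ofReal_re, Complex.ofReal_im, Complex.zero_re, Complex.zero_im,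
    mul_zero, sub_zero, zero_sub, zero_add, neg_mul, neg_neg] at hre him
  have hu : ‖u‖ ^ 2 = 0 := by
    by_cases hzi : z.im = 0
    · have hzr : z.re < 0 := by
        by_contra hneg
        exact hz ⟨hzi, not_lt.mp hneg⟩
      nlinarith [sq_nonneg ‖u‖]
    · have : k = 0 := by
        rcases mul_eq_zero.mp him with h | h
        · exact absurd h hzi
        · exact h
      rw [this] at hre; linarith
  have : u = 0 := by simpa using hu
  rw [this] at h
  exact he (by simpa using h.symm)

theorem resForm_conj (hK : K.IsPositive) {z : ℂ} (hz : z ∈ cutPlane)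
    (hz' : (starRingEnd ℂ) z ∈ cutPlane) :
    resForm K e ((starRingEnd ℂ) z) = (starRingEnd ℂ) (resForm K e z) := by
  have h := resVec_sub (e := e) (isUnit_one_sub_smul hK hz)
  have h' := resVec_sub (e := e) (isUnit_one_sub_smul hK hz')
  rw [resForm, resForm, inner_conj_symm]
  set u := resVec K e z
  set v := resVec K e ((starRingEnd ℂ) z)
  have hs : inner ℂ (K u) v = inner ℂ u (K v) := hK.isSymmetric u v
  calc inner ℂ e v = inner ℂ (u - z • K u) v := by rw [h]
    _ = inner ℂ u (v - (starRingEnd ℂ) z • K v) := by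
      rw [inner_sub_left, inner_sub_right, inner_smul_left, inner_smul_right, hs]
    _ = _ := by rw [h']

theorem differentiableAt_resForm {z : ℂ} (h : IsUnit (1 - z • K)) :
    DifferentiableAt ℂ (resForm K e) z := by
  have h1 : DifferentiableAt ℂ (fun z : ℂ => Ring.inverse (1 - z • K)) z :=
    DifferentiableAt.comp z (f := fun z : ℂ => 1 - z • K) (differentiableAt_inverse h)
      (by fun_prop)
  have h2 : DifferentiableAt ℂ (fun z : ℂ => Ring.inverse (1 - z • K) e) z :=
    h1.clm_apply (differentiableAt_const e)
  exact (innerSL ℂ e).differentiableAt.comp z h2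

theorem rank_kerSub_adjoint (hK : K.IsPositive) (he : e ≠ 0) {z : ℂ} (hz : z ∈ cutPlane) :
    Module.rank ℂ (kerSub (invRestrict K e).adjoint z) = 1 := by
  have hU := isUnit_one_sub_smul hK hz
  rw [rank_submodule_eq_one_iff]
  have h := resVec_sub (e := e) hU
  refine ⟨resVec K e z, (mem_adjoint_invRestrict hK.isSymmetric he).mpr ⟨1, ?_⟩, ?_, ?_⟩
  · rw [one_smul, map_smul]
    exact eq_add_of_sub_eq h
  · intro h0
    rw [h0] at h
    exact he (by simpa using h.symm)
  · intro u hu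
    obtain ⟨α, hα⟩ := (mem_adjoint_invRestrict hK.isSymmetric he).mp hu
    simp only [map_smul] at hα
    rw [Submodule.mem_span_singleton]
    refine ⟨α, ?_⟩
    rw [eq_inverse_apply hU (sub_eq_of_eq_add hα), map_smul, resVec]

theorem hasDeficiencyIndices_invRestrict (hK : K.IsPositive) (he : e ≠ 0) :
    HasDeficiencyIndices (invRestrict K e) 1 1 := by
  constructor <;> rw [Nat.cast_one] <;> refine rank_kerSub_adjoint hK he fun h => ?_
  · simp at h
  · simp at h

theorem isRegularPoint_kerExt (hK : K.IsPositive) (he : e ≠ 0) {z : ℂ} (hz : z ∈ cutPlane) :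
    IsRegularPoint (kerExt (invRestrict K e) (bdry₀ K e)) z := by
  have hU := isUnit_one_sub_smul hK hz
  have hz0 : z ≠ 0 := by rintro rfl; exact hz ⟨rfl, le_rfl⟩
  have hD := resForm_ne_zero hK he hz
  constructor
  · intro u hu
    obtain ⟨h1, α, h2⟩ := (mem_kerExt hK.isSymmetric he).mp hu
    simp only [map_smul] at h1 h2
    have hu' : u = α • resVec K e z := by
      rw [eq_inverse_apply hU (sub_eq_of_eq_add h2), map_smul, resVec]
    rw [inner_smul_right, hu', inner_smul_right] at h1
    have : α = 0 := by
      rcases mul_eq_zero.mp h1 with h | h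
      · exact absurd h hz0
      · exact (mul_eq_zero.mp h).resolve_right hD
    rw [hu', this, zero_smul]
  · intro h
    set v := Ring.inverse (1 - z • K) h
    have hv : v - z • K v = h := inverse_apply_sub hU h
    -- Since `(1 - z K) g = h + z α e`, the pair `(α e + K g, g)` is mapped to `h`. The value of `α`
    -- is the one making `g` orthogonal to `e`, and it exists because the form does not vanish.
    set α := -(inner ℂ e v) / (z * resForm K e z)
    set g := v + (z * α) • resVec K e z
    have hg : g - z • K g = h + (z * α) • e := by
      have h2 := resVec_sub (e := e) hU
      simp only [g, map_add, map_smul]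
      rw [← hv]
      nth_rewrite 3 [← h2]
      module
    refine ⟨(α • e + K g, g), (mem_kerExt hK.isSymmetric he).mpr ⟨?_, α, rfl⟩, ?_⟩
    · simp only [g, inner_add_right, inner_smul_right]
      change inner ℂ e v + z * α * resForm K e z = 0
      simp only [α]
      field_simp
      ring
    · change g - z • (α • e + K g) = h
      rw [smul_add, smul_smul, add_comm, ← sub_sub, hg, add_sub_cancel_right]

end LinRel

end

noncomputable section

/-! ### The Weyl function of a rank one restriction -/

theorem mem_cutPlane_of_im_ne_zero {z : ℂ} (h : z.im ≠ 0) : z ∈ cutPlane := fun h' => h h'.1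

theorem ofReal_mem_cutPlane {x : ℝ} (h : x < 0) : (x : ℂ) ∈ cutPlane :=
  fun h' => absurd h'.2 (by simpa using h)

theorem ne_zero_of_mem_cutPlane {z : ℂ} (hz : z ∈ cutPlane) : z ≠ 0 := by
  rintro rfl; exact hz ⟨rfl, le_rfl⟩

theorem IsStieltjes.congr {f g : ℂ → ℂ} (hf : IsStieltjes f) (h : EqOn g f cutPlane) :
    IsStieltjes g := by
  obtain ⟨h1, h2, h3, h4⟩ := hf
  refine ⟨h1.congr h, fun z hz => ?_, fun z hz => ?_, fun x hx => ?_⟩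
  · rw [h (mem_cutPlane_of_im_ne_zero hz.ne')]; exact h2 z hz
  · rw [h (mem_cutPlane_of_im_ne_zero hz), h (mem_cutPlane_of_im_ne_zero (by simpa using hz))]
    exact h3 z hz
  · rw [h (ofReal_mem_cutPlane hx)]; exact h4 x hx

/-- A criterion for Stieltjes functions: `f(z) = A - B / z` pointwise with `A, B ≥ 0`. -/
theorem isStieltjes_of_forall_exists {f : ℂ → ℂ} (hd : DifferentiableOn ℂ f cutPlane)
    (hc : ∀ z : ℂ, z.im ≠ 0 → f ((starRingEnd ℂ) z) = (starRingEnd ℂ) (f z))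
    (h : ∀ z ∈ cutPlane, ∃ A B : ℝ, 0 ≤ A ∧ 0 ≤ B ∧ f z = A - B / z) : IsStieltjes f := by
  refine ⟨hd, fun z hz => ?_, hc, fun x hx => ?_⟩
  · obtain ⟨A, B, hA, hB, e⟩ := h z (mem_cutPlane_of_im_ne_zero hz.ne')
    rw [e, Complex.sub_im, Complex.ofReal_im, Complex.div_im]
    simp only [Complex.ofReal_im, Complex.ofReal_re, zero_mul, zero_div, zero_sub, neg_neg]
    have := Complex.normSq_nonneg z
    positivity
  · obtain ⟨A, B, hA, hB, e⟩ := h x (ofReal_mem_cutPlane hx)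
    have e' : f x = ((A - B / x : ℝ) : ℂ) := by rw [e]; push_cast; rfl
    rw [e', Complex.ofReal_im, Complex.ofReal_re]
    have := div_nonpos_of_nonneg_of_nonpos hB hx.le
    exact ⟨rfl, by linarith⟩

namespace LinRel

variable {H : Type*} [NormedAddCommGroup H] [InnerProductSpace ℂ H] [CompleteSpace H]
variable {K : H →L[ℂ] H} {e : H}

/-- The Weyl function `-1 / (z ⟨(1 - z K)⁻¹ e, e⟩)`. -/
def weyl (K : H →L[ℂ] H) (e : H) (z : ℂ) : ℂ := -1 / (z * resForm K e z)

/-- Multiplying numerator and denominator by the conjugate of `D` and expanding it as `‖u‖² - z ⟨K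
u, u⟩` puts the function in the form `A - B / z`. The parameter `c` removes part of the pole at `0`.
-/
theorem weyl_eq (hK : K.IsPositive) (he : e ≠ 0) {z : ℂ} (hz : z ∈ cutPlane) (c : ℝ) :
    weyl K e z + c / z = ((inner ℂ (resVec K e z) (K (resVec K e z))).re /
      ‖resForm K e z‖ ^ 2 : ℝ) - ((‖resVec K e z‖ ^ 2 / ‖resForm K e z‖ ^ 2 - c : ℝ) : ℂ) / z := by
  have hz0 := ne_zero_of_mem_cutPlane hz
  have hD := resForm_ne_zero hK he hz
  have hE := congrArg (starRingEnd ℂ) (resForm_eq (e := e) hK hz)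
  rw [weyl]
  set D := resForm K e z
  set u := resVec K e z
  set k := (inner ℂ u (K u)).re
  simp only [map_sub, map_mul, Complex.conj_conj, Complex.conj_ofReal] at hE
  have hDD : ((‖D‖ ^ 2 : ℝ) : ℂ) = (starRingEnd ℂ) D * D := by
    rw [Complex.conj_mul', Complex.ofReal_pow]
  have hDc : (starRingEnd ℂ) D ≠ 0 := by simpa using hD
  rw [Complex.ofReal_sub, Complex.ofReal_div, Complex.ofReal_div, hDD]
  field_simp
  rw [hE]
  ring

theorem weyl_conj (hK : K.IsPositive) {z : ℂ} (hz : z.im ≠ 0) :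
    weyl K e ((starRingEnd ℂ) z) = (starRingEnd ℂ) (weyl K e z) := by
  rw [weyl, weyl, resForm_conj hK (mem_cutPlane_of_im_ne_zero hz)
    (mem_cutPlane_of_im_ne_zero (by simpa using hz))]
  simp

theorem differentiableOn_weyl (hK : K.IsPositive) (he : e ≠ 0) :
    DifferentiableOn ℂ (weyl K e) cutPlane := fun _ hz =>
  (DifferentiableAt.div (differentiableAt_const _)
    (differentiableAt_id.mul (differentiableAt_resForm (isUnit_one_sub_smul hK hz)))
    (mul_ne_zero (ne_zero_of_mem_cutPlane hz) (resForm_ne_zero hK he hz))).differentiableWithinAt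

/-- Nonnegativity of the coefficient of `-1 / z` is Cauchy-Schwarz: `|⟨u, e⟩|² ≤ ‖e‖² ‖u‖²`. -/
theorem isStieltjes_weyl_add (hK : K.IsPositive) (he : e ≠ 0) {c : ℝ} (hc : c * ‖e‖ ^ 2 ≤ 1) :
    IsStieltjes fun z => weyl K e z + c / z := by
  refine isStieltjes_of_forall_exists ?_ (fun z hz => ?_) fun z hz => ?_
  · exact (differentiableOn_weyl hK he).add (DifferentiableOn.div (differentiableOn_const _)
      differentiableOn_id fun _ hz => ne_zero_of_mem_cutPlane hz)
  · rw [weyl_conj hK hz]; simp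
  · refine ⟨_, _, ?_, ?_, weyl_eq hK he hz c⟩
    · exact div_nonneg (inner_apply_eq hK _).2 (sq_nonneg _)
    · have hD : 0 < ‖resForm K e z‖ ^ 2 := by
        have := norm_pos_iff.mpr (resForm_ne_zero hK he hz)
        positivity
      rw [sub_nonneg, le_div_iff₀ hD]
      have hcs : ‖resForm K e z‖ ≤ ‖e‖ * ‖resVec K e z‖ := norm_inner_le_norm _ _
      by_cases hc0 : 0 ≤ c
      · calc c * ‖resForm K e z‖ ^ 2 ≤ c * (‖e‖ * ‖resVec K e z‖) ^ 2 := by gcongr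
          _ = c * ‖e‖ ^ 2 * ‖resVec K e z‖ ^ 2 := by ring
          _ ≤ 1 * ‖resVec K e z‖ ^ 2 := by gcongr
          _ = _ := one_mul _
      · exact (mul_nonpos_of_nonpos_of_nonneg (not_le.mp hc0).le hD.le).trans (sq_nonneg _)

/-- At `z = 0` the form equals `‖e‖²` and is continuous there, so `z` times the Weyl function tends
to `-1 / ‖e‖²`. -/
theorem tendsto_mul_weyl_add (he : e ≠ 0) :
    Tendsto (fun y : ℝ => (y : ℂ) * (weyl K e (Complex.I * y) +
      ((‖e‖ ^ 2)⁻¹ : ℝ) / (Complex.I * y))) (𝓝[≠] 0) (𝓝 0) := by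
  have hee : (‖e‖ : ℂ) ^ 2 ≠ 0 := by simpa using he
  have h0 : resForm K e 0 = (‖e‖ : ℂ) ^ 2 := by
    simp [resForm, resVec, inner_self_eq_norm_sq_to_K]
  have hcont : ContinuousAt (resForm K e) 0 :=
    (differentiableAt_resForm (by simp)).continuousAt
  have hI : Tendsto (fun y : ℝ => Complex.I * (y : ℂ)) (𝓝[≠] 0) (𝓝 0) := by
    have : Continuous fun y : ℝ => Complex.I * (y : ℂ) := by fun_prop
    simpa using (this.tendsto 0).mono_left nhdsWithin_le_nhds
  have h1 : Tendsto (fun y : ℝ => -1 / (Complex.I * resForm K e (Complex.I * y)) +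
      ((‖e‖ ^ 2)⁻¹ : ℝ) / Complex.I) (𝓝[≠] 0) (𝓝 0) := by
    have h2 : Tendsto (fun y : ℝ => resForm K e (Complex.I * y)) (𝓝[≠] 0)
        (𝓝 ((‖e‖ : ℂ) ^ 2)) := h0 ▸ hcont.tendsto.comp hI
    have h3 := ((tendsto_const_nhds (x := (-1 : ℂ))).div (h2.const_mul Complex.I)
      (mul_ne_zero Complex.I_ne_zero hee)).add_const (((‖e‖ ^ 2)⁻¹ : ℝ) / Complex.I)
    have e0 : -1 / (Complex.I * (‖e‖ : ℂ) ^ 2) + ((‖e‖ ^ 2)⁻¹ : ℝ) / Complex.I = 0 := by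
      push_cast
      field_simp
      ring
    rw [e0] at h3
    exact h3
  refine h1.congr' ?_
  filter_upwards [self_mem_nhdsWithin] with y hy
  have hy' : (y : ℂ) ≠ 0 := by simpa using hy
  rw [weyl, mul_add, ← mul_div_assoc, ← mul_div_assoc]
  congr 1
  · rw [mul_comm Complex.I (y : ℂ), mul_assoc, mul_div_mul_left _ _ hy']
  · rw [mul_comm Complex.I (y : ℂ), mul_div_mul_left _ _ hy']

/-- At `z = -x` the form equals `d = ‖u‖² + x ⟨K u, u⟩` and the Weyl function is `1 / (x d)`. The
lower bound follows from `ρ x d² ≤ x ⟨K u, u⟩ ≤ d`. For the upper one, `u / d` minimizes `‖g‖² + x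
⟨K g, g⟩` under `⟨g, e⟩ = 1`, with minimum `1 / d`. -/
theorem weyl_neg_bounds (hK : K.IsPositive) (he : e ≠ 0) {x : ℝ} (hx : 0 < x) {ρ : ℝ}
    (hρ : ∀ f : H, ρ * ‖inner ℂ e f‖ ^ 2 ≤ (inner ℂ f (K f)).re) {f : H}
    (hf : inner ℂ e f = 1) : ∃ w : ℝ, weyl K e ((-x : ℝ) : ℂ) = w ∧ ρ ≤ w ∧
      w ≤ ‖f‖ ^ 2 / x + (inner ℂ f (K f)).re := by
  set z : ℂ := ((-x : ℝ) : ℂ) with hzdef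
  have hz : z ∈ cutPlane := ofReal_mem_cutPlane (by linarith)
  have hz0 := ne_zero_of_mem_cutPlane hz
  have hD := resForm_ne_zero hK he hz
  have hE := resForm_eq (e := e) hK hz
  have hw := weyl_eq hK he hz 0
  have hu := resVec_sub (e := e) (isUnit_one_sub_smul hK hz)
  have hρu := hρ (resVec K e z)
  change ρ * ‖resForm K e z‖ ^ 2 ≤ _ at hρu
  have hDdef : inner ℂ e (resVec K e z) = resForm K e z := rfl
  set D := resForm K e z
  set u := resVec K e z
  set k := (inner ℂ u (K u)).re
  have hk0 : 0 ≤ k := (inner_apply_eq hK u).2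
  set d : ℝ := ‖u‖ ^ 2 + x * k with hd
  have hDd : D = d := by
    rw [hE, hzdef, hd, Complex.conj_ofReal]; push_cast; ring
  have hd0 : 0 ≤ d := by positivity
  have hdpos : 0 < d := lt_of_le_of_ne hd0 fun h => hD (by rw [hDd, ← h]; simp)
  have hDn : ‖D‖ = d := by rw [hDd, Complex.norm_real, Real.norm_of_nonneg hd0]
  have hweyl : weyl K e z = ((1 / (x * d) : ℝ) : ℂ) := by
    change -1 / (z * D) = _
    rw [hDd, hzdef]; push_cast
    rw [neg_mul, neg_div_neg_eq]
  refine ⟨1 / (x * d), hweyl, ?_, ?_⟩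
  · rw [hDn] at hρu
    rw [le_div_iff₀ (by positivity)]
    have h1 : ρ * (x * d) * d ≤ 1 * d := by nlinarith [sq_nonneg ‖u‖]
    exact le_of_mul_le_mul_right h1 hdpos
  · have hv := hK.re_inner_nonneg_right (f - (d : ℂ)⁻¹ • u)
    have hK' := hK.isSymmetric
    have hsym : inner ℂ u (K f) = (starRingEnd ℂ) (inner ℂ f (K u)) := by
      rw [inner_conj_symm]; exact (hK' u f).symm
    have hfe : inner ℂ f e = 1 := by rw [← inner_conj_symm, hf, map_one]
    have h2 : inner ℂ f u + x * inner ℂ f (K u) = 1 := by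
      rw [← hfe, ← hu, inner_sub_right, inner_smul_right, hzdef]; push_cast; ring
    have h2re := congrArg Complex.re h2
    have e1 : (inner ℂ (f - (d : ℂ)⁻¹ • u) (K (f - (d : ℂ)⁻¹ • u))).re =
        (inner ℂ f (K f)).re - 2 * d⁻¹ * (inner ℂ f (K u)).re + d⁻¹ ^ 2 * k := by
      rw [map_sub, map_smul, inner_sub_left, inner_sub_right, inner_sub_right, inner_smul_left,
        inner_smul_left, inner_smul_right, inner_smul_right, hsym, ← Complex.ofReal_inv,
        Complex.conj_ofReal]
      simp only [Complex.sub_re, Complex.re_ofReal_mul, Complex.conj_re]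
      change _ - _ - (_ - d⁻¹ * (d⁻¹ * k)) = _
      ring
    have e2 : ‖f - (d : ℂ)⁻¹ • u‖ ^ 2 =
        ‖f‖ ^ 2 - 2 * d⁻¹ * (inner ℂ f u).re + d⁻¹ ^ 2 * ‖u‖ ^ 2 := by
      rw [norm_sub_sq (𝕜 := ℂ), inner_smul_right, ← Complex.ofReal_inv, norm_smul,
        Complex.norm_real, mul_pow, Real.norm_eq_abs, sq_abs]
      simp only [RCLike.re_to_complex, Complex.re_ofReal_mul]
      ring
    simp only [RCLike.re_to_complex] at hv
    rw [e1] at hv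
    have hv2 := sq_nonneg ‖f - (d : ℂ)⁻¹ • u‖
    rw [e2] at hv2
    simp only [Complex.add_re, Complex.re_ofReal_mul, Complex.one_re] at h2re
    set a := (inner ℂ f u).re
    set c := (inner ℂ f (K u)).re
    have h3 : 0 ≤ ‖f‖ ^ 2 + x * (inner ℂ f (K f)).re - d⁻¹ := by
      have h4 := add_nonneg hv2 (mul_nonneg hx.le hv)
      have h5 : ‖f‖ ^ 2 - 2 * d⁻¹ * a + d⁻¹ ^ 2 * ‖u‖ ^ 2 +
          x * ((inner ℂ f (K f)).re - 2 * d⁻¹ * c + d⁻¹ ^ 2 * k) =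
          ‖f‖ ^ 2 + x * (inner ℂ f (K f)).re - 2 * d⁻¹ * (a + x * c) +
            d⁻¹ ^ 2 * (‖u‖ ^ 2 + x * k) := by ring
      rw [h5, h2re, ← hd] at h4
      have h6 : d⁻¹ ^ 2 * d = d⁻¹ := by field_simp
      rw [h6] at h4
      linarith
    have h7 : 1 / (x * d) = d⁻¹ / x := by field_simp
    rw [h7, div_le_iff₀ hx, add_mul, div_mul_cancel₀ _ hx.ne']
    linarith

theorem tendsto_weyl_atBot (hK : K.IsPositive) (he : e ≠ 0) {ρ : ℝ}
    (hρ : ∀ f : H, ρ * ‖inner ℂ e f‖ ^ 2 ≤ (inner ℂ f (K f)).re)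
    (happrox : ∀ ε > 0, ∃ f : H, inner ℂ e f = 1 ∧ (inner ℂ f (K f)).re ≤ ρ + ε) :
    Tendsto (fun x : ℝ => weyl K e (x : ℂ)) atBot (𝓝 (ρ : ℂ)) := by
  rw [Metric.tendsto_nhds]
  intro ε hε
  obtain ⟨f, hf, hfρ⟩ := happrox (ε / 2) (by linarith)
  filter_upwards [eventually_lt_atBot (-(1 + ‖f‖ ^ 2 / (ε / 2)))] with x hx
  have h0 : 0 ≤ ‖f‖ ^ 2 / (ε / 2) := by positivity
  have hx0 : 0 < -x := by linarith
  obtain ⟨w, hw, hw1, hw2⟩ := weyl_neg_bounds hK he hx0 hρ hf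
  rw [neg_neg] at hw
  rw [hw, dist_eq_norm, ← Complex.ofReal_sub, Complex.norm_real, Real.norm_eq_abs, abs_lt]
  have h1 : ‖f‖ ^ 2 / (-x) < ε / 2 := by
    rw [div_lt_iff₀ hx0]
    have : ‖f‖ ^ 2 / (ε / 2) < -x := by linarith
    rw [div_lt_iff₀ (by linarith)] at this
    linarith
  constructor <;> linarith

/-- `weyl` is the Weyl function on the cut plane. -/
theorem IsWeylFunction.eq_weyl (hK : K.IsPositive) (he : e ≠ 0) {m : ℂ → ℂ}
    (hm : IsWeylFunction (invRestrict K e) (bdry₀ K e) (bdry₁ K e) m) :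
    EqOn m (weyl K e) cutPlane := by
  intro z hz
  have hz0 := ne_zero_of_mem_cutPlane hz
  have hD := resForm_ne_zero hK he hz
  have hu := resVec_sub (e := e) (isUnit_one_sub_smul hK hz)
  have hp : (resVec K e z, z • resVec K e z) ∈ (invRestrict K e).adjoint := by
    refine (mem_adjoint_invRestrict hK.isSymmetric he).mpr ⟨1, ?_⟩
    rw [one_smul, map_smul]
    exact eq_add_of_sub_eq hu
  have h := ((hm z (isRegularPoint_kerExt hK he hz) (m z)).mp rfl) ⟨_, hp⟩ rfl
  rw [bdry₁_apply he ⟨_, hp⟩ (α := 1) (by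
    rw [one_smul, map_smul]; exact eq_add_of_sub_eq hu), bdry₀_apply, inner_smul_right] at h
  rw [weyl, eq_div_iff (mul_ne_zero hz0 hD)]
  exact h

end LinRel

end

noncomputable section

namespace IntegralSystem

variable {S : IntegralSystem}

/-! ### The Neumann relation -/

theorem Definite.eq_zero (h : S.Definite) {α β : ℂ}
    (hae : ∀ᵐ x ∂S.dR₂, α + β * (S.R₁ x : ℂ) = 0) : α = 0 ∧ β = 0 := by
  obtain ⟨b₀, -, hb⟩ := h
  exact hb α β (ae_restrict_of_ae hae)

/-- An `L²` solution of the homogeneous system represents an element of `T_max`. -/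
theorem represents_of_solves {z : ℂ} {u₁ u₂ : ℝ → ℂ} (h : S.Solves u₁ u₂ fun t => z * u₁ t)
    (hu : MemLp u₁ 2 S.dR₂) : S.Represents (hu.toLp, z • hu.toLp) u₁ u₂ fun t => z * u₁ t := by
  refine ⟨⟨hu, hu.const_mul z, h⟩, hu.coeFn_toLp, ?_⟩
  filter_upwards [Lp.coeFn_smul z hu.toLp, hu.coeFn_toLp] with x a1 a2
  rw [a1, Pi.smul_apply, a2, smul_eq_mul]

/-- Divide `u₁ = u₁(0) + R₁ u₂ + ∫ f R₁ dR₂` by `R₁ → ∞`: the last integral stays bounded because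
`f` and `R₁` are both in `L²`. -/
theorem Solves.tendsto_div_R₁ (hj : S.NoCommonJumps) (hR : MemLp (fun x => (S.R₁ x : ℂ)) 2 S.dR₂)
    (hRt : Tendsto S.R₁ S.atEnd atTop) {u₁ u₂ f : ℝ → ℂ} (h : S.Solves u₁ u₂ f)
    (hf : MemLp f 2 S.dR₂) {γ : ℂ} (hγ : Tendsto u₂ S.atEnd (𝓝 γ)) :
    Tendsto (fun x => u₁ x / S.R₁ x) S.atEnd (𝓝 γ) := by
  have hi : Integrable (fun t => f t * S.R₁ t) S.dR₂ := hf.integrable_mul hR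
  have h1 := (tendsto_integral_Iio S.dR₂_ae_mem hi).const_add (u₁ 0)
  have hinv : Tendsto (fun x => ((S.R₁ x : ℂ))⁻¹) S.atEnd (𝓝 0) := by
    have := (Complex.continuous_ofReal.tendsto 0).comp hRt.inv_tendsto_atTop
    simpa [Function.comp_def] using this
  have h2 := hγ.add (h1.mul hinv)
  rw [mul_zero, add_zero] at h2
  refine h2.congr' ?_
  filter_upwards [S.eventually_mem_I, hRt.eventually_gt_atTop 0] with x hx hx0
  have : (S.R₁ x : ℂ) ≠ 0 := by exact_mod_cast hx0.ne'
  rw [(h.eq_R₁_mul hj hx).2]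
  field_simp
  ring

/-! ### The left endpoint of the support of `dR₂` and the right limit of `R₁` there. -/

theorem nonneg_of_mem_support {x : ℝ} (hx : x ∈ S.dR₂.support) : 0 ≤ x := by
  by_contra hneg
  have h1 := (Measure.mem_support_iff_forall _).mp hx (Iio 0) (Iio_mem_nhds (not_le.mp hneg))
  rw [dR₂_Iio S.zero_mem_I, S.zero₂] at h1
  simp at h1

theorem measure_Iio_sInf_support : S.dR₂ (Iio (sInf S.dR₂.support)) = 0 :=
  measure_mono_null (t := S.dR₂.supportᶜ) (fun _ hx hx' => absurd
    (csInf_le ⟨0, fun _ h => nonneg_of_mem_support h⟩ hx') (not_le.mpr hx))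
    Measure.measure_compl_support

theorem sInf_support_mem_I (h : S.dR₂ ≠ 0) : S.dR₂.support.Nonempty ∧
    sInf S.dR₂.support ∈ S.I := by
  have hne : S.dR₂.support.Nonempty := by
    by_contra hne
    have := Measure.measure_compl_support (μ := S.dR₂)
    rw [not_nonempty_iff_eq_empty.mp hne, compl_empty] at this
    exact h (Measure.measure_univ_eq_zero.mp this)
  refine ⟨hne, ?_⟩
  have h0 := measure_Iio_sInf_support (S := S)
  by_contra hI
  refine h (Measure.measure_univ_eq_zero.mp ?_)
  have hpos : 0 ≤ sInf S.dR₂.support := le_csInf hne fun x hx => nonneg_of_mem_support hx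
  have hb : S.b ≤ ((sInf S.dR₂.support : ℝ) : EReal) := by
    by_contra hlt
    exact hI ⟨hpos, not_le.mp hlt⟩
  rw [measure_eq_zero_iff_ae_notMem] at h0 ⊢
  filter_upwards [h0, S.dR₂_ae_mem] with x hx hxI
  exact absurd (show x < sInf S.dR₂.support by exact_mod_cast hxI.2.trans_le hb) hx

theorem tendsto_R₁_rightLim {a : ℝ} (ha : a ∈ S.I) :
    Tendsto S.R₁ (𝓝[>] a) (𝓝 (Function.rightLim S.R₁ a)) := by
  obtain ⟨y, hy, hay⟩ := exists_gt_mem_halfOpen ha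
  have hI : Ioo a y ⊆ S.I := fun t ht => halfOpen_of_le hy (ha.1.trans ht.1.le) ht.2.le
  refine tendsto_rightLim_of_tendsto ⟨_, MonotoneOn.tendsto_nhdsWithin_Ioo_right
    (nonempty_Ioo.mpr hay) (S.mono₁.mono hI) ⟨0, ?_⟩⟩
  rintro _ ⟨t, ht, rfl⟩
  exact R₁_nonneg (hI ht)

theorem dR₁_Iic {a : ℝ} (ha : a ∈ S.I) :
    S.dR₁ (Iic a) = ENNReal.ofReal (Function.rightLim S.R₁ a) := by
  obtain ⟨y, hy, hay⟩ := exists_gt_mem_halfOpen ha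
  have h1 := tendsto_measure_biInter_gt (μ := S.dR₁) (s := fun r : ℝ => Iio r) (a := a)
    (fun r _ => measurableSet_Iio.nullMeasurableSet) (fun i j _ hij => Iio_subset_Iio hij)
    ⟨y, hay, by rw [dR₁_Iio hy]; exact ENNReal.ofReal_ne_top⟩
  have h2 : ⋂ r > a, Iio r = Iic a := by
    ext t
    simp only [mem_iInter, mem_Iio, mem_Iic]
    exact ⟨fun h => le_of_forall_gt h, fun h r hr => lt_of_le_of_lt h hr⟩
  rw [h2] at h1
  refine tendsto_nhds_unique h1 ((ENNReal.tendsto_ofReal (tendsto_R₁_rightLim ha)).congr' ?_)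
  filter_upwards [Ioo_mem_nhdsGT hay] with t ht
  exact (dR₁_Iio (halfOpen_of_le hy (ha.1.trans ht.1.le) ht.2.le)).symm

variable [IsFiniteMeasure S.dR₂]

theorem Definite.one_ne_zero (h : S.Definite) : S.one ≠ 0 := by
  intro h0
  have : ∀ᵐ x ∂S.dR₂, (1 : ℂ) + 0 * (S.R₁ x : ℂ) = 0 := by
    have h1 := S.coeFn_one
    rw [h0] at h1
    filter_upwards [h1, Lp.coeFn_zero ℂ 2 S.dR₂] with x a1 a2
    rw [zero_mul, add_zero, ← a1, a2, Pi.zero_apply]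
  exact _root_.one_ne_zero (h.eq_zero this).1

theorem norm_one_sq : ‖S.one‖ ^ 2 = S.dR₂.real univ := by
  have h : inner ℂ S.one S.one = (S.dR₂.real univ : ℂ) := by
    rw [inner_one, integral_congr_ae S.coeFn_one]; simp
  rw [inner_self_eq_norm_sq_to_K] at h
  exact Complex.ofReal_injective (by rw [Complex.ofReal_pow]; exact h)

theorem greenOp_isPositive (hj : S.NoCommonJumps)
    (hR : MemLp (fun x => (S.R₁ x : ℂ)) 2 S.dR₂) : (greenOp hR).IsPositive := by
  have hsym : (greenOp hR).IsSymmetric := fun f g => by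
    change inner ℂ (greenOp hR f) g = inner ℂ f (greenOp hR g)
    rw [← inner_conj_symm, (inner_greenOp hj hR g f).2, (inner_greenOp hj hR f g).2,
      ← integral_conj]
    simp [mul_comm]
  refine ⟨hsym, fun f => ?_⟩
  change 0 ≤ RCLike.re (inner ℂ (greenOp hR f) f)
  rw [show inner ℂ (greenOp hR f) f = inner ℂ f (greenOp hR f) from hsym f f,
    (inner_greenOp hj hR f f).2]
  simp_rw [Complex.mul_conj]
  rw [integral_complex_ofReal]
  simpa using integral_nonneg fun s => Complex.normSq_nonneg (S.tail f s)

theorem inner_greenOp_self (hj : S.NoCommonJumps)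
    (hR : MemLp (fun x => (S.R₁ x : ℂ)) 2 S.dR₂) (f : S.L2) :
    Integrable (fun s => ‖S.tail f s‖ ^ 2) S.dR₁ ∧
      (inner ℂ f (greenOp hR f)).re = ∫ s, ‖S.tail f s‖ ^ 2 ∂S.dR₁ := by
  obtain ⟨h1, h2⟩ := inner_greenOp hj hR f f
  simp_rw [Complex.mul_conj'] at h1 h2
  constructor
  · refine h1.re.congr (Eventually.of_forall fun s => ?_)
    simp [← Complex.ofReal_pow]
  · rw [h2]
    simp_rw [← Complex.ofReal_pow]
    rw [integral_complex_ofReal, Complex.ofReal_re]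

theorem Represents.eq_of_tendsto (hR : MemLp (fun x => (S.R₁ x : ℂ)) 2 S.dR₂) {p : S.L2 × S.L2}
    {u₁ u₂ f : ℝ → ℂ} (h : S.Represents p u₁ u₂ f) (h0 : Tendsto u₂ S.atEnd (𝓝 0)) :
    p.1 = u₁ 0 • S.one + greenOp hR p.2 ∧ u₂ 0 = inner ℂ S.one p.2 := by
  obtain ⟨⟨-, hf, hs⟩, e1, e2⟩ := h
  have hfi := hf.integrable_two
  have hγ := tendsto_nhds_unique (hs.tendsto₂ hfi) h0
  refine ⟨?_, ?_⟩
  · apply Lp.ext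
    filter_upwards [e1, Lp.coeFn_add (u₁ 0 • S.one) (greenOp hR p.2), Lp.coeFn_smul (u₁ 0) S.one,
      S.coeFn_one, coeFn_greenOp hR p.2, S.dR₂_ae_mem] with x a1 a2 a3 a4 a5 hx
    rw [a1, a2, Pi.add_apply, a3, Pi.smul_apply, a4, a5, green_congr e2, (hs.eq_green hfi hx).1, hγ]
    simp
  · rw [inner_one, integral_congr_ae e2]
    exact sub_eq_zero.mp hγ

theorem represents_of_eq (hR : MemLp (fun x => (S.R₁ x : ℂ)) 2 S.dR₂) {p : S.L2 × S.L2} {α : ℂ}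
    (h : p.1 = α • S.one + greenOp hR p.2) : ∃ u₁ u₂ f, S.Represents p u₁ u₂ f ∧
      u₁ 0 = α ∧ u₂ 0 = inner ℂ S.one p.2 ∧ Tendsto u₂ S.atEnd (𝓝 0) := by
  have hf := integrable_coeFn p.2
  have hs := solves_green hf α 0
  have hae : p.1 =ᵐ[S.dR₂] fun x => α + S.green p.2 x + 0 * S.R₁ x := by
    rw [h]
    filter_upwards [Lp.coeFn_add (α • S.one) (greenOp hR p.2), Lp.coeFn_smul α S.one,
      S.coeFn_one, coeFn_greenOp hR p.2] with x a2 a3 a4 a5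
    rw [a2, Pi.add_apply, a3, Pi.smul_apply, a4, a5]
    simp
  refine ⟨_, _, _, ⟨⟨(Lp.memLp p.1).ae_eq hae, Lp.memLp p.2, hs⟩, hae, ae_eq_refl _⟩, ?_, ?_, ?_⟩
  · simp [green_zero]
  · simp [tail_zero hf, inner_one]
  · have := hs.tendsto₂ hf
    simpa [tail_zero hf] using this

theorem TN_eq (hR : MemLp (fun x => (S.R₁ x : ℂ)) 2 S.dR₂) :
    S.TN = LinRel.invRestrict (greenOp hR) S.one := by
  ext p
  constructor
  · rintro ⟨u₁, u₂, f, h, h1, h2, h3⟩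
    obtain ⟨e1, e2⟩ := h.eq_of_tendsto hR h3
    exact ⟨by rw [e1, h1, zero_smul, zero_add], by rw [← e2, h2]⟩
  · rintro ⟨h1, h2⟩
    obtain ⟨u₁, u₂, f, h, k1, k2, k3⟩ := represents_of_eq hR (p := p) (α := 0) (by simpa using h1)
    exact ⟨u₁, u₂, f, h, k1, k2.trans h2, k3⟩

theorem mem_adjoint_iff (hj : S.NoCommonJumps) (hd : S.Definite)
    (hR : MemLp (fun x => (S.R₁ x : ℂ)) 2 S.dR₂) (p : S.L2 × S.L2) :
    p ∈ (LinRel.invRestrict (greenOp hR) S.one).adjoint ↔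
      ∃ u₁ u₂ f, S.Represents p u₁ u₂ f ∧ Tendsto u₂ S.atEnd (𝓝 0) := by
  rw [LinRel.mem_adjoint_invRestrict (greenOp_isPositive hj hR).isSymmetric hd.one_ne_zero]
  constructor
  · rintro ⟨α, h⟩
    obtain ⟨u₁, u₂, f, k, -, -, k3⟩ := represents_of_eq hR h
    exact ⟨u₁, u₂, f, k, k3⟩
  · rintro ⟨u₁, u₂, f, h, h3⟩
    exact ⟨_, (h.eq_of_tendsto hR h3).1⟩

/-- Different triples might represent the same pair. Comparing any of them with `α e + K f` leaves
`(u₁(0) - α) + u₂(b) R₁ = 0` almost everywhere, and definiteness forces `u₂(b) = 0`. This is what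
makes the boundary maps well defined. -/
theorem tendsto_of_mem_adjoint (hj : S.NoCommonJumps) (hd : S.Definite)
    (hR : MemLp (fun x => (S.R₁ x : ℂ)) 2 S.dR₂) {p : S.L2 × S.L2}
    (hp : p ∈ (LinRel.invRestrict (greenOp hR) S.one).adjoint) {u₁ u₂ f : ℝ → ℂ}
    (h : S.Represents p u₁ u₂ f) : Tendsto u₂ S.atEnd (𝓝 0) := by
  obtain ⟨α, hα⟩ := (LinRel.mem_adjoint_invRestrict (greenOp_isPositive hj hR).isSymmetric
    hd.one_ne_zero).mp hp
  obtain ⟨⟨-, hf, hs⟩, e1, e2⟩ := h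
  have hfi := hf.integrable_two
  have hlim := hs.tendsto₂ hfi
  have hae : ∀ᵐ x ∂S.dR₂, (u₁ 0 - α) + (u₂ 0 - ∫ t, f t ∂S.dR₂) * (S.R₁ x : ℂ) = 0 := by
    have hsum := Lp.coeFn_add (α • S.one) (greenOp hR p.2)
    rw [← hα] at hsum
    filter_upwards [e1, hsum, Lp.coeFn_smul α S.one,
      S.coeFn_one, coeFn_greenOp hR p.2, S.dR₂_ae_mem] with x a1 a2 a3 a4 a5 hx
    rw [a1, Pi.add_apply, a3, Pi.smul_apply, a4, a5, green_congr e2, (hs.eq_green hfi hx).1,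
      smul_eq_mul] at a2
    linear_combination a2
  rwa [(hd.eq_zero hae).2] at hlim

theorem bdry_eq (hj : S.NoCommonJumps) (hd : S.Definite)
    (hR : MemLp (fun x => (S.R₁ x : ℂ)) 2 S.dR₂)
    (p : (LinRel.invRestrict (greenOp hR) S.one).adjoint) {u₁ u₂ f : ℝ → ℂ}
    (h : S.Represents p u₁ u₂ f) : LinRel.bdry₀ (greenOp hR) S.one p = u₂ 0 ∧
      LinRel.bdry₁ (greenOp hR) S.one p = -u₁ 0 := by
  obtain ⟨e1, e2⟩ := h.eq_of_tendsto hR (tendsto_of_mem_adjoint hj hd hR p.2 h)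
  exact ⟨by rw [LinRel.bdry₀_apply, e2], LinRel.bdry₁_apply hd.one_ne_zero p e1⟩

/-! ### The Neumann `m`-function -/

theorem tendsto_c₂ (hR : MemLp (fun x => (S.R₁ x : ℂ)) 2 S.dR₂) (z : ℂ) :
    Tendsto (S.c₂ z) S.atEnd (𝓝 (S.c₂b z)) := tendsto_sol₂ hR z 1 0

theorem tendsto_s₂ (hR : MemLp (fun x => (S.R₁ x : ℂ)) 2 S.dR₂) (z : ℂ) :
    Tendsto (S.s₂ z) S.atEnd (𝓝 (S.s₂b z)) := tendsto_sol₂ hR z 0 1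

/-- If `c₂(b) = 0`, then `c` lies in the kernel of `A₀ - z`, because `c₂(0) = 0`. Regularity makes
its class zero, and the representation `c₁(0) e + K (z c₁)` then reduces to `e = 0`. -/
theorem c₂b_ne_zero (hj : S.NoCommonJumps) (hd : S.Definite)
    (hR : MemLp (fun x => (S.R₁ x : ℂ)) 2 S.dR₂) {z : ℂ}
    (hz : LinRel.IsRegularPoint (LinRel.kerExt (LinRel.invRestrict (greenOp hR) S.one)
      (LinRel.bdry₀ (greenOp hR) S.one)) z) : S.c₂b z ≠ 0 := by
  intro h0
  have hc := (wellPosed hR z 1 0).1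
  have hrep := represents_of_solves hc.1 (memLp_sol hR z 1 0)
  set p := (memLp_sol hR z 1 0).toLp
  have hlim := tendsto_c₂ hR z
  rw [h0] at hlim
  obtain ⟨e1, e2⟩ := hrep.eq_of_tendsto hR hlim
  have hp : p = 0 := hz.1 p ((LinRel.mem_kerExt (greenOp_isPositive hj hR).isSymmetric
    hd.one_ne_zero).mpr ⟨by rw [← e2, hc.2.2], _, e1⟩)
  simp only at e1
  rw [hp, hc.2.1, smul_zero, map_zero, one_smul, add_zero] at e1
  exact hd.one_ne_zero e1.symm

theorem isWeylFunction_neumannM (hj : S.NoCommonJumps) (hd : S.Definite)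
    (hR : MemLp (fun x => (S.R₁ x : ℂ)) 2 S.dR₂) :
    LinRel.IsWeylFunction (LinRel.invRestrict (greenOp hR) S.one) (LinRel.bdry₀ (greenOp hR) S.one)
      (LinRel.bdry₁ (greenOp hR) S.one) S.neumannM := by
  intro z hz w
  have hc0 := c₂b_ne_zero hj hd hR hz
  have hc := (wellPosed hR z 1 0).1
  have hs := (wellPosed hR z 0 1).1
  have hcomb : ∀ α β : ℂ, S.Solves (α • (S.c₁ z) + β • (S.s₁ z)) (α • (S.c₂ z) + β • (S.s₂ z))
      fun t => z * (α • (S.c₁ z) + β • (S.s₁ z)) t := fun α β => by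
    have := (hc.1.smul α).add (hs.1.smul β)
    have e : (α • fun t => z * (S.sol z 1 0).1 t) + (β • fun t => z * (S.sol z 0 1).1 t) =
        fun t => z * (α • (S.c₁ z) + β • (S.s₁ z)) t := by
      ext t
      simp only [Pi.add_apply, Pi.smul_apply, smul_eq_mul, c₁, s₁]
      ring
    rwa [e] at this
  have hc10 : S.c₁ z 0 = 1 := hc.2.1
  have hc20 : S.c₂ z 0 = 0 := hc.2.2
  have hs10 : S.s₁ z 0 = 0 := hs.2.1
  have hs20 : S.s₂ z 0 = 1 := hs.2.2
  have hlim : ∀ α β : ℂ, Tendsto (α • (S.c₂ z) + β • (S.s₂ z)) S.atEnd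
      (𝓝 (α * S.c₂b z + β * S.s₂b z)) := fun α β =>
    ((tendsto_c₂ hR z).const_mul α).add ((tendsto_s₂ hR z).const_mul β)
  constructor
  · rintro rfl p hp
    obtain ⟨u₁, u₂, f, h, h0⟩ := (mem_adjoint_iff hj hd hR p).mp p.2
    obtain ⟨e1, e2⟩ := bdry_eq hj hd hR p h
    rw [e1, e2]
    have hsol : S.Solves u₁ u₂ fun t => z * u₁ t := by
      refine h.1.2.2.congr_rhs ?_
      have h3 := h.2.2
      rw [hp] at h3
      filter_upwards [h3, h.2.1, Lp.coeFn_smul z (p : S.L2 × S.L2).1] with t a1 a2 a3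
      rw [← a1, a3, Pi.smul_apply, a2, smul_eq_mul]
    have heq := (hsol.eqOn (hcomb (u₁ 0) (u₂ 0)) (by simp [hc10, hs10])
      (by simp [hc20, hs20])).2
    -- By uniqueness the solution is `u₁(0) c + u₂(0) s`; taking the limit of its second component
    -- gives the relation between the boundary values.
    have h4 : u₁ 0 * S.c₂b z + u₂ 0 * S.s₂b z = 0 := by
      refine tendsto_nhds_unique ((hlim (u₁ 0) (u₂ 0)).congr' ?_) h0
      filter_upwards [S.eventually_mem_I] with x hx using (heq hx).symm
    rw [neumannM, div_mul_eq_mul_div, div_eq_iff hc0]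
    linear_combination h4
  · intro h
    -- For uniqueness of the Weyl value, the test element is `-s₂(b) c + c₂(b) s`: its second
    -- component tends to `0`, and `u₂(0) = c₂(b)` is nonzero.
    have hL : MemLp ((-S.s₂b z) • (S.c₁ z) + S.c₂b z • (S.s₁ z)) 2 S.dR₂ :=
      ((memLp_sol hR z 1 0).const_smul _).add ((memLp_sol hR z 0 1).const_smul _)
    have hrep := represents_of_solves (hcomb (-S.s₂b z) (S.c₂b z)) hL
    have h0 := hlim (-S.s₂b z) (S.c₂b z)
    rw [show -S.s₂b z * S.c₂b z + S.c₂b z * S.s₂b z = 0 by ring] at h0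
    have hp := (mem_adjoint_iff hj hd hR _).mpr ⟨_, _, _, hrep, h0⟩
    obtain ⟨e1, e2⟩ := bdry_eq hj hd hR ⟨_, hp⟩ hrep
    have := h ⟨_, hp⟩ rfl
    rw [e1, e2] at this
    simp only [Pi.add_apply, Pi.smul_apply, smul_eq_mul, hc10, hc20, hs10, hs20] at this
    rw [neumannM, eq_div_iff hc0]
    linear_combination this

theorem principalCoeffEq (hj : S.NoCommonJumps) (hR : MemLp (fun x => (S.R₁ x : ℂ)) 2 S.dR₂)
    (hRt : Tendsto S.R₁ S.atEnd atTop) {z : ℂ} (hz : S.c₂b z ≠ 0) :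
    S.PrincipalCoeffEq z (S.neumannM z) := by
  have hc := Solves.tendsto_div_R₁ hj hR hRt (wellPosed hR z 1 0).1.1
    ((memLp_sol hR z 1 0).const_mul z) (tendsto_c₂ hR z)
  have hs := Solves.tendsto_div_R₁ hj hR hRt (wellPosed hR z 0 1).1.1
    ((memLp_sol hR z 0 1).const_mul z) (tendsto_s₂ hR z)
  refine ⟨?_, (hs.div hc hz).congr' ?_⟩
  · filter_upwards [hc.eventually_ne hz] with x hx h0
    exact hx (by rw [c₁] at h0; simp [h0])
  · filter_upwards [hRt.eventually_gt_atTop 0] with x hx0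
    have : (S.R₁ x : ℂ) ≠ 0 := by exact_mod_cast hx0.ne'
    exact div_div_div_cancel_right₀ this _ _

/-! ### The limit at `-∞` -/

/-- No `dR₂`-mass lies left of `a`, so the tail of `f` equals `∫ f dR₂` on all of `(-∞, a]`, and
`dR₁ (-∞, a] = R₁₊(a)`. -/
theorem rightLim_mul_le_inner (hj : S.NoCommonJumps) (hR : MemLp (fun x => (S.R₁ x : ℂ)) 2 S.dR₂)
    (h : S.dR₂ ≠ 0) (f : S.L2) : Function.rightLim S.R₁ (sInf S.dR₂.support) *
      ‖inner ℂ S.one f‖ ^ 2 ≤ (inner ℂ f (greenOp hR f)).re := by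
  obtain ⟨hi, he⟩ := inner_greenOp_self hj hR f
  have ha := (sInf_support_mem_I h).2
  have h0 := measure_Iio_sInf_support (S := S)
  set a := sInf S.dR₂.support
  have hρ : S.dR₁.real (Iic a) = Function.rightLim S.R₁ a := by
    rw [Measure.real, dR₁_Iic ha, ENNReal.toReal_ofReal]
    obtain ⟨y, hy, hay⟩ := exists_gt_mem_halfOpen ha
    refine ge_of_tendsto (tendsto_R₁_rightLim ha) ?_
    filter_upwards [Ioo_mem_nhdsGT hay] with t ht
    exact R₁_nonneg (halfOpen_of_le hy (ha.1.trans ht.1.le) ht.2.le)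
  have htail : ∀ s ∈ Iic a, S.tail f s = inner ℂ S.one f := fun s hs => by
    rw [tail_eq_sub (integrable_coeFn f), inner_one, setIntegral_measure_zero, sub_zero]
    exact measure_mono_null (Iio_subset_Iio hs) h0
  rw [he]
  calc _ = ∫ s in Iic a, ‖S.tail f s‖ ^ 2 ∂S.dR₁ := by
        rw [setIntegral_congr_fun measurableSet_Iic (g := fun _ => ‖inner ℂ S.one f‖ ^ 2)
          (fun s hs => by simp only [htail s hs]), setIntegral_const, hρ, smul_eq_mul]
    _ ≤ _ := setIntegral_le_integral hi (Eventually.of_forall fun s => sq_nonneg _)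

/-- Take the indicator of `(-∞, c)`, normalized to integral one, with `c` slightly right of `a`. Its
tail is at most `1` in modulus and vanishes from `c` on, so the form is at most `R₁(c)`, which is
close to `R₁₊(a)`. -/
theorem exists_inner_le_rightLim_add (hj : S.NoCommonJumps)
    (hR : MemLp (fun x => (S.R₁ x : ℂ)) 2 S.dR₂) (h : S.dR₂ ≠ 0) {ε : ℝ} (hε : 0 < ε) :
    ∃ f : S.L2, inner ℂ S.one f = 1 ∧ (inner ℂ f (greenOp hR f)).re ≤
      Function.rightLim S.R₁ (sInf S.dR₂.support) + ε := by
  obtain ⟨hne, ha⟩ := sInf_support_mem_I h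
  set a := sInf S.dR₂.support with hadef
  obtain ⟨y, hy, hay⟩ := exists_gt_mem_halfOpen ha
  obtain ⟨c, hc1, hc2⟩ := (((tendsto_R₁_rightLim ha).eventually
    (gt_mem_nhds (lt_add_of_pos_right _ hε))).and (Ioo_mem_nhdsGT hay)).exists
  have hc : c ∈ S.I := halfOpen_of_le hy (ha.1.trans hc2.1.le) hc2.2.le
  obtain ⟨t, ht, htc⟩ := exists_lt_of_csInf_lt hne hc2.1
  have hpos : 0 < S.dR₂ (Iio c) :=
    (Measure.mem_support_iff_forall _).mp ht (Iio c) (Iio_mem_nhds htc)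
  set M := S.dR₂.real (Iio c) with hM
  have hM0 : 0 < M := ENNReal.toReal_pos hpos.ne' (measure_ne_top _ _)
  have hMc : (M : ℂ) ≠ 0 := by exact_mod_cast hM0.ne'
  set f : S.L2 := indicatorConstLp 2 (measurableSet_Iio (a := c)) (measure_ne_top S.dR₂ _)
    ((M : ℂ)⁻¹) with hf
  have hfc : f =ᵐ[S.dR₂] (Iio c).indicator fun _ => (M : ℂ)⁻¹ := indicatorConstLp_coeFn
  have hfi := integrable_coeFn f
  have hnorm : ∫ t, ‖f t‖ ∂S.dR₂ = 1 := by
    have : (fun t => ‖f t‖) =ᵐ[S.dR₂] (Iio c).indicator fun _ => M⁻¹ := by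
      filter_upwards [hfc] with t ht
      rw [ht, norm_indicator_eq_indicator_norm]
      simp [abs_of_pos hM0]
    rw [integral_congr_ae this, integral_indicator measurableSet_Iio, setIntegral_const, smul_eq_mul,
      ← hM, mul_inv_cancel₀ hM0.ne']
  refine ⟨f, ?_, ?_⟩
  · rw [inner_one, integral_congr_ae hfc, integral_indicator measurableSet_Iio, setIntegral_const,
      ← hM, Complex.real_smul, mul_inv_cancel₀ hMc]
  · have htail : ∀ s, s ∉ Iio c → ‖S.tail f s‖ ^ 2 = 0 := fun s hs => by
      have : S.tail f s = 0 := by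
        rw [tail_congr hfc, tail]
        refine setIntegral_eq_zero_of_forall_eq_zero fun t ht => ?_
        have : t ∉ Iio c := fun h => hs (mem_Iio.mpr (lt_of_le_of_lt (mem_Ici.mp ht) (mem_Iio.mp h)))
        simp [indicator_of_notMem this]
      simp [this]
    rw [(inner_greenOp_self hj hR f).2, ← setIntegral_eq_integral_of_forall_compl_eq_zero htail]
    have hb : ‖∫ s in Iio c, ‖S.tail f s‖ ^ 2 ∂S.dR₁‖ ≤ 1 * S.dR₁.real (Iio c) := by
      refine norm_setIntegral_le_of_norm_le_const (by rw [dR₁_Iio hc]; exact ENNReal.ofReal_lt_top)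
        fun s _ => ?_
      have := norm_tail_le hfi s
      rw [hnorm] at this
      rw [norm_pow, norm_norm]
      exact pow_le_one₀ (norm_nonneg _) this
    rw [one_mul, real_dR₁_Iio hc] at hb
    exact (le_abs_self _).trans (hb.trans hc1.le)

end IntegralSystem

end

/-! ### Assembly of the theorem from the abstract model. -/

theorem mainTheorem3 (S : IntegralSystem) (hjump : S.NoCommonJumps) (hdef : S.Definite)
    (hsing : S.IsSingular) (hlc : S.IsLimitCircle) :
    -- the solutions `c`, `s` and the limits `c₂(b, z)`, `s₂(b, z)` are well defined
    S.WellPosed ∧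
    (∀ z : ℂ, Tendsto (S.c₂ z) S.atEnd (𝓝 (S.c₂b z)) ∧
      Tendsto (S.s₂ z) S.atEnd (𝓝 (S.s₂b z))) ∧
    -- (i)
    LinRel.IsSymm S.TN ∧ LinRel.IsNonneg S.TN ∧ LinRel.HasDeficiencyIndices S.TN 1 1 ∧
    -- the adjoint of `T_N` is given by the condition `u₂(b) = 0`
    (∀ p : S.L2 × S.L2, p ∈ S.TN.adjoint ↔
      ∃ u₁ u₂ f, S.Represents p u₁ u₂ f ∧ Tendsto u₂ S.atEnd (𝓝 0)) ∧
    -- (ii)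
    (∃ Γ₀ Γ₁ : S.TN.adjoint →ₗ[ℂ] ℂ,
      (∀ (p : S.TN.adjoint) (u₁ u₂ f : ℝ → ℂ), S.Represents p u₁ u₂ f →
        Γ₀ p = u₂ 0 ∧ Γ₁ p = -u₁ 0) ∧
      LinRel.IsBoundaryTriple S.TN Γ₀ Γ₁ ∧
      -- (iii)
      (∀ z ∈ cutPlane, LinRel.IsRegularPoint (LinRel.kerExt S.TN Γ₀) z) ∧
      (∀ z : ℂ, LinRel.IsRegularPoint (LinRel.kerExt S.TN Γ₀) z → S.c₂b z ≠ 0) ∧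
      LinRel.IsWeylFunction S.TN Γ₀ Γ₁ S.neumannM ∧
      -- (iv)
      (∀ z : ℂ, LinRel.IsRegularPoint (LinRel.kerExt S.TN Γ₀) z →
        S.PrincipalCoeffEq z (S.neumannM z))) ∧
    IsStieltjes S.neumannM ∧
    Tendsto (fun x : ℝ => S.neumannM (x : ℂ)) atBot
      (𝓝 ((Function.rightLim S.R₁ (sInf S.dR₂.support) : ℝ) : ℂ)) ∧
    -- (v)
    (∃ R₂b : ℝ, 0 < R₂b ∧ Tendsto S.R₂ S.atEnd (𝓝 R₂b) ∧
      ∃ m : ℂ → ℂ, IsStieltjes m ∧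
        (∀ z ∈ cutPlane, S.neumannM z = -1 / ((R₂b : ℂ) * z) + m z) ∧
        Tendsto (fun y : ℝ => (y : ℂ) * m (Complex.I * (y : ℂ))) (𝓝[≠] 0) (𝓝 0)) := by
  have : IsFiniteMeasure S.dR₂ := hlc.isFiniteMeasure hjump
  have hR := hlc.memLp_R₁ hjump
  have hK := IntegralSystem.greenOp_isPositive hjump hR
  have he := hdef.one_ne_zero
  have hN := IntegralSystem.norm_one_sq (S := S)
  have hN0 : 0 < S.dR₂.real univ := by
    rw [← hN]; have := norm_pos_iff.mpr he; positivity
  have hμ : S.dR₂ ≠ 0 := fun h => by simp [h] at hN0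
  have hW := IntegralSystem.isWeylFunction_neumannM hjump hdef hR
  have hm := LinRel.IsWeylFunction.eq_weyl hK he hW
  rw [IntegralSystem.TN_eq hR]
  refine ⟨IntegralSystem.wellPosed hR,
    fun z => ⟨IntegralSystem.tendsto_c₂ hR z, IntegralSystem.tendsto_s₂ hR z⟩,
    LinRel.isSymm_invRestrict hK.isSymmetric he, LinRel.isNonneg_invRestrict hK,
    LinRel.hasDeficiencyIndices_invRestrict hK he,
    IntegralSystem.mem_adjoint_iff hjump hdef hR,
    ⟨_, _, fun p u₁ u₂ f h => IntegralSystem.bdry_eq hjump hdef hR p h,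
      LinRel.isBoundaryTriple_invRestrict hK.isSymmetric he,
      fun z hz => LinRel.isRegularPoint_kerExt hK he hz,
      fun z hz => IntegralSystem.c₂b_ne_zero hjump hdef hR hz, hW,
      fun z hz => IntegralSystem.principalCoeffEq hjump hR hsing.tendsto_R₁
        (IntegralSystem.c₂b_ne_zero hjump hdef hR hz)⟩, ?_, ?_,
    S.dR₂.real univ, hN0, IntegralSystem.tendsto_R₂, fun z =>
      LinRel.weyl (IntegralSystem.greenOp hR) S.one z + ((‖S.one‖ ^ 2)⁻¹ : ℝ) / z, ?_, ?_, ?_⟩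
  · refine (LinRel.isStieltjes_weyl_add hK he (c := 0) (by simp)).congr fun z hz => ?_
    rw [hm hz]; simp
  · refine (LinRel.tendsto_weyl_atBot hK he (IntegralSystem.rightLim_mul_le_inner hjump hR hμ)
      fun ε hε => IntegralSystem.exists_inner_le_rightLim_add hjump hR hμ hε).congr' ?_
    filter_upwards [eventually_lt_atBot 0] with x hx
    exact (hm (ofReal_mem_cutPlane hx)).symm
  -- The constant `1 / ‖e‖² = 1 / R₂(b)` meets the Cauchy-Schwarz condition with equality, so the
  -- whole pole at `0` can be split off.
  · refine LinRel.isStieltjes_weyl_add hK he ?_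
    rw [hN, inv_mul_cancel₀ hN0.ne']
  · intro z hz
    have hz0 := ne_zero_of_mem_cutPlane hz
    have hNc : (S.dR₂.real univ : ℂ) ≠ 0 := by exact_mod_cast hN0.ne'
    rw [hm hz, hN]
    push_cast
    field_simp
    ring
  · exact LinRel.tendsto_mul_weyl_add he
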